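/- **Lemma 5.3.** Let $0<\beta<1$, $\theta>0$, $\alpha=-\frac{1}{\theta(1-\beta)}$. Let $\mathcal X$ be a measurable space with countably generated $\sigma$-algebra (e.g. any subset of $\mathbb R^d$ with its Borel sets), $Q$ a Markov kernel on $\mathcal X$ and $Q_0$ a stationary probability distribution of $Q$. Write $Q_0\otimes Q$ for the law of $(X_t,X_{t+1})$, and $\mathbb E^Q[f(X_t,X_{t+1})|X_t=x]=\int f(x,y)\,Q(dy|x)$. For $s\ge 1$ and a probability measure $\mu$ let $\phi_s(x)=e^{x^s}-1$, $\|f\|_{L^{\phi_s}(\mu)}=\inf\{c>0:\int\phi_s(|f|/c)\,d\mu\le 1\}$, $L^{\phi_s}(\mu)=\{f \text{ measurable}:\|f\|_{L^{\phi_s}(\mu)}<\infty\}$ and $E^{\phi_s}(\mu)=\{f\in L^{\phi_s}(\mu):\int\phi_s(|f|/c)\,d\mu<\infty\ \text{for all } c>0\}$, with functions equal $\mu$-a.e. identified. Write $L^{\phi_s},E^{\phi_s}$ if $\mu=Q_0$ and $L^{\phi_s}_2,E^{\phi_s}_2$ if $\mu=Q_0\otimes Q$, and $\|\cdot\|_{\phi_s}$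 for the norm in both cases. Assume (Assumption U) that $u\in E^{\phi_r}_2$ for some $r>1$, and let $v\in E^{\phi_r}$ be the fixed point ($Q_0$-a.e.) of $\mathbb Tf(x)=\beta\log\mathbb E^Q[e^{f(X_{t+1})+\alpha u(X_t,X_{t+1})}|X_t=x]$. For a function $g$ of $(x_0,x_1)$ put $$m_g=\frac{e^{g+\alpha u}}{\mathbb E^Q[e^{g(X_t,X_{t+1})+\alpha u(X_t,X_{t+1})}|X_t]},\qquad \mathbb D_gf(x)=\beta\,\mathbb E_gf(x)=\beta\,\mathbb E^Q[m_g(X_t,X_{t+1})f(X_t,X_{t+1})|X_t=x],$$ where a function of one variable (such as $v$, or an $f$ on $\mathcal X$) is read as a function of $x_1$. For $\eta\in L_2^{\phi_1}$ put $\kappa_\eta(x)=\log\mathbb E^Q[e^{\eta(X_t,X_{t+1})}|X_t=x]$. Assume that * $\eta\mapsto\kappa_\eta$, from $L^{\phi_1}_2$ to $L^{\phi_1}$, is Fréchet differentiable at $\eta=0$; * $\|\mathbb D_{h+v}-\mathbb D_v\|_{L^{\phi_1}}\to0$ as $\|h\|_{\phi_1}\to0$, $h\in L^{\phi_1}_2$,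 where $\|\mathbb K\|_{L^{\phi_1}}=\sup\{\|\mathbb Kf\|_{\phi_1}:f\in L^{\phi_1},\|f\|_{\phi_1}\le1\}$. Let $M<\infty$ satisfy $M\ge\mathbb E^{Q_0\otimes Q}[\exp(|\frac{\alpha}{1-\beta}u(X_t,X_{t+1})|^r)]$ and let $p>1$. For a Markov kernel $\hat Q$ on $\mathcal X$ with $Q(\cdot|x)\ll\hat Q(\cdot|x)\ll Q(\cdot|x)$ for every $x$, put $\hat\ell(x_0,x_1)=\log\frac{d\hat Q(\cdot|x_0)}{dQ(\cdot|x_0)}(x_1)$ and $\hat\eta(x_0,x_1)=\hat\ell(x_0,x_1)-\mathbb E^Q[\hat\ell(X_t,X_{t+1})|X_t=x_0]$. Say that such a $\hat Q$ satisfies AM2 (with constants $M,p$) if (a) or (b) holds: * (a) $\hat\ell\in E^{\phi_r}_2$, $\|\hat\ell\|_{\phi_r}\le M$ and $\mathbb E^{Q_0\otimes Q}[\exp(|\frac1{1-\beta}(\hat\ell+\alpha u)(X_t,X_{t+1})|^r)]\le M$; * (b) $\hat\ell\in L^{\phi_1}_2$ and $\hat Q$ has a stationary probability distribution $\hat Q_0$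 with $Q_0\ll\hat Q_0\ll Q_0$ such that, with $\hat\Delta=\frac{d\hat Q_0}{dQ_0}$ and $\hat\Delta_2=\frac{d(\hat Q_0\otimes\hat Q)}{d(Q_0\otimes Q)}$, the expectations $\mathbb E^{Q_0}[\hat\Delta^p]$, $\mathbb E^{Q_0}[\hat\Delta^{1-p}]$ and $\mathbb E^{Q_0\otimes Q}[\hat\Delta_2^p]$ are all at most $M$. For such $\hat Q$ let $\hat v\in E^{\phi_r}$ be the fixed point ($Q_0$-a.e.) of $\hat{\mathbb T}f(x)=\beta\log\mathbb E^{\hat Q}[e^{f(X_{t+1})+\alpha u(X_t,X_{t+1})}|X_t=x]$. Then for every $\hat Q$ satisfying AM2 the series $\sum_{n\ge1}(\beta\mathbb E_v)^n\hat\eta$ converges in $L^{\phi_1}$, and $$\hat v-v=\sum_{n=1}^\infty(\beta\mathbb E_v)^n\hat\eta+o(\|\hat\eta\|_{\phi_1}),$$ that is: for every $\varepsilon>0$ there is $\delta>0$ such that for every $\hat Q$ satisfying AM2 with $\|\hat\eta\|_{\phi_1}\le\delta$, $$\Big\|\hat v-v-\sum_{n=1}^\infty(\beta\mathbb E_v)^n\hat\eta\Big\|_{\phi_1}\le\varepsilon\,\|\hat\eta\|_{\phi_1}.$$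 -/

import Mathlib

open MeasureTheory ProbabilityTheory Filter Topology
open scoped ENNReal

namespace RobustValue

section Orlicz

variable {Ω Ω' : Type*} [MeasurableSpace Ω] [MeasurableSpace Ω']

/-- The modular `E^μ[φ_r(|f| / c)]` with `φ_r(x) = exp(x ^ r) - 1`, as an extended nonnegative
real number. -/
noncomputable def modular (r : ℝ) (μ : Measure Ω) (c : ℝ) (f : Ω → ℝ) : ℝ≥0∞ :=
  ∫⁻ x, ENNReal.ofReal (Real.exp ((|f x| / c) ^ r) - 1) ∂μ

/-- The Luxemburg norm `‖f‖_{φ_r}`; its value is `∞` when no constant `c` is admissible. -/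
noncomputable def orliczNorm (r : ℝ) (μ : Measure Ω) (f : Ω → ℝ) : ℝ≥0∞ :=
  ⨅ (c : ℝ) (_ : 0 < c) (_ : modular r μ c f ≤ 1), ENNReal.ofReal c

/-- `f` belongs to the Orlicz space `L^{φ_r}(μ)` (functions equal `μ`-a.e. are identified). -/
structure MemL (r : ℝ) (μ : Measure Ω) (f : Ω → ℝ) : Prop where
  measurable : Measurable f
  norm_lt_top : orliczNorm r μ f < ∞

/-- `f` belongs to the Orlicz heart `E^{φ_r}(μ)`. -/
structure MemE (r : ℝ) (μ : Measure Ω) (f : Ω → ℝ) : Prop extends MemL r μ f where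
  modular_lt_top : ∀ c : ℝ, 0 < c → modular r μ c f < ∞

/-- The operator norm `sup {‖K f‖ : f ∈ L^{φ_r}(μ), ‖f‖ ≤ 1}` of `K` from `L^{φ_r}(μ)` to
`L^{φ_r}(ν)`. -/
noncomputable def opNorm (r : ℝ) (μ : Measure Ω) (ν : Measure Ω')
    (K : (Ω → ℝ) → (Ω' → ℝ)) : ℝ≥0∞ :=
  ⨆ (f : Ω → ℝ) (_ : MemL r μ f) (_ : orliczNorm r μ f ≤ 1), orliczNorm r ν (K f)

/-- `A` represents a bounded linear operator from `L^{φ_r}(μ)` to `L^{φ_r}(ν)`. -/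
structure IsBoundedLinear (r : ℝ) (μ : Measure Ω) (ν : Measure Ω')
    (A : (Ω → ℝ) → (Ω' → ℝ)) : Prop where
  map_mem : ∀ f, MemL r μ f → MemL r ν (A f)
  map_add : ∀ f g, MemL r μ f → MemL r μ g → A (f + g) =ᵐ[ν] A f + A g
  map_smul : ∀ (a : ℝ) (f), MemL r μ f → A (a • f) =ᵐ[ν] a • A f
  bound : ∃ C : ℝ, ∀ f, MemL r μ f → orliczNorm r ν (A f) ≤ ENNReal.ofReal C * orliczNorm r μ f

/-- The (possibly nonlinear) map `K` from `L^{φ_r}(μ)` to `L^{φ_r}(ν)` is Fréchet differentiable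
at `0`. -/
def FrechetDiffAtZero (r : ℝ) (μ : Measure Ω) (ν : Measure Ω')
    (K : (Ω → ℝ) → (Ω' → ℝ)) : Prop :=
  ∃ A : (Ω → ℝ) → (Ω' → ℝ), IsBoundedLinear r μ ν A ∧
    ∀ ε : ℝ, 0 < ε → ∃ δ : ℝ, 0 < δ ∧ ∀ f, MemL r μ f → orliczNorm r μ f ≤ ENNReal.ofReal δ →
      orliczNorm r ν (K f - K 0 - A f) ≤ ENNReal.ofReal ε * orliczNorm r μ f

/-- The series `∑_{n ≥ 0} a n` converges to `w` in the norm of `L^{φ_r}(μ)`. -/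
def HasOrliczSum (r : ℝ) (μ : Measure Ω) (a : ℕ → Ω → ℝ) (w : Ω → ℝ) : Prop :=
  MemL r μ w ∧
    Tendsto (fun N : ℕ => orliczNorm r μ (fun x => (∑ n ∈ Finset.range N, a n x) - w x))
      atTop (𝓝 0)

end Orlicz

section Model

variable {X : Type*} [MeasurableSpace X]

/-- The coefficient `α = -1 / (θ (1 - β))`. -/
noncomputable def alpha (β θ : ℝ) : ℝ := -(1 / (θ * (1 - β)))

/-- `E^Q[f(X_t, X_{t+1}) | X_t = x]`. -/
noncomputable def condE (Q : Kernel X X) (f : X × X → ℝ) (x : X) : ℝ :=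
  ∫ y, f (x, y) ∂(Q x)

/-- A function of the next state, as a function of the pair (current state, next state). -/
def nextState (f : X → ℝ) : X × X → ℝ := fun z => f z.2

/-- The recursion operator
`T f (x) = β log E^Q[exp(f(X_{t+1}) + α u(X_t, X_{t+1})) | X_t = x]`. -/
noncomputable def opT (β θ : ℝ) (u : X × X → ℝ) (Q : Kernel X X) (f : X → ℝ) (x : X) : ℝ :=
  β * Real.log (condE Q (fun z => Real.exp (f z.2 + alpha β θ * u z)) x)

/-- The change of measure
`m_g(x₀, x₁) = exp(g + α u)(x₀, x₁) / E^Q[exp(g + α u)(X_t, X_{t+1}) | X_t = x₀]`. -/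
noncomputable def distortion (β θ : ℝ) (u : X × X → ℝ) (Q : Kernel X X) (g : X × X → ℝ)
    (z : X × X) : ℝ :=
  Real.exp (g z + alpha β θ * u z) /
    condE Q (fun z' => Real.exp (g z' + alpha β θ * u z')) z.1

/-- The extended subgradient
`D_g f (x) = β E_g f (x) = β E^Q[m_g(X_t, X_{t+1}) f(X_t, X_{t+1}) | X_t = x]`. -/
noncomputable def opD (β θ : ℝ) (u : X × X → ℝ) (Q : Kernel X X) (g f : X × X → ℝ) (x : X) : ℝ :=
  β * condE Q (fun z => distortion β θ u Q g z * f z) x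

/-- The restriction of `D_g` to functions of the next state alone. -/
noncomputable def opD₁ (β θ : ℝ) (u : X × X → ℝ) (Q : Kernel X X) (g : X × X → ℝ)
    (f : X → ℝ) : X → ℝ :=
  opD β θ u Q g (nextState f)

/-- `(β E_v)^(n+1) f` for a function `f` of the pair (current state, next state). -/
noncomputable def seriesTerm (β θ : ℝ) (u : X × X → ℝ) (Q : Kernel X X) (v : X → ℝ)
    (f : X × X → ℝ) (n : ℕ) : X → ℝ :=
  (opD₁ β θ u Q (nextState v))^[n] (opD β θ u Q (nextState v) f)

/-- `v` is a fixed point in `E^{φ_r}(μ)` of the recursion operator with transition kernel `Q`. -/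
structure IsValueFn (β θ r : ℝ) (u : X × X → ℝ) (μ : Measure X) (Q : Kernel X X)
    (v : X → ℝ) : Prop where
  mem : MemE r μ v
  fixed : opT β θ u Q v =ᵐ[μ] v

/-- `κ_η(x) = log E^Q[exp(η(X_t, X_{t+1})) | X_t = x]`. -/
noncomputable def kappa (Q : Kernel X X) (η : X × X → ℝ) (x : X) : ℝ :=
  Real.log (condE Q (fun z => Real.exp (η z)) x)

/-- `‖D_{h+v} - D_v‖ → 0`, in the operator norm of `L^{φ_1}(Q₀)`, as `‖h‖_{φ_1} → 0` with
`h ∈ L^{φ_1}(Q₀ ⊗ Q)`. -/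
def SubgradientContinuousAt (β θ : ℝ) (u : X × X → ℝ) (Q₀ : Measure X) (Q : Kernel X X)
    (v : X → ℝ) : Prop :=
  ∀ ε : ℝ, 0 < ε → ∃ δ : ℝ, 0 < δ ∧ ∀ h : X × X → ℝ, MemL 1 (Q₀ ⊗ₘ Q) h →
    orliczNorm 1 (Q₀ ⊗ₘ Q) h ≤ ENNReal.ofReal δ →
    opNorm 1 Q₀ Q₀ (fun f => opD₁ β θ u Q (h + nextState v) f - opD₁ β θ u Q (nextState v) f)
      ≤ ENNReal.ofReal ε

/-- Everywhere mutual absolute continuity of two transition kernels. -/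
def MutuallyAC (Q Q' : Kernel X X) : Prop := ∀ x, Q x ≪ Q' x ∧ Q' x ≪ Q x

variable [MeasurableSpace.CountablyGenerated X]

/-- The log likelihood ratio `ℓ(x₀, x₁) = log (Q'(x₁ | x₀) / Q(x₁ | x₀))`. -/
noncomputable def logLik (Q Q' : Kernel X X) (z : X × X) : ℝ :=
  Real.log (Kernel.rnDeriv Q' Q z.1 z.2).toReal

/-- The score `η(x₀, x₁) = ℓ(x₀, x₁) - E^Q[ℓ(X_t, X_{t+1}) | X_t = x₀]`. -/
noncomputable def score (Q Q' : Kernel X X) (z : X × X) : ℝ :=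
  logLik Q Q' z - condE Q (logLik Q Q') z.1

/-- Case (a) of the uniform regularity condition on the alternative kernel `Q'`. -/
structure AM2a (β θ r M : ℝ) (u : X × X → ℝ) (Q₀ : Measure X) (Q Q' : Kernel X X) : Prop where
  mem : MemE r (Q₀ ⊗ₘ Q) (logLik Q Q')
  norm_le : orliczNorm r (Q₀ ⊗ₘ Q) (logLik Q Q') ≤ ENNReal.ofReal M
  moment_le : ∫⁻ z, ENNReal.ofReal
      (Real.exp (|1 / (1 - β) * (logLik Q Q' z + alpha β θ * u z)| ^ r)) ∂(Q₀ ⊗ₘ Q)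
    ≤ ENNReal.ofReal M

/-- Case (b) of the uniform regularity condition on the alternative kernel `Q'`, with exponent
`p`; here `Q₀'` is the stationary distribution under `Q'`. -/
structure AM2b (p M : ℝ) (Q₀ Q₀' : Measure X) (Q Q' : Kernel X X) : Prop where
  mem : MemL 1 (Q₀ ⊗ₘ Q) (logLik Q Q')
  isProbabilityMeasure : IsProbabilityMeasure Q₀'
  stationary : Kernel.Invariant Q' Q₀'
  ac : Q₀ ≪ Q₀'
  ac' : Q₀' ≪ Q₀
  moment_le : ∫⁻ x, (Q₀'.rnDeriv Q₀ x) ^ p ∂Q₀ ≤ ENNReal.ofReal M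
  inv_moment_le : ∫⁻ x, (Q₀'.rnDeriv Q₀ x) ^ (1 - p) ∂Q₀ ≤ ENNReal.ofReal M
  joint_moment_le :
    ∫⁻ z, ((Q₀' ⊗ₘ Q').rnDeriv (Q₀ ⊗ₘ Q) z) ^ p ∂(Q₀ ⊗ₘ Q) ≤ ENNReal.ofReal M

/-- The uniform regularity condition on the alternative kernel `Q'`, with constants `M` and `p`. -/
def AM2 (β θ r M p : ℝ) (u : X × X → ℝ) (Q₀ : Measure X) (Q Q' : Kernel X X) : Prop :=
  MutuallyAC Q Q' ∧
    (AM2a β θ r M u Q₀ Q Q' ∨ ∃ Q₀' : Measure X, AM2b p M Q₀ Q₀' Q Q')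

end Model

end RobustValue

open RobustValue

/-! Write D = βE_v, d = v̂ - v, and let w be the series. Since w = D w + D η̂, it suffices that D is
a contraction and that the residual d - D d - D η̂ is o(‖η̂‖), uniformly over the class.

Contraction. In the norm `lux R`, where the threshold 2 of the φ₁-norm is replaced by R, Hölder's
inequality with exponents 2/(1-β) and 2/(1+β) bounds D by 2β/(1+β) < 1 as soon as R dominates the
moment of order 2/(1-β) of the density m_v (`expI_contract`). Different thresholds give equivalent
norms. The density moment is finite because convexity and stationarity bound exponential moments of
a fixed point by those of its flow term αu (`moment_le`).

Lipschitz bound. The Gibbs variational inequality gives v̂ - v ≤ βÊ[v̂ - v + ℓ̂] and v - v̂ ≤ βE_v[v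
- v̂ - ℓ̂], where Ê is the distorted expectation of the alternative model. So the positive and
negative parts of d are subsolutions, and the same contraction argument yields ‖d‖ ≤ C‖ℓ̂‖
(`exists_lux_value_sub_le`). For the positive part, case (a) is treated under Q₀ ⊗ Q and case (b)
under Q̂₀ ⊗ Q̂, with Hölder's inequality transferring the norms.

From ℓ̂ to η̂. Because e^ℓ̂ has conditional mean one, the conditional mean of ℓ̂ is -κ_η̂, and 0 ≤
κ_η̂ ≤ κ_η̂ + κ_{-η̂}. In this symmetrized sum the derivative of κ cancels, so it is o(‖η̂‖). Hence
‖ℓ̂‖ ≤ 2‖η̂‖ and ‖d‖ = O(‖η̂‖) for small scores.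

Residual (`FixedPair.abs_linearization_le`). The change of the cumulant caused by replacing v with
v̂ lies between expectations of d under two tilts, which the continuity of h ↦ D_{h+v} compares with
E_v d. What remains is the second-order remainder of the cumulant of η̂ under the tilted law, and
the conditional mean of ℓ̂. The tilted remainder is reduced to the untilted symmetrized cumulant
(`remainder_le`, `tilted_remainder_small`): write η̂ = s f with s small and f of fixed size, use a
bound quadratic in s where the tilt is moderate and a linear one elsewhere. -/

namespace RobustValue

/-! ### Luxemburg norms with a variable threshold, and exponential moments -/

section Luxemburg

variable {Ω Ω' : Type*} [MeasurableSpace Ω] [MeasurableSpace Ω']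

/-- The exponential moment `∫ exp(|f| / c) dμ`. -/
noncomputable def expI (μ : Measure Ω) (c : ℝ) (f : Ω → ℝ) : ℝ≥0∞ :=
  ∫⁻ x, ENNReal.ofReal (Real.exp (|f x| / c)) ∂μ

/-- The Luxemburg norm of the function `exp` with threshold `R`. -/
noncomputable def lux (R : ℝ) (μ : Measure Ω) (f : Ω → ℝ) : ℝ≥0∞ :=
  ⨅ (c : ℝ) (_ : 0 < c) (_ : expI μ c f ≤ ENNReal.ofReal R), ENNReal.ofReal c

theorem expI_antitone (μ : Measure Ω) {c c' : ℝ} (hc : 0 < c) (h : c ≤ c') (f : Ω → ℝ) :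
    expI μ c' f ≤ expI μ c f := by
  refine lintegral_mono fun x => ENNReal.ofReal_le_ofReal (Real.exp_le_exp.2 ?_)
  gcongr

theorem expI_mono_ae {μ : Measure Ω} {c : ℝ} (hc : 0 < c) {f g : Ω → ℝ}
    (h : ∀ᵐ x ∂μ, |f x| ≤ |g x|) : expI μ c f ≤ expI μ c g := by
  refine lintegral_mono_ae ?_
  filter_upwards [h] with x hx
  refine ENNReal.ofReal_le_ofReal (Real.exp_le_exp.2 ?_)
  gcongr

theorem lux_le {R : ℝ} {μ : Measure Ω} {f : Ω → ℝ} {c : ℝ} (hc : 0 < c)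
    (h : expI μ c f ≤ ENNReal.ofReal R) : lux R μ f ≤ ENNReal.ofReal c :=
  iInf_le_of_le c (iInf_le_of_le hc (iInf_le_of_le h le_rfl))

theorem expI_le_of_lux_lt {R : ℝ} {μ : Measure Ω} {f : Ω → ℝ} {c : ℝ}
    (h : lux R μ f < ENNReal.ofReal c) : 0 < c ∧ expI μ c f ≤ ENNReal.ofReal R := by
  simp only [lux, iInf_lt_iff] at h
  obtain ⟨c', hc', hR, hlt⟩ := h
  have : c' < c := (ENNReal.ofReal_lt_ofReal_iff_of_nonneg hc'.le).1 hlt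
  exact ⟨hc'.trans this, (expI_antitone μ hc' this.le f).trans hR⟩

theorem exists_expI_le {R : ℝ} {μ : Measure Ω} {f : Ω → ℝ}
    (h : lux R μ f < ∞) : ∃ c : ℝ, 0 < c ∧ expI μ c f ≤ ENNReal.ofReal R := by
  simp only [lux, iInf_lt_iff] at h
  obtain ⟨c', hc', hR, -⟩ := h
  exact ⟨c', hc', hR⟩

/-- To bound a Luxemburg norm by `b`, it suffices to bound it by all larger reals. -/
theorem le_of_forall_ofReal_lt {a b : ℝ≥0∞}
    (h : ∀ c : ℝ, b < ENNReal.ofReal c → a ≤ ENNReal.ofReal c) : a ≤ b := by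
  refine le_of_forall_gt_imp_ge_of_dense fun c hc => ?_
  rcases eq_or_ne c ∞ with rfl | hc'
  · exact le_top
  · have := h c.toReal (by rwa [ENNReal.ofReal_toReal hc'])
    rwa [ENNReal.ofReal_toReal hc'] at this

/-- A linear bound on the Luxemburg norm follows from the corresponding bound on moments. -/
theorem lux_le_mul_of_expI {R R' : ℝ} {μ : Measure Ω} {ν : Measure Ω'} {f : Ω → ℝ} {g : Ω' → ℝ}
    {K : ℝ} (hK : 0 < K)
    (h : ∀ c : ℝ, 0 < c → expI μ c f ≤ ENNReal.ofReal R →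
      expI ν (K * c) g ≤ ENNReal.ofReal R') :
    lux R' ν g ≤ ENNReal.ofReal K * lux R μ f := by
  have hK' : ENNReal.ofReal K ≠ 0 := by simpa using hK
  rw [mul_comm, ← ENNReal.div_le_iff_le_mul (Or.inl hK') (Or.inl ENNReal.ofReal_ne_top)]
  refine le_of_forall_ofReal_lt fun c hc => ?_
  obtain ⟨hc0, hc1⟩ := expI_le_of_lux_lt hc
  rw [ENNReal.div_le_iff_le_mul (Or.inl hK') (Or.inl ENNReal.ofReal_ne_top),
    mul_comm, ← ENNReal.ofReal_mul hK.le]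
  exact lux_le (by positivity) (h c hc0 hc1)

theorem orliczNorm_one_eq_lux (μ : Measure Ω) [IsProbabilityMeasure μ] (f : Ω → ℝ) :
    orliczNorm 1 μ f = lux 2 μ f := by
  have key : ∀ c : ℝ, 0 < c → (modular 1 μ c f ≤ 1 ↔ expI μ c f ≤ ENNReal.ofReal 2) := by
    intro c hc
    have h1 : expI μ c f = modular 1 μ c f + 1 := by
      have : (1 : ℝ≥0∞) = ∫⁻ _, 1 ∂μ := by simp
      rw [modular, expI, this, ← lintegral_add_right _ measurable_const]
      refine lintegral_congr fun x => ?_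
      have : (0 : ℝ) ≤ |f x| / c := by positivity
      rw [Real.rpow_one, ← ENNReal.ofReal_one, ← ENNReal.ofReal_add
        (by linarith [Real.one_le_exp this]) zero_le_one]
      ring_nf
    have h2 : ENNReal.ofReal 2 = 1 + 1 := by norm_num
    rw [h1, h2, ENNReal.add_le_add_iff_right ENNReal.one_ne_top]
  unfold orliczNorm lux
  refine iInf_congr fun c => iInf_congr fun hc => ?_
  rw [key c hc]

theorem lux_mono_ae {R : ℝ} {μ : Measure Ω} {f g : Ω → ℝ}
    (h : ∀ᵐ x ∂μ, |f x| ≤ |g x|) : lux R μ f ≤ lux R μ g :=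
  le_of_forall_ofReal_lt fun _ hc =>
    have := expI_le_of_lux_lt hc
    lux_le this.1 ((expI_mono_ae this.1 h).trans this.2)

theorem lux_congr_ae {R : ℝ} {μ : Measure Ω} {f g : Ω → ℝ}
    (h : f =ᵐ[μ] g) : lux R μ f = lux R μ g :=
  le_antisymm (lux_mono_ae (h.mono fun x hx => by rw [hx]))
    (lux_mono_ae (h.mono fun x hx => by rw [hx]))

theorem lux_antitone_threshold {R R' : ℝ} (h : R ≤ R') (μ : Measure Ω) (f : Ω → ℝ) :
    lux R' μ f ≤ lux R μ f :=
  le_of_forall_ofReal_lt fun _ hc =>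
    have := expI_le_of_lux_lt hc
    lux_le this.1 (this.2.trans (ENNReal.ofReal_le_ofReal h))

theorem lux_neg (R : ℝ) (μ : Measure Ω) (f : Ω → ℝ) : lux R μ (-f) = lux R μ f := by
  simp [lux, expI]

theorem lux_smul_le (R : ℝ) (μ : Measure Ω) {a : ℝ} (ha : 0 < a) (f : Ω → ℝ) :
    lux R μ (a • f) ≤ ENNReal.ofReal a * lux R μ f := by
  refine lux_le_mul_of_expI ha fun c hc h => ?_
  refine le_trans (le_of_eq ?_) h
  refine lintegral_congr fun x => ?_
  have : |(a • f) x| / (a * c) = |f x| / c := by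
    simp only [Pi.smul_apply, smul_eq_mul, abs_mul, abs_of_pos ha]
    field_simp
  rw [this]

theorem measurable_ofReal_exp_abs {f : Ω → ℝ} (hf : Measurable f) (c : ℝ) :
    Measurable fun x => ENNReal.ofReal (Real.exp (|f x| / c)) :=
  (Real.measurable_exp.comp
    ((continuous_abs.measurable.comp hf).div_const c)).ennreal_ofReal

theorem exp_convex_comb {a b s t : ℝ} (hs : 0 ≤ s) (ht : 0 ≤ t) (h : s + t = 1) :
    Real.exp (s * a + t * b) ≤ s * Real.exp a + t * Real.exp b :=
  convexOn_exp.2 (Set.mem_univ a) (Set.mem_univ b) hs ht h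

theorem lintegral_exp_convex_comb (μ : Measure Ω) {a b h : Ω → ℝ} (ha : Measurable a)
    {s t : ℝ} (hs : 0 ≤ s) (ht : 0 ≤ t) (hst : s + t = 1)
    (hh : ∀ᵐ x ∂μ, h x ≤ s * a x + t * b x) :
    ∫⁻ x, ENNReal.ofReal (Real.exp (h x)) ∂μ ≤
      ENNReal.ofReal s * ∫⁻ x, ENNReal.ofReal (Real.exp (a x)) ∂μ +
      ENNReal.ofReal t * ∫⁻ x, ENNReal.ofReal (Real.exp (b x)) ∂μ := by
  have hma : Measurable fun x => ENNReal.ofReal (Real.exp (a x)) :=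
    (Real.measurable_exp.comp ha).ennreal_ofReal
  rw [← lintegral_const_mul' _ _ ENNReal.ofReal_ne_top,
    ← lintegral_const_mul' _ _ ENNReal.ofReal_ne_top,
    ← lintegral_add_left (hma.const_mul _)]
  refine lintegral_mono_ae ?_
  filter_upwards [hh] with x hx
  rw [← ENNReal.ofReal_mul hs, ← ENNReal.ofReal_mul ht,
    ← ENNReal.ofReal_add (by positivity) (by positivity)]
  exact ENNReal.ofReal_le_ofReal ((Real.exp_le_exp.2 hx).trans (exp_convex_comb hs ht hst))

theorem expI_add_le {μ : Measure Ω} {R c c' : ℝ} (hc : 0 < c) (hc' : 0 < c')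
    {f g : Ω → ℝ} (hf : Measurable f) (h : expI μ c f ≤ ENNReal.ofReal R)
    (h' : expI μ c' g ≤ ENNReal.ofReal R) : expI μ (c + c') (f + g) ≤ ENNReal.ofReal R := by
  have hcc : 0 < c + c' := by positivity
  have := lintegral_exp_convex_comb μ (a := fun x => |f x| / c) (b := fun x => |g x| / c')
    (h := fun x => |(f + g) x| / (c + c')) ((continuous_abs.measurable.comp hf).div_const c)
    (s := c / (c + c')) (t := c' / (c + c')) (by positivity) (by positivity) (by field_simp)
    (Eventually.of_forall fun x => by
      have : c / (c + c') * (|f x| / c) + c' / (c + c') * (|g x| / c')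
          = (|f x| + |g x|) / (c + c') := by field_simp
      rw [this]
      gcongr
      exact abs_add_le _ _)
  refine this.trans ?_
  calc _ ≤ ENNReal.ofReal (c / (c + c')) * ENNReal.ofReal R
        + ENNReal.ofReal (c' / (c + c')) * ENNReal.ofReal R := by
        gcongr
        exacts [h, h']
    _ = ENNReal.ofReal R := by
        rw [← add_mul, ← ENNReal.ofReal_add (by positivity) (by positivity)]
        have : c / (c + c') + c' / (c + c') = 1 := by field_simp
        rw [this]; simp

theorem lux_add_le {R : ℝ} {μ : Measure Ω} {f g : Ω → ℝ} (hf : Measurable f) :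
    lux R μ (f + g) ≤ lux R μ f + lux R μ g := by
  rcases eq_or_ne (lux R μ f) ∞ with h | h
  · simp [h]
  rcases eq_or_ne (lux R μ g) ∞ with h' | h'
  · simp [h']
  refine ENNReal.le_of_forall_pos_le_add fun ε hε _ => ?_
  have hε2 : (0 : ℝ≥0∞) < ε / 2 := by simp [hε.ne']
  obtain ⟨h1, h2⟩ : lux R μ f < lux R μ f + ε / 2 ∧ lux R μ g < lux R μ g + ε / 2 :=
    ⟨ENNReal.lt_add_right h hε2.ne', ENNReal.lt_add_right h' hε2.ne'⟩
  have e1 : lux R μ f + ε / 2 ≠ ∞ := by finiteness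
  have e2 : lux R μ g + ε / 2 ≠ ∞ := by finiteness
  rw [← ENNReal.ofReal_toReal e1] at h1
  rw [← ENNReal.ofReal_toReal e2] at h2
  obtain ⟨p1, q1⟩ := expI_le_of_lux_lt h1
  obtain ⟨p2, q2⟩ := expI_le_of_lux_lt h2
  refine (lux_le (by positivity) (expI_add_le p1 p2 hf q1 q2)).trans (le_of_eq ?_)
  rw [ENNReal.ofReal_add p1.le p2.le, ENNReal.ofReal_toReal e1, ENNReal.ofReal_toReal e2]
  rw [add_add_add_comm, ENNReal.add_halves]

/-- Lowering the threshold costs a constant factor. -/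
theorem expI_le_two {μ : Measure Ω} [IsProbabilityMeasure μ] {R K c : ℝ}
    (hK : 1 ≤ K) (hR : R ≤ K) {f : Ω → ℝ} (hf : Measurable f)
    (h : expI μ c f ≤ ENNReal.ofReal R) : expI μ (K * c) f ≤ ENNReal.ofReal 2 := by
  have hK0 : 0 < K := by linarith
  have hK1 : 1 / K ≤ 1 := by rw [div_le_one hK0]; exact hK
  -- Here |f|/(Kc) is the convex combination of |f|/c and 0 with weights 1/K and 1 - 1/K, so the
  -- integral is at most (1/K)K + 1.
  have := lintegral_exp_convex_comb μ (a := fun x => |f x| / c) (b := fun x => 0)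
    (h := fun x => |f x| / (K * c)) ((continuous_abs.measurable.comp hf).div_const c)
    (s := 1 / K) (t := 1 - 1 / K) (by positivity) (by linarith) (by ring)
    (Eventually.of_forall fun x => by rw [mul_zero, add_zero, div_mul_div_comm, one_mul])
  refine this.trans ?_
  calc _ ≤ ENNReal.ofReal (1 / K) * ENNReal.ofReal K + ENNReal.ofReal 1 := by
        gcongr
        · exact h.trans (ENNReal.ofReal_le_ofReal hR)
        · simp only [Real.exp_zero, ENNReal.ofReal_one, lintegral_const, measure_univ, mul_one]
          rw [ENNReal.ofReal_le_one]
          have : 0 ≤ 1 / K := by positivity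
          linarith
    _ = ENNReal.ofReal 2 := by
        rw [← ENNReal.ofReal_mul (by positivity), ← ENNReal.ofReal_add (by positivity) zero_le_one]
        congr 1; field_simp; norm_num

theorem lux_two_le {μ : Measure Ω} [IsProbabilityMeasure μ] {R K : ℝ}
    (hK : 1 ≤ K) (hR : R ≤ K) {f : Ω → ℝ} (hf : Measurable f) :
    lux 2 μ f ≤ ENNReal.ofReal K * lux R μ f :=
  lux_le_mul_of_expI (by linarith) fun _ _ h => expI_le_two hK hR hf h

theorem lux_two_lt_top_of_expI {μ : Measure Ω} [IsProbabilityMeasure μ] {c : ℝ} (hc : 0 < c)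
    {f : Ω → ℝ} (hf : Measurable f) (h : expI μ c f < ∞) : lux 2 μ f < ∞ := by
  have h1 : lux (expI μ c f).toReal μ f ≤ ENNReal.ofReal c :=
    lux_le hc (by rw [ENNReal.ofReal_toReal h.ne])
  refine (lux_two_le (le_max_left 1 (expI μ c f).toReal) (le_max_right _ _) hf).trans_lt ?_
  exact ENNReal.mul_lt_top ENNReal.ofReal_lt_top (h1.trans_lt ENNReal.ofReal_lt_top)

/-- The factor 2 suffices because e^{1/2} ≤ 2. -/
theorem lux_const_le (μ : Measure Ω) [IsProbabilityMeasure μ] {a c : ℝ} (ha : 0 ≤ a)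
    (hc : 0 < c) (h : 2 * a ≤ c) : lux 2 μ (fun _ => a) ≤ ENNReal.ofReal c := by
  refine lux_le hc ?_
  simp only [expI, lintegral_const, measure_univ, mul_one, abs_of_nonneg ha]
  refine ENNReal.ofReal_le_ofReal ?_
  have h1 : a / c ≤ 1 / 2 := by rw [div_le_iff₀ hc]; linarith
  have h3 := Real.exp_one_lt_d9
  have h4 : Real.exp (1 / 2) * Real.exp (1 / 2) = Real.exp 1 := by
    rw [← Real.exp_add]; norm_num
  nlinarith [Real.exp_le_exp.2 h1, Real.exp_pos (1 / 2)]

theorem memL_one_iff {μ : Measure Ω} [IsProbabilityMeasure μ] {f : Ω → ℝ} :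
    MemL 1 μ f ↔ Measurable f ∧ lux 2 μ f < ∞ :=
  ⟨fun h => ⟨h.1, by rw [← orliczNorm_one_eq_lux]; exact h.2⟩,
    fun h => ⟨h.1, by rw [orliczNorm_one_eq_lux]; exact h.2⟩⟩

theorem expI_comp {μ : Measure Ω} {T : Ω → Ω'} (hT : Measurable T) {c : ℝ} {f : Ω' → ℝ}
    (hf : Measurable f) : expI (μ.map T) c f = expI μ c (f ∘ T) := by
  rw [expI, lintegral_map (measurable_ofReal_exp_abs hf c) hT]; rfl

theorem lux_comp {R : ℝ} {μ : Measure Ω} {T : Ω → Ω'} (hT : Measurable T) {f : Ω' → ℝ}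
    (hf : Measurable f) : lux R μ (f ∘ T) = lux R (μ.map T) f := by
  simp only [lux, expI_comp hT hf]

/-- Finite exponential moments of all orders. -/
def AllExp (μ : Measure Ω) (f : Ω → ℝ) : Prop :=
  ∀ s : ℝ, ∫⁻ x, ENNReal.ofReal (Real.exp (s * |f x|)) ∂μ < ∞

/-- Split at y = s^{1/(r-1)}: below it the constant dominates, above it s ≤ y^{r-1}. This is how one
moment of exp(|f|^r) with r > 1 yields exponential moments of every order. -/
theorem mul_le_add_rpow {r s y : ℝ} (hr : 1 < r) (hs : 0 ≤ s) (hy : 0 ≤ y) :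
    s * y ≤ s * s ^ (1 / (r - 1)) + y ^ r := by
  have hr' : 0 < r - 1 := by linarith
  rcases le_total y (s ^ (1 / (r - 1))) with h | h
  · have : 0 ≤ y ^ r := by positivity
    nlinarith [mul_le_mul_of_nonneg_left h hs]
  · have h1 : s ≤ y ^ (r - 1) := by
      calc s = (s ^ (1 / (r - 1))) ^ (r - 1) := by
            rw [← Real.rpow_mul hs, one_div_mul_cancel hr'.ne', Real.rpow_one]
        _ ≤ y ^ (r - 1) := by gcongr
    have h2 : y ^ r = y ^ (r - 1) * y := by
      rcases hy.eq_or_lt with rfl | hy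
      · rw [Real.zero_rpow (by linarith), mul_zero]
      · rw [← Real.rpow_add_one hy.ne']; ring_nf
    have h3 : 0 ≤ s * s ^ (1 / (r - 1)) := by positivity
    nlinarith [mul_le_mul_of_nonneg_right h1 hy]

theorem lintegral_exp_le_of_rpow {μ : Measure Ω} {r : ℝ} (hr : 1 < r) {s : ℝ} (hs : 0 ≤ s)
    (f : Ω → ℝ) :
    ∫⁻ x, ENNReal.ofReal (Real.exp (s * |f x|)) ∂μ ≤
      ENNReal.ofReal (Real.exp (s * s ^ (1 / (r - 1)))) *
        ∫⁻ x, ENNReal.ofReal (Real.exp (|f x| ^ r)) ∂μ := by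
  rw [← lintegral_const_mul' _ _ ENNReal.ofReal_ne_top]
  refine lintegral_mono fun x => ?_
  rw [← ENNReal.ofReal_mul (Real.exp_nonneg _), ← Real.exp_add]
  exact ENNReal.ofReal_le_ofReal (Real.exp_le_exp.2 (mul_le_add_rpow hr hs (abs_nonneg _)))

theorem MemE.allExp {r : ℝ} (hr : 1 < r) {μ : Measure Ω} [IsProbabilityMeasure μ] {f : Ω → ℝ}
    (hf : MemE r μ f) : AllExp μ f := by
  have h1 : ∫⁻ x, ENNReal.ofReal (Real.exp (|f x| ^ r)) ∂μ < ∞ := by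
    have h := hf.modular_lt_top 1 one_pos
    have h2 : ∫⁻ x, ENNReal.ofReal (Real.exp (|f x| ^ r)) ∂μ ≤ modular r μ 1 f + ∫⁻ _, 1 ∂μ := by
      rw [modular, ← lintegral_add_right _ measurable_const]
      refine lintegral_mono fun x => ?_
      have h3 : (0 : ℝ) ≤ |f x| ^ r := by positivity
      rw [div_one, ← ENNReal.ofReal_one, ← ENNReal.ofReal_add
        (by linarith [Real.one_le_exp h3]) zero_le_one, sub_add_cancel]
    refine h2.trans_lt (ENNReal.add_lt_top.2 ⟨h, by simp⟩)
  intro s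
  refine (lintegral_mono fun x => ENNReal.ofReal_le_ofReal (Real.exp_le_exp.2
    (mul_le_mul_of_nonneg_right (le_abs_self s) (abs_nonneg (f x))))).trans_lt
    ((lintegral_exp_le_of_rpow hr (abs_nonneg s) f).trans_lt ?_)
  exact ENNReal.mul_lt_top ENNReal.ofReal_lt_top h1

theorem AllExp.add {μ : Measure Ω} {f g : Ω → ℝ} (hf : AllExp μ f) (hg : AllExp μ g)
    (hfm : Measurable f) : AllExp μ (f + g) := by
  intro s
  have := lintegral_exp_convex_comb μ (a := fun x => 2 * |s| * |f x|)
    (b := fun x => 2 * |s| * |g x|) (h := fun x => s * |(f + g) x|)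
    ((continuous_abs.measurable.comp hfm).const_mul _)
    (s := 1 / 2) (t := 1 / 2) (by norm_num) (by norm_num) (by norm_num)
    (Eventually.of_forall fun x => by
      have h1 : s * |(f + g) x| ≤ |s| * |(f + g) x| :=
        mul_le_mul_of_nonneg_right (le_abs_self s) (abs_nonneg _)
      have h2 : |s| * |(f + g) x| ≤ |s| * (|f x| + |g x|) :=
        mul_le_mul_of_nonneg_left (abs_add_le _ _) (abs_nonneg _)
      linarith)
  refine this.trans_lt (ENNReal.add_lt_top.2 ⟨?_, ?_⟩)
  · exact ENNReal.mul_lt_top ENNReal.ofReal_lt_top (hf _)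
  · exact ENNReal.mul_lt_top ENNReal.ofReal_lt_top (hg _)

theorem AllExp.const_mul {μ : Measure Ω} {f : Ω → ℝ} (hf : AllExp μ f) (a : ℝ) :
    AllExp μ (fun x => a * f x) := by
  intro s
  simpa only [abs_mul, mul_assoc] using hf (s * |a|)

theorem AllExp.neg {μ : Measure Ω} {f : Ω → ℝ} (hf : AllExp μ f) : AllExp μ (-f) := by
  simpa [AllExp] using hf

theorem AllExp.comp {μ : Measure Ω} {T : Ω → Ω'} (hT : Measurable T) {f : Ω' → ℝ}
    (hfm : Measurable f) (hf : AllExp (μ.map T) f) : AllExp μ (f ∘ T) := by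
  intro s
  have := hf s
  rwa [lintegral_map _ hT] at this
  exact (Real.measurable_exp.comp
    ((continuous_abs.measurable.comp hfm).const_mul s)).ennreal_ofReal

theorem AllExp.lux_lt_top {μ : Measure Ω} [IsProbabilityMeasure μ] {f : Ω → ℝ}
    (hfm : Measurable f) (hf : AllExp μ f) : lux 2 μ f < ∞ := by
  refine lux_two_lt_top_of_expI one_pos hfm ?_
  simpa [expI] using hf 1

/-- Exponential moments after a change of measure whose density has a moment of order `p > 1`. -/
theorem lintegral_exp_change_le {μ : Measure Ω} {p q : ℝ}
    (hpq : p.HolderConjugate q) {D : Ω → ℝ≥0∞} (hD : Measurable D) {h : Ω → ℝ}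
    (hh : Measurable h) :
    ∫⁻ x, D x * ENNReal.ofReal (Real.exp (h x)) ∂μ ≤
      (∫⁻ x, D x ^ p ∂μ) ^ (1 / p) *
        (∫⁻ x, ENNReal.ofReal (Real.exp (q * h x)) ∂μ) ^ (1 / q) := by
  refine (ENNReal.lintegral_mul_le_Lp_mul_Lq μ hpq hD.aemeasurable
    (g := fun x => ENNReal.ofReal (Real.exp (h x)))
    (Real.measurable_exp.comp hh).ennreal_ofReal.aemeasurable).trans (le_of_eq ?_)
  congr 3
  ext x
  rw [ENNReal.ofReal_rpow_of_pos (Real.exp_pos _), ← Real.exp_mul, mul_comm]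

/-- Luxemburg norms after a change of measure whose density has a moment of order `p > 1`. -/
theorem lux_change_le {μ ν : Measure Ω} [IsProbabilityMeasure ν]
    {p q M : ℝ} (hpq : p.HolderConjugate q) (hM : 0 ≤ M) {D : Ω → ℝ≥0∞} (hD : Measurable D)
    (hν : ∀ F : Ω → ℝ≥0∞, Measurable F → ∫⁻ x, F x ∂ν = ∫⁻ x, D x * F x ∂μ)
    (hDp : ∫⁻ x, D x ^ p ∂μ ≤ ENNReal.ofReal M) {f : Ω → ℝ} (hf : Measurable f) :
    lux 2 ν f ≤ ENNReal.ofReal ((1 + M ^ (1 / p) * 2 ^ (1 / q)) * q) * lux 2 μ f := by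
  have hq := hpq.symm.pos
  have hp := hpq.pos
  refine lux_le_mul_of_expI (by positivity) fun c hc h => ?_
  rw [mul_assoc]
  -- Hölder's inequality multiplies the exponent by q, which the scale qc undoes; it leaves the
  -- threshold M^{1/p} 2^{1/q}, which is then lowered to 2.
  refine expI_le_two (R := M ^ (1 / p) * 2 ^ (1 / q)) (le_add_of_nonneg_right (by positivity))
    (by linarith) hf ?_
  rw [expI, hν _ (measurable_ofReal_exp_abs hf _)]
  refine (lintegral_exp_change_le hpq hD
    ((continuous_abs.measurable.comp hf).div_const (q * c))).trans ?_
  rw [ENNReal.ofReal_mul (by positivity), ← ENNReal.ofReal_rpow_of_nonneg hM (by positivity),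
    ← ENNReal.ofReal_rpow_of_nonneg zero_le_two (by positivity)]
  gcongr
  refine le_trans (le_of_eq ?_) h
  refine lintegral_congr fun x => ?_
  congr 2
  simp only [Function.comp]
  field_simp

end Luxemburg

end RobustValue

namespace RobustValue

/-! ### Jensen inequalities stated with lower integrals -/

section Jensen

variable {Ω : Type*} [MeasurableSpace Ω]

theorem measurable_ofReal_exp {h : Ω → ℝ} (hh : Measurable h) :
    Measurable fun x => ENNReal.ofReal (Real.exp (h x)) :=
  (Real.measurable_exp.comp hh).ennreal_ofReal

/-- No integrability is assumed: either the right side is infinite, or F ≤ e^F makes F integrable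
and the usual Jensen inequality applies. -/
theorem ofReal_exp_le_lintegral_exp {π : Measure Ω} [IsProbabilityMeasure π] {F : Ω → ℝ}
    (hF : Measurable F) (hF0 : ∀ y, 0 ≤ F y) {a : ℝ}
    (ha : ENNReal.ofReal a ≤ ∫⁻ y, ENNReal.ofReal (F y) ∂π) :
    ENNReal.ofReal (Real.exp a) ≤ ∫⁻ y, ENNReal.ofReal (Real.exp (F y)) ∂π := by
  rcases eq_or_ne (∫⁻ y, ENNReal.ofReal (Real.exp (F y)) ∂π) ∞ with h | h
  · rw [h]; exact le_top
  have hi : Integrable (fun y => Real.exp (F y)) π := by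
    refine (lintegral_ofReal_ne_top_iff_integrable
      (Real.measurable_exp.comp hF).aestronglyMeasurable
      (Eventually.of_forall fun y => Real.exp_nonneg _)).1 h
  have hi' : Integrable F π := by
    refine hi.mono' hF.aestronglyMeasurable (Eventually.of_forall fun y => ?_)
    rw [Real.norm_of_nonneg (hF0 y)]
    linarith [Real.add_one_le_exp (F y)]
  rw [← ofReal_integral_eq_lintegral_ofReal hi' (Eventually.of_forall hF0),
    ENNReal.ofReal_le_ofReal_iff (integral_nonneg hF0)] at ha
  rw [← ofReal_integral_eq_lintegral_ofReal hi (Eventually.of_forall fun y => Real.exp_nonneg _)]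
  refine ENNReal.ofReal_le_ofReal ((Real.exp_le_exp.2 ha).trans ?_)
  exact convexOn_exp.map_integral_le Real.continuous_exp.continuousOn isClosed_univ
    (Eventually.of_forall fun _ => Set.mem_univ _) hi' hi

theorem ofReal_exp_le_lintegral_mul_exp {π : Measure Ω} {m F : Ω → ℝ}
    (hm : Measurable m) (hm0 : ∀ y, 0 ≤ m y) (h1 : ∫⁻ y, ENNReal.ofReal (m y) ∂π = 1)
    (hF : Measurable F) (hF0 : ∀ y, 0 ≤ F y) {a : ℝ}
    (ha : ENNReal.ofReal a ≤ ∫⁻ y, ENNReal.ofReal (m y * F y) ∂π) :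
    ENNReal.ofReal (Real.exp a) ≤ ∫⁻ y, ENNReal.ofReal (m y * Real.exp (F y)) ∂π := by
  have : IsProbabilityMeasure (π.withDensity fun y => ENNReal.ofReal (m y)) := ⟨by simpa using h1⟩
  have key : ∀ G : Ω → ℝ, Measurable G →
      ∫⁻ y, ENNReal.ofReal (m y * G y) ∂π =
        ∫⁻ y, ENNReal.ofReal (G y) ∂(π.withDensity fun y => ENNReal.ofReal (m y)) := by
    intro G hG
    rw [lintegral_withDensity_eq_lintegral_mul _ hm.ennreal_ofReal hG.ennreal_ofReal]
    exact lintegral_congr fun y => ENNReal.ofReal_mul (hm0 y)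
  rw [key (fun y => Real.exp (F y)) (Real.measurable_exp.comp hF)]
  rw [key _ hF] at ha
  exact ofReal_exp_le_lintegral_exp hF hF0 ha

/-- Integrate the arithmetic-geometric bound e^{-f} + e^{-2a} e^f ≥ 2e^{-a}; the second summand has
integral e^{-a}. This turns a fixed-point equation into a bound from below on the fixed point. -/
theorem ofReal_exp_neg_le {π : Measure Ω} [IsProbabilityMeasure π] {f : Ω → ℝ}
    (hf : Measurable f) {a : ℝ}
    (ha : ENNReal.ofReal (Real.exp a) = ∫⁻ y, ENNReal.ofReal (Real.exp (f y)) ∂π) :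
    ENNReal.ofReal (Real.exp (-a)) ≤ ∫⁻ y, ENNReal.ofReal (Real.exp (-f y)) ∂π := by
  have hmeas : Measurable fun y => ENNReal.ofReal (Real.exp (f y)) :=
    (Real.measurable_exp.comp hf).ennreal_ofReal
  have h : ENNReal.ofReal (2 * Real.exp (-a)) ≤
      ∫⁻ y, ENNReal.ofReal (Real.exp (-f y)) ∂π + ENNReal.ofReal (Real.exp (-a)) := by
    calc ENNReal.ofReal (2 * Real.exp (-a))
        = ∫⁻ y, ENNReal.ofReal (2 * Real.exp (-a)) ∂π := by simp
      _ ≤ ∫⁻ y, (ENNReal.ofReal (Real.exp (-f y)) +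
            ENNReal.ofReal (Real.exp (-(2 * a))) * ENNReal.ofReal (Real.exp (f y))) ∂π := by
          refine lintegral_mono fun y => ?_
          rw [← ENNReal.ofReal_mul (Real.exp_nonneg _),
            ← ENNReal.ofReal_add (Real.exp_nonneg _) (by positivity)]
          refine ENNReal.ofReal_le_ofReal ?_
          have e1 : Real.exp (-f y) = Real.exp (-a) * Real.exp (-(f y - a)) := by
            rw [← Real.exp_add]; ring_nf
          have e2 : Real.exp (-(2 * a)) * Real.exp (f y) = Real.exp (-a) * Real.exp (f y - a) := by
            rw [← Real.exp_add, ← Real.exp_add]; ring_nf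
          rw [e1, e2]
          nlinarith [Real.exp_pos (-a), Real.add_one_le_exp (f y - a),
            Real.add_one_le_exp (-(f y - a))]
      _ = _ := by
          rw [lintegral_add_right _ (hmeas.const_mul _), lintegral_const_mul _ hmeas, ← ha,
            ← ENNReal.ofReal_mul (Real.exp_nonneg _), ← Real.exp_add]
          ring_nf
  rw [two_mul, ENNReal.ofReal_add (Real.exp_nonneg _) (Real.exp_nonneg _)] at h
  exact (ENNReal.add_le_add_iff_right ENNReal.ofReal_ne_top).1 h

/-- Jensen's inequality for the power s. Bernoulli's inequality supplies the tangent line at e^a,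
and (s - 1)e^{sa} is added on both sides to avoid subtraction in [0, ∞]. -/
theorem ofReal_exp_mul_le {π : Measure Ω} [IsProbabilityMeasure π] {f : Ω → ℝ}
    (hf : Measurable f) {a s : ℝ} (hs : 1 ≤ s)
    (ha : ENNReal.ofReal (Real.exp a) ≤ ∫⁻ y, ENNReal.ofReal (Real.exp (f y)) ∂π) :
    ENNReal.ofReal (Real.exp (s * a)) ≤ ∫⁻ y, ENNReal.ofReal (Real.exp (s * f y)) ∂π := by
  have hmeas : Measurable fun y => ENNReal.ofReal (Real.exp (f y)) :=
    (Real.measurable_exp.comp hf).ennreal_ofReal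
  have h : ENNReal.ofReal (Real.exp (s * a)) + ENNReal.ofReal ((s - 1) * Real.exp (s * a)) ≤
      ∫⁻ y, ENNReal.ofReal (Real.exp (s * f y)) ∂π +
        ENNReal.ofReal ((s - 1) * Real.exp (s * a)) := by
    calc ENNReal.ofReal (Real.exp (s * a)) + ENNReal.ofReal ((s - 1) * Real.exp (s * a))
        = ENNReal.ofReal (s * Real.exp (s * a - a)) * ENNReal.ofReal (Real.exp a) := by
          rw [← ENNReal.ofReal_mul (by positivity), mul_assoc, ← Real.exp_add,
            ← ENNReal.ofReal_add (by positivity)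
              (mul_nonneg (by linarith) (Real.exp_nonneg _))]
          ring_nf
      _ ≤ ENNReal.ofReal (s * Real.exp (s * a - a)) *
            ∫⁻ y, ENNReal.ofReal (Real.exp (f y)) ∂π := by gcongr
      _ ≤ ∫⁻ y, (ENNReal.ofReal (Real.exp (s * f y)) +
            ENNReal.ofReal ((s - 1) * Real.exp (s * a))) ∂π := by
          rw [← lintegral_const_mul _ hmeas]
          refine lintegral_mono fun y => ?_
          rw [← ENNReal.ofReal_mul (by positivity), ← ENNReal.ofReal_add (by positivity)
              (mul_nonneg (by linarith) (Real.exp_nonneg _))]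
          refine ENNReal.ofReal_le_ofReal ?_
          have hb := one_add_mul_self_le_rpow_one_add
            (s := Real.exp (f y - a) - 1) (by linarith [Real.exp_pos (f y - a)]) hs
          rw [add_sub_cancel, ← Real.exp_mul] at hb
          have e1 : Real.exp (s * f y) = Real.exp (s * a) * Real.exp ((f y - a) * s) := by
            rw [← Real.exp_add]; ring_nf
          have e2 : s * Real.exp (s * a - a) * Real.exp (f y) =
              Real.exp (s * a) * (s * Real.exp (f y - a)) := by
            have : Real.exp (s * a - a) * Real.exp (f y) =
              Real.exp (s * a) * Real.exp (f y - a) := by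
              rw [← Real.exp_add, ← Real.exp_add]; ring_nf
            linear_combination s * this
          rw [e1, e2]
          nlinarith [Real.exp_pos (s * a)]
      _ = _ := by
          rw [lintegral_add_right _ measurable_const]; simp
  exact (ENNReal.add_le_add_iff_right ENNReal.ofReal_ne_top).1 h

end Jensen

/-! ### Contraction of the distorted conditional expectation, and moments of fixed points -/

section Markov

variable {X : Type*} [MeasurableSpace X]

theorem map_snd_compProd {μ : Measure X} [SFinite μ] {P : Kernel X X} [IsSFiniteKernel P]
    (h : Kernel.Invariant P μ) : (μ ⊗ₘ P).map Prod.snd = μ := by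
  have := Measure.snd_compProd μ P
  rw [h] at this
  exact this

theorem map_fst_compProd (μ : Measure X) [SFinite μ] (P : Kernel X X) [IsMarkovKernel P] :
    (μ ⊗ₘ P).map Prod.fst = μ :=
  Measure.fst_compProd μ P

theorem lux_nextState {R : ℝ} {μ : Measure X} [SFinite μ] {P : Kernel X X} [IsSFiniteKernel P]
    (h : Kernel.Invariant P μ) {f : X → ℝ} (hf : Measurable f) :
    lux R (μ ⊗ₘ P) (nextState f) = lux R μ f := by
  have := lux_comp (R := R) (μ := μ ⊗ₘ P) (T := Prod.snd) measurable_snd hf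
  rwa [map_snd_compProd h] at this

theorem lux_currentState {R : ℝ} {μ : Measure X} [SFinite μ] {P : Kernel X X} [IsMarkovKernel P]
    {f : X → ℝ} (hf : Measurable f) :
    lux R (μ ⊗ₘ P) (fun z => f z.1) = lux R μ f := by
  have := lux_comp (R := R) (μ := μ ⊗ₘ P) (T := Prod.fst) measurable_fst hf
  rwa [map_fst_compProd] at this

theorem measurable_nextState {f : X → ℝ} (hf : Measurable f) : Measurable (nextState f) :=
  hf.comp measurable_snd

/-- The contraction factor of the discounted, distorted conditional expectation. -/
noncomputable def contr (β : ℝ) : ℝ := 2 * β / (1 + β)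

theorem contr_pos {β : ℝ} (h : 0 < β) : 0 < contr β := by unfold contr; positivity

theorem contr_lt_one {β : ℝ} (h : 0 < β) (h1 : β < 1) : contr β < 1 := by
  unfold contr; rw [div_lt_one (by linarith)]; linarith

/-- Put q = 2/(1+β), so `contr β` = βq. Jensen under the density m gives e^{|G|/(βqc)} ≤ E[m
e^{|F|/(qc)}]; Hölder with exponents 2/(1-β) and q then gives R^{(1-β)/2} R^{(1+β)/2} = R. The same
R serves as threshold and as moment bound, so the threshold reproduces itself. -/
theorem expI_contract {μ : Measure X} [SFinite μ] {P : Kernel X X} [IsSFiniteKernel P]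
    {β R : ℝ} (hβ0 : 0 < β) (hβ1 : β < 1) (hR : 0 < R) {m : X × X → ℝ} (hm : Measurable m)
    (hm0 : ∀ z, 0 ≤ m z) (h1 : ∀ᵐ x ∂μ, ∫⁻ y, ENNReal.ofReal (m (x, y)) ∂(P x) = 1)
    (hq : ∫⁻ z, ENNReal.ofReal (m z) ^ (2 / (1 - β)) ∂(μ ⊗ₘ P) ≤ ENNReal.ofReal R)
    {F : X × X → ℝ} (hF : Measurable F) {G : X → ℝ}
    (h : ∀ᵐ x ∂μ, ENNReal.ofReal |G x| ≤
      ENNReal.ofReal β * ∫⁻ y, ENNReal.ofReal (m (x, y) * |F (x, y)|) ∂(P x))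
    {c : ℝ} (hc : 0 < c) (hcR : expI (μ ⊗ₘ P) c F ≤ ENNReal.ofReal R) :
    expI μ (contr β * c) G ≤ ENNReal.ofReal R := by
  have hpq : (2 / (1 - β)).HolderConjugate (2 / (1 + β)) := by
    rw [Real.holderConjugate_iff]
    refine ⟨?_, ?_⟩
    · rw [lt_div_iff₀ (by linarith)]; linarith
    · have : 1 - β ≠ 0 := by linarith
      have : 1 + β ≠ 0 := by linarith
      field_simp; ring
  have hb : 0 < 1 + β := by linarith
  set q := 2 / (1 + β) with hqdef
  have hq0 : 0 < q := by positivity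
  have hcontr : contr β = β * q := by rw [contr, hqdef]; ring
  have hFm : Measurable fun z => |F z| / (q * c) :=
    (continuous_abs.measurable.comp hF).div_const _
  have hpt : ∀ᵐ x ∂μ, ENNReal.ofReal (Real.exp (|G x| / (contr β * c))) ≤
      ∫⁻ y, ENNReal.ofReal (m (x, y) * Real.exp (|F (x, y)| / (q * c))) ∂(P x) := by
    filter_upwards [h, h1] with x hx hx1
    refine ofReal_exp_le_lintegral_mul_exp (hm.comp measurable_prodMk_left) (fun y => hm0 _) hx1
      (hFm.comp measurable_prodMk_left)
      (fun y => div_nonneg (abs_nonneg _) (by positivity)) ?_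
    have e1 : |G x| / (contr β * c) = (1 / (contr β * c)) * |G x| := by ring
    have hcp : 0 < contr β * c := mul_pos (contr_pos hβ0) hc
    rw [e1, ENNReal.ofReal_mul (by positivity)]
    calc _ ≤ ENNReal.ofReal (1 / (contr β * c)) *
          (ENNReal.ofReal β * ∫⁻ y, ENNReal.ofReal (m (x, y) * |F (x, y)|) ∂(P x)) := by gcongr
      _ = ∫⁻ y, ENNReal.ofReal (m (x, y) * (|F (x, y)| / (q * c))) ∂(P x) := by
          rw [← mul_assoc, ← ENNReal.ofReal_mul (by positivity),
            ← lintegral_const_mul' _ _ ENNReal.ofReal_ne_top]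
          refine lintegral_congr fun y => ?_
          rw [← ENNReal.ofReal_mul (by positivity), hcontr]
          congr 1
          field_simp
  have hmeas : Measurable fun z => ENNReal.ofReal (m z * Real.exp (|F z| / (q * c))) :=
    (hm.mul (Real.measurable_exp.comp hFm)).ennreal_ofReal
  calc expI μ (contr β * c) G
      ≤ ∫⁻ x, ∫⁻ y, ENNReal.ofReal (m (x, y) * Real.exp (|F (x, y)| / (q * c))) ∂(P x) ∂μ :=
        lintegral_mono_ae hpt
    _ = ∫⁻ z, ENNReal.ofReal (m z) * ENNReal.ofReal (Real.exp (|F z| / (q * c))) ∂(μ ⊗ₘ P) := by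
        rw [← Measure.lintegral_compProd hmeas]
        exact lintegral_congr fun z => ENNReal.ofReal_mul (hm0 z)
    _ ≤ _ := lintegral_exp_change_le hpq hm.ennreal_ofReal hFm
    _ ≤ ENNReal.ofReal R ^ (1 / (2 / (1 - β))) * ENNReal.ofReal R ^ (1 / q) := by
        have hb' : 0 < 1 - β := by linarith
        gcongr
        refine le_trans (le_of_eq ?_) hcR
        refine lintegral_congr fun z => ?_
        congr 2
        field_simp
    _ = ENNReal.ofReal R := by
        rw [← ENNReal.rpow_add _ _ (by simpa using hR) ENNReal.ofReal_ne_top]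
        have : 1 / (2 / (1 - β)) + 1 / q = 1 := by
          rw [hqdef]; field_simp; ring
        rw [this, ENNReal.rpow_one]

theorem lux_contract {μ : Measure X} [SFinite μ] {P : Kernel X X} [IsSFiniteKernel P]
    {β R : ℝ} (hβ0 : 0 < β) (hβ1 : β < 1) (hR : 0 < R) {m : X × X → ℝ} (hm : Measurable m)
    (hm0 : ∀ z, 0 ≤ m z) (h1 : ∀ᵐ x ∂μ, ∫⁻ y, ENNReal.ofReal (m (x, y)) ∂(P x) = 1)
    (hq : ∫⁻ z, ENNReal.ofReal (m z) ^ (2 / (1 - β)) ∂(μ ⊗ₘ P) ≤ ENNReal.ofReal R)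
    {F : X × X → ℝ} (hF : Measurable F) {G : X → ℝ}
    (h : ∀ᵐ x ∂μ, ENNReal.ofReal |G x| ≤
      ENNReal.ofReal β * ∫⁻ y, ENNReal.ofReal (m (x, y) * |F (x, y)|) ∂(P x)) :
    lux R μ G ≤ ENNReal.ofReal (contr β) * lux R (μ ⊗ₘ P) F :=
  lux_le_mul_of_expI (contr_pos hβ0) fun _ hc hcR =>
    expI_contract hβ0 hβ1 hR hm hm0 h1 hq hF h hc hcR

/-- If `N ≤ ρ (N + L)` with `ρ < 1` and `N` finite, then `N ≤ ρ / (1 - ρ) L`. -/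
theorem le_of_le_contract {ρ : ℝ} (h0 : 0 < ρ) (h1 : ρ < 1) {N L : ℝ≥0∞} (hN : N ≠ ∞)
    (h : N ≤ ENNReal.ofReal ρ * (N + L)) : N ≤ ENNReal.ofReal (ρ / (1 - ρ)) * L := by
  have hρ : 0 < 1 - ρ := by linarith
  rcases eq_or_ne L ∞ with rfl | hL
  · rw [ENNReal.mul_top]
    · exact le_top
    · simpa using div_pos h0 hρ
  rw [← ENNReal.ofReal_toReal hN, ← ENNReal.ofReal_toReal hL] at h ⊢
  rw [← ENNReal.ofReal_add ENNReal.toReal_nonneg ENNReal.toReal_nonneg,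
    ← ENNReal.ofReal_mul h0.le, ENNReal.ofReal_le_ofReal_iff (by positivity)] at h
  rw [← ENNReal.ofReal_mul (by positivity)]
  refine ENNReal.ofReal_le_ofReal ?_
  rw [div_mul_eq_mul_div, le_div_iff₀ hρ]
  linarith

/-- Exponential moments of a fixed point are controlled by those of the flow term. -/
theorem moment_le {μ : Measure X} [IsProbabilityMeasure μ] {P : Kernel X X} [IsMarkovKernel P]
    (hP : Kernel.Invariant P μ) {β : ℝ} (hβ0 : 0 < β) (hβ1 : β < 1) {v : X → ℝ}
    (hv : Measurable v) {w : X × X → ℝ} (hw : Measurable w)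
    (hfix : ∀ᵐ x ∂μ, ENNReal.ofReal (Real.exp (v x / β)) =
      ∫⁻ y, ENNReal.ofReal (Real.exp (v y + w (x, y))) ∂(P x))
    (hfin : AllExp μ v) {s : ℝ} (hs : 1 ≤ s) :
    ∫⁻ x, ENNReal.ofReal (Real.exp (s / β * |v x|)) ∂μ ≤
      ∫⁻ z, ENNReal.ofReal (Real.exp (s / (1 - β) * |w z|)) ∂(μ ⊗ₘ P) := by
  have hb : 0 < 1 - β := by linarith
  have hav : Measurable fun x => |v x| := continuous_abs.measurable.comp hv
  have haw : Measurable fun z => |w z| := continuous_abs.measurable.comp hw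
  -- Where v ≥ 0 this is the fixed-point equation itself; where v < 0 it is Jensen's inequality for
  -- the reciprocal.
  have hpt : ∀ᵐ x ∂μ, ENNReal.ofReal (Real.exp (|v x| / β)) ≤
      ∫⁻ y, ENNReal.ofReal (Real.exp (|v y| + |w (x, y)|)) ∂(P x) := by
    filter_upwards [hfix] with x hx
    have hwx : Measurable fun y => v y + w (x, y) := hv.add (hw.comp measurable_prodMk_left)
    rcases abs_cases (v x) with ⟨h, -⟩ | ⟨h, -⟩
    · rw [h, hx]
      refine lintegral_mono fun y => ENNReal.ofReal_le_ofReal (Real.exp_le_exp.2 ?_)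
      linarith [le_abs_self (v y), le_abs_self (w (x, y))]
    · rw [h, neg_div]
      refine (ofReal_exp_neg_le hwx hx).trans ?_
      refine lintegral_mono fun y => ENNReal.ofReal_le_ofReal (Real.exp_le_exp.2 ?_)
      linarith [neg_abs_le (v y), neg_abs_le (w (x, y))]
  have hm1 : Measurable fun z : X × X => |v z.2| + |w z| :=
    (hav.comp measurable_snd).add haw
  set I := ∫⁻ x, ENNReal.ofReal (Real.exp (s / β * |v x|)) ∂μ with hI
  set J := ∫⁻ z, ENNReal.ofReal (Real.exp (s / (1 - β) * |w z|)) ∂(μ ⊗ₘ P) with hJ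
  have hIfin : I ≠ ∞ := (hfin _).ne
  have h1 : I ≤ ∫⁻ z, ENNReal.ofReal (Real.exp (s * (|v z.2| + |w z|))) ∂(μ ⊗ₘ P) := by
    rw [Measure.lintegral_compProd
      (measurable_ofReal_exp (hm1.const_mul s))]
    refine lintegral_mono_ae ?_
    filter_upwards [hpt] with x hx
    have := ofReal_exp_mul_le (hm1.comp measurable_prodMk_left) hs hx
    refine le_trans (le_of_eq ?_) this
    congr 2
    ring
  -- Convexity with weights β and 1 - β, together with stationarity, gives I ≤ βI + (1-β)J. As I is
  -- finite it can be absorbed, leaving I ≤ J.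
  have h2 := lintegral_exp_convex_comb (μ ⊗ₘ P) (a := fun z => s / β * |v z.2|)
    (b := fun z => s / (1 - β) * |w z|) (h := fun z => s * (|v z.2| + |w z|))
    ((hav.comp measurable_snd).const_mul _) hβ0.le hb.le (by ring)
    (Eventually.of_forall fun z => by
      apply le_of_eq
      field_simp)
  have h3 : ∫⁻ z, ENNReal.ofReal (Real.exp (s / β * |v z.2|)) ∂(μ ⊗ₘ P) = I := by
    rw [hI]
    conv_rhs => rw [← map_snd_compProd hP]
    rw [lintegral_map (measurable_ofReal_exp (hav.const_mul _)) measurable_snd]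
  rw [h3, ← hJ] at h2
  have h4 := h1.trans h2
  rcases eq_or_ne J ∞ with h | hJf
  · rw [h]; exact le_top
  rw [← ENNReal.ofReal_toReal hIfin, ← ENNReal.ofReal_toReal hJf] at h4 ⊢
  rw [← ENNReal.ofReal_mul hβ0.le, ← ENNReal.ofReal_mul hb.le,
    ← ENNReal.ofReal_add (by positivity) (by positivity),
    ENNReal.ofReal_le_ofReal_iff (by positivity)] at h4
  refine ENNReal.ofReal_le_ofReal ?_
  have : (1 - β) * I.toReal ≤ (1 - β) * J.toReal := by linarith
  exact le_of_mul_le_mul_left this hb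

/-- The density `exp(v(x₁) + w(x₀, x₁) - v(x₀) / β)`. -/
noncomputable def dens (β : ℝ) (v : X → ℝ) (w : X × X → ℝ) (z : X × X) : ℝ :=
  Real.exp (v z.2 + w z - v z.1 / β)

theorem measurable_dens {β : ℝ} {v : X → ℝ} (hv : Measurable v) {w : X × X → ℝ}
    (hw : Measurable w) : Measurable (dens β v w) :=
  Real.measurable_exp.comp (((hv.comp measurable_snd).add hw).sub
    ((hv.comp measurable_fst).div_const β))

theorem dens_pos {Y : Type*} (β : ℝ) (v : Y → ℝ) (w : Y × Y → ℝ) (z : Y × Y) : 0 < dens β v w z :=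
  Real.exp_pos _

theorem lintegral_dens_eq_one {P : Kernel X X} {β : ℝ} {v : X → ℝ} {w : X × X → ℝ} {x : X}
    (h : ENNReal.ofReal (Real.exp (v x / β)) =
      ∫⁻ y, ENNReal.ofReal (Real.exp (v y + w (x, y))) ∂(P x)) :
    ∫⁻ y, ENNReal.ofReal (dens β v w (x, y)) ∂(P x) = 1 := by
  have : ∀ y, ENNReal.ofReal (dens β v w (x, y)) =
      ENNReal.ofReal (Real.exp (-(v x / β))) * ENNReal.ofReal (Real.exp (v y + w (x, y))) := by
    intro y
    rw [← ENNReal.ofReal_mul (Real.exp_nonneg _), ← Real.exp_add, dens]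
    congr 2
    ring
  simp_rw [this]
  rw [lintegral_const_mul' _ _ ENNReal.ofReal_ne_top, ← h,
    ← ENNReal.ofReal_mul (Real.exp_nonneg _), ← Real.exp_add]
  simp

/-- The exponent of the density is a sum of three terms. Averaging them with weights 1/3 triples
each exponent, and `moment_le`, with both marginals equal to μ, converts the two terms in v into
moments of w. -/
theorem lintegral_dens_rpow_le {μ : Measure X} [IsProbabilityMeasure μ] {P : Kernel X X}
    [IsMarkovKernel P] (hP : Kernel.Invariant P μ) {β : ℝ} (hβ0 : 0 < β) (hβ1 : β < 1)
    {v : X → ℝ} (hv : Measurable v) {w : X × X → ℝ} (hw : Measurable w)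
    (hfix : ∀ᵐ x ∂μ, ENNReal.ofReal (Real.exp (v x / β)) =
      ∫⁻ y, ENNReal.ofReal (Real.exp (v y + w (x, y))) ∂(P x))
    (hfin : AllExp μ v) {q : ℝ} (hq : 1 ≤ q) :
    ∫⁻ z, ENNReal.ofReal (dens β v w z) ^ q ∂(μ ⊗ₘ P) ≤
      ∫⁻ z, ENNReal.ofReal (Real.exp (3 * q / (1 - β) * |w z|)) ∂(μ ⊗ₘ P) := by
  have hb : 0 < 1 - β := by linarith
  have hav : Measurable fun x => |v x| := continuous_abs.measurable.comp hv
  have haw : Measurable fun z => |w z| := continuous_abs.measurable.comp hw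
  have hmom := moment_le hP hβ0 hβ1 hv hw hfix hfin (s := 3 * q) (by linarith)
  have hmeas : Measurable fun x => ENNReal.ofReal (Real.exp (3 * q / β * |v x|)) :=
    (Real.measurable_exp.comp (hav.const_mul _)).ennreal_ofReal
  set J := ∫⁻ z, ENNReal.ofReal (Real.exp (3 * q / (1 - β) * |w z|)) ∂(μ ⊗ₘ P) with hJ
  have hq3 : 0 ≤ 3 * q := by linarith
  have hvle : ∀ x, 3 * q * |v x| ≤ 3 * q / β * |v x| := by
    intro x
    have : 3 * q ≤ 3 * q / β := by rw [le_div_iff₀ hβ0]; nlinarith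
    exact mul_le_mul_of_nonneg_right this (abs_nonneg _)
  have hfst : ∫⁻ z, ENNReal.ofReal (Real.exp (3 * q / β * |v z.1|)) ∂(μ ⊗ₘ P) ≤ J := by
    refine le_trans (le_of_eq ?_) hmom
    conv_rhs => rw [← map_fst_compProd μ P]
    rw [lintegral_map hmeas measurable_fst]
  have hsnd : ∫⁻ z, ENNReal.ofReal (Real.exp (3 * q / β * |v z.2|)) ∂(μ ⊗ₘ P) ≤ J := by
    refine le_trans (le_of_eq ?_) hmom
    conv_rhs => rw [← map_snd_compProd hP]
    rw [lintegral_map hmeas measurable_snd]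
  have hthird : ∫⁻ z, ENNReal.ofReal (Real.exp (3 * q * |w z|)) ∂(μ ⊗ₘ P) ≤ J := by
    refine lintegral_mono fun z => ENNReal.ofReal_le_ofReal (Real.exp_le_exp.2 ?_)
    have : 3 * q ≤ 3 * q / (1 - β) := by rw [le_div_iff₀ hb]; nlinarith
    exact mul_le_mul_of_nonneg_right this (abs_nonneg _)
  have hc1 := lintegral_exp_convex_comb (μ ⊗ₘ P) (a := fun z => 3 * q / β * |v z.1|)
    (b := fun z => 3 * q / β * |v z.2|)
    (h := fun z => 1 / 2 * (3 * q / β * |v z.1|) + 1 / 2 * (3 * q / β * |v z.2|))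
    ((hav.comp measurable_fst).const_mul _) (s := 1 / 2) (t := 1 / 2)
    (by norm_num) (by norm_num) (by norm_num) (Eventually.of_forall fun z => le_rfl)
  have hc2 := lintegral_exp_convex_comb (μ ⊗ₘ P) (a := fun z => 3 * q * |w z|)
    (b := fun z => 1 / 2 * (3 * q / β * |v z.1|) + 1 / 2 * (3 * q / β * |v z.2|))
    (h := fun z => (v z.2 + w z - v z.1 / β) * q)
    (haw.const_mul _) (s := 1 / 3) (t := 2 / 3)
    (by norm_num) (by norm_num) (by norm_num) (Eventually.of_forall fun z => by
      have e1 : v z.2 * q ≤ q * |v z.2| := by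
        nlinarith [le_abs_self (v z.2)]
      have e2 : w z * q ≤ q * |w z| := by nlinarith [le_abs_self (w z)]
      have e3 : -(v z.1 / β) * q ≤ q / β * |v z.1| := by
        have : -(v z.1 / β) * q = q / β * -v z.1 := by ring
        rw [this]
        gcongr
        exact neg_le_abs _
      have e4 := hvle z.2
      have e5 : 3 * q / β * |v z.1| = 3 * (q / β * |v z.1|) := by ring
      linarith)
  have hlhs : ∫⁻ z, ENNReal.ofReal (dens β v w z) ^ q ∂(μ ⊗ₘ P) =
      ∫⁻ z, ENNReal.ofReal (Real.exp ((v z.2 + w z - v z.1 / β) * q)) ∂(μ ⊗ₘ P) := by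
    refine lintegral_congr fun z => ?_
    rw [dens, ENNReal.ofReal_rpow_of_pos (Real.exp_pos _), ← Real.exp_mul]
  rw [hlhs]
  refine hc2.trans ?_
  calc _ ≤ ENNReal.ofReal (1 / 3) * J + ENNReal.ofReal (2 / 3) *
        (ENNReal.ofReal (1 / 2) * J + ENNReal.ofReal (1 / 2) * J) := by
        gcongr
        refine hc1.trans ?_
        gcongr
    _ = J := by
        rw [← add_mul, ← ENNReal.ofReal_add (by norm_num) (by norm_num), ← mul_assoc,
          ← ENNReal.ofReal_mul (by norm_num), ← add_mul,
          ← ENNReal.ofReal_add (by norm_num) (by norm_num)]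
        norm_num

end Markov

end RobustValue

namespace RobustValue

/-! ### Tilted expectations, log-integrals and the Gibbs variational inequality -/

section Gibbs

variable {Ω : Type*} [MeasurableSpace Ω]

/-- The expectation of `f` under the probability measure with density proportional to `exp g`. -/
noncomputable def tilt (π : Measure Ω) (g f : Ω → ℝ) : ℝ :=
  ∫ y, Real.exp (g y) / (∫ z, Real.exp (g z) ∂π) * f y ∂π

/-- The logarithm of `∫ exp g`. -/
noncomputable def logInt (π : Measure Ω) (g : Ω → ℝ) : ℝ := Real.log (∫ y, Real.exp (g y) ∂π)

theorem exp_logInt {π : Measure Ω} [NeZero π] {g : Ω → ℝ}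
    (hg : Integrable (fun y => Real.exp (g y)) π) :
    Real.exp (logInt π g) = ∫ y, Real.exp (g y) ∂π :=
  Real.exp_log (integral_exp_pos hg)

theorem tilt_eq (π : Measure Ω) (g f : Ω → ℝ) :
    tilt π g f = (∫ y, Real.exp (g y) * f y ∂π) / ∫ y, Real.exp (g y) ∂π := by
  rw [tilt, ← integral_div]
  refine integral_congr_ae (Eventually.of_forall fun y => ?_)
  simp only
  ring

theorem integral_exp_add_const (π : Measure Ω) (g : Ω → ℝ) (c : ℝ) :
    ∫ y, Real.exp (g y + c) ∂π = Real.exp c * ∫ y, Real.exp (g y) ∂π := by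
  rw [← integral_const_mul]
  refine integral_congr_ae (Eventually.of_forall fun y => ?_)
  simp only [Real.exp_add]
  ring

theorem tilt_add_const (π : Measure Ω) (g f : Ω → ℝ) (c : ℝ) :
    tilt π (fun y => g y + c) f = tilt π g f := by
  unfold tilt
  rw [integral_exp_add_const]
  refine integral_congr_ae (Eventually.of_forall fun y => ?_)
  simp only [Real.exp_add]
  have := Real.exp_pos c
  rw [mul_comm (Real.exp (g y)), mul_div_mul_left _ _ this.ne']

theorem logInt_add_const {π : Measure Ω} [NeZero π] {g : Ω → ℝ}
    (hg : Integrable (fun y => Real.exp (g y)) π) (c : ℝ) :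
    logInt π (fun y => g y + c) = logInt π g + c := by
  unfold logInt
  rw [integral_exp_add_const, Real.log_mul (Real.exp_pos c).ne' (integral_exp_pos hg).ne',
    Real.log_exp, add_comm]

theorem tilt_smul (π : Measure Ω) (g f : Ω → ℝ) (a : ℝ) :
    tilt π g (fun y => a * f y) = a * tilt π g f := by
  unfold tilt
  rw [← integral_const_mul]
  refine integral_congr_ae (Eventually.of_forall fun y => ?_)
  simp only
  ring

theorem tilt_sub {π : Measure Ω} {g f f' : Ω → ℝ}
    (hf : Integrable (fun y => Real.exp (g y) * f y) π)
    (hf' : Integrable (fun y => Real.exp (g y) * f' y) π) :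
    tilt π g (fun y => f y - f' y) = tilt π g f - tilt π g f' := by
  rw [tilt_eq, tilt_eq, tilt_eq, ← sub_div, ← integral_sub hf hf']
  simp_rw [mul_sub]

/-- Hölder's inequality in exponential form: normalize both exponentials to integral one, then apply
convexity of exp pointwise. -/
theorem integral_le_one_of_young {π : Measure Ω} {a b h : Ω → ℝ} {s t A B : ℝ}
    (hh : Integrable (fun y => Real.exp (h y)) π)
    (ha : Integrable (fun y => Real.exp (a y)) π) (hb : Integrable (fun y => Real.exp (b y)) π)
    (hA : ∫ y, Real.exp (a y) ∂π = Real.exp A) (hB : ∫ y, Real.exp (b y) ∂π = Real.exp B)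
    (hs : 0 ≤ s) (ht : 0 ≤ t) (hst : s + t = 1) (hle : ∀ y, h y = s * a y + t * b y) :
    ∫ y, Real.exp (h y) ∂π ≤ Real.exp (s * A + t * B) := by
  have h1 : ∫ y, Real.exp (h y) ∂π ≤ ∫ y, (Real.exp (s * A + t * B)) *
      (s * Real.exp (-A) * Real.exp (a y) + t * Real.exp (-B) * Real.exp (b y)) ∂π := by
    refine integral_mono hh (((ha.const_mul _).add (hb.const_mul _)).const_mul _) fun y => ?_
    have := exp_convex_comb (a := a y - A) (b := b y - B) hs ht hst
    have e : Real.exp (h y) = Real.exp (s * A + t * B) *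
        Real.exp (s * (a y - A) + t * (b y - B)) := by
      rw [← Real.exp_add, hle]; ring_nf
    simp only
    rw [e]
    refine mul_le_mul_of_nonneg_left (this.trans (le_of_eq ?_)) (Real.exp_nonneg _)
    rw [sub_eq_neg_add, sub_eq_neg_add, Real.exp_add, Real.exp_add]
    ring
  refine h1.trans (le_of_eq ?_)
  rw [integral_const_mul, integral_add (ha.const_mul _) (hb.const_mul _), integral_const_mul,
    integral_const_mul, hA, hB, mul_assoc, mul_assoc, ← Real.exp_add, ← Real.exp_add]
  simp [hst]

theorem logInt_young {π : Measure Ω} [NeZero π] {a b h : Ω → ℝ} {s t : ℝ}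
    (hh : Integrable (fun y => Real.exp (h y)) π)
    (ha : Integrable (fun y => Real.exp (a y)) π) (hb : Integrable (fun y => Real.exp (b y)) π)
    (hs : 0 ≤ s) (ht : 0 ≤ t) (hst : s + t = 1) (hle : ∀ y, h y = s * a y + t * b y) :
    logInt π h ≤ s * logInt π a + t * logInt π b := by
  have := integral_le_one_of_young hh ha hb (exp_logInt ha).symm (exp_logInt hb).symm hs ht hst hle
  rw [← exp_logInt hh, Real.exp_le_exp] at this
  exact this

/-- The Gibbs variational inequality. -/
theorem logInt_sub_le_tilt {π : Measure Ω} [NeZero π] {g h : Ω → ℝ}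
    (hg : Integrable (fun y => Real.exp (g y)) π)
    (hh : Integrable (fun y => Real.exp (h y)) π)
    (hi : Integrable (fun y => Real.exp (h y) * (h y - g y)) π) :
    logInt π h - logInt π g ≤ tilt π h (fun y => h y - g y) := by
  set c := tilt π h (fun y => h y - g y) with hc
  have hZ := integral_exp_pos hh
  rw [tilt_eq] at hc
  have hcZ : ∫ y, Real.exp (h y) * (h y - g y) ∂π = c * ∫ y, Real.exp (h y) ∂π := by
    rw [hc]; field_simp
  -- Write e^g = e^{-c} e^h e^{c-(h-g)} and use e^x ≥ 1 + x at x = c - (h - g), which has mean zero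
  -- under the tilt by h.
  have h1 : ∫ y, Real.exp (-c) * ((1 + c) * Real.exp (h y) - Real.exp (h y) * (h y - g y)) ∂π ≤
      ∫ y, Real.exp (g y) ∂π := by
    refine integral_mono (((hh.const_mul _).sub hi).const_mul _) hg fun y => ?_
    have e : Real.exp (g y) = Real.exp (-c) * (Real.exp (h y) * Real.exp (c - (h y - g y))) := by
      rw [← Real.exp_add, ← Real.exp_add]; ring_nf
    simp only
    rw [e]
    refine mul_le_mul_of_nonneg_left ?_ (Real.exp_nonneg _)
    nlinarith [Real.add_one_le_exp (c - (h y - g y)), Real.exp_pos (h y)]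
  rw [integral_const_mul, integral_sub (hh.const_mul _) hi, integral_const_mul, hcZ,
    ← exp_logInt hg, ← exp_logInt hh] at h1
  have h2 : Real.exp (-c + logInt π h) ≤ Real.exp (logInt π g) := by
    rw [Real.exp_add]; linarith
  linarith [Real.exp_le_exp.1 h2]

theorem tilt_le_logInt_sub {π : Measure Ω} [NeZero π] {g h : Ω → ℝ}
    (hg : Integrable (fun y => Real.exp (g y)) π)
    (hh : Integrable (fun y => Real.exp (h y)) π)
    (hi : Integrable (fun y => Real.exp (g y) * (h y - g y)) π) :
    tilt π g (fun y => h y - g y) ≤ logInt π h - logInt π g := by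
  have := logInt_sub_le_tilt hh hg (hi.neg.congr (Eventually.of_forall fun y => by
    simp only [Pi.neg_apply]; ring))
  have e : tilt π g (fun y => g y - h y) = -tilt π g (fun y => h y - g y) := by
    rw [← neg_one_mul, ← tilt_smul]
    congr 1; ext y; ring
  linarith

theorem integrable_exp_of_convex {π : Measure Ω} {a b h : Ω → ℝ} {s t : ℝ}
    (hm : Measurable h)
    (ha : Integrable (fun y => Real.exp (a y)) π) (hb : Integrable (fun y => Real.exp (b y)) π)
    (hs : 0 ≤ s) (ht : 0 ≤ t) (hst : s + t = 1) (hle : ∀ y, h y ≤ s * a y + t * b y) :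
    Integrable (fun y => Real.exp (h y)) π := by
  refine ((ha.const_mul s).add (hb.const_mul t)).mono'
    (Real.measurable_exp.comp hm).aestronglyMeasurable (Eventually.of_forall fun y => ?_)
  rw [Real.norm_of_nonneg (Real.exp_nonneg _)]
  exact (Real.exp_le_exp.2 (hle y)).trans (exp_convex_comb hs ht hst)

theorem integrable_exp_of_le {π : Measure Ω} {a h : Ω → ℝ} (hm : Measurable h)
    (ha : Integrable (fun y => Real.exp (a y)) π) (hle : ∀ y, h y ≤ a y) :
    Integrable (fun y => Real.exp (h y)) π :=
  integrable_exp_of_convex hm ha ha zero_le_one le_rfl (by norm_num)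
    (fun y => by simpa using hle y)

theorem integrable_exp_iff {π : Measure Ω} {h : Ω → ℝ} (hm : Measurable h) :
    Integrable (fun y => Real.exp (h y)) π ↔
      ∫⁻ y, ENNReal.ofReal (Real.exp (h y)) ∂π < ∞ := by
  rw [lt_top_iff_ne_top]
  exact (lintegral_ofReal_ne_top_iff_integrable
    (Real.measurable_exp.comp hm).aestronglyMeasurable
    (Eventually.of_forall fun y => Real.exp_nonneg _)).symm

theorem AllExp.integrable {π : Measure Ω} {f : Ω → ℝ} (hf : AllExp π f) (hm : Measurable f)
    (s : ℝ) : Integrable (fun y => Real.exp (s * |f y|)) π :=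
  (integrable_exp_iff ((continuous_abs.measurable.comp hm).const_mul s)).2 (hf s)

theorem AllExp.integrable_exp {π : Measure Ω} {f : Ω → ℝ} (hf : AllExp π f) (hm : Measurable f) :
    Integrable (fun y => Real.exp (f y)) π :=
  integrable_exp_of_le hm (hf.integrable hm 1) fun y => by rw [one_mul]; exact le_abs_self _

theorem AllExp.abs {π : Measure Ω} {f : Ω → ℝ} (hf : AllExp π f) : AllExp π (fun y => |f y|) := by
  intro s; simpa using hf s

/-- Young's inequality with weights 1 - 1/p and 1/p: since A has exponential moments of every order,
any p > 1 is enough for l. -/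
theorem AllExp.integrable_exp_add {π : Measure Ω} {A l : Ω → ℝ} (hA : AllExp π A)
    (hAm : Measurable A) (hlm : Measurable l) {p : ℝ} (hp : 1 < p)
    (hl : Integrable (fun y => Real.exp (p * l y)) π) :
    Integrable (fun y => Real.exp (A y + l y)) π := by
  have hp0 : 0 < p := by linarith
  have hp1 : 1 / p < 1 := by rw [div_lt_one hp0]; exact hp
  refine integrable_exp_of_convex (hAm.add hlm) (hA.integrable hAm (1 / (1 - 1 / p))) hl
    (s := 1 - 1 / p) (t := 1 / p) (by linarith) (by positivity) (by ring) fun y => ?_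
  have e1 : (1 - 1 / p) * (1 / (1 - 1 / p) * |A y|) = |A y| := by
    rw [← mul_assoc, mul_one_div_cancel (by linarith), one_mul]
  have e2 : 1 / p * (p * l y) = l y := by field_simp
  rw [e1, e2]
  linarith [le_abs_self (A y)]

theorem abs_le_exp_mul {ε x : ℝ} (hε : 0 < ε) : |x| ≤ 1 / ε * Real.exp (ε * |x|) := by
  rw [div_mul_eq_mul_div, one_mul, le_div_iff₀ hε]
  linarith [Real.add_one_le_exp (ε * |x|)]

/-- A function with an exponential moment is integrable against a density all of whose
exponential moments are finite. -/
theorem AllExp.integrable_exp_mul {π : Measure Ω} {A l : Ω → ℝ} (hA : AllExp π A)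
    (hAm : Measurable A) (hlm : Measurable l) {c : ℝ} (hc : 0 < c)
    (hl : Integrable (fun y => Real.exp (c * |l y|)) π) :
    Integrable (fun y => Real.exp (A y) * l y) π := by
  have habs : Measurable fun y => |l y| := continuous_abs.measurable.comp hlm
  have h := hA.integrable_exp_add hAm (habs.const_mul (c / 2)) (p := 2) one_lt_two
    (by
      refine hl.congr (Eventually.of_forall fun y => ?_)
      simp only
      ring_nf)
  refine (h.const_mul (1 / (c / 2))).mono'
    ((Real.measurable_exp.comp hAm).mul hlm).aestronglyMeasurable
    (Eventually.of_forall fun y => ?_)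
  rw [norm_mul, Real.norm_of_nonneg (Real.exp_nonneg _), Real.norm_eq_abs, Real.exp_add]
  calc _ ≤ Real.exp (A y) * (1 / (c / 2) * Real.exp (c / 2 * |l y|)) := by
        gcongr
        exact abs_le_exp_mul (by positivity)
    _ = _ := by ring

theorem AllExp.integrable_exp_add_mul_left {π : Measure Ω} {A D l : Ω → ℝ} (hA : AllExp π A)
    (hAm : Measurable A) (hD : AllExp π D) (hDm : Measurable D) (hlm : Measurable l) {p : ℝ}
    (hp : 1 < p) (hl : Integrable (fun y => Real.exp (p * l y)) π) :
    Integrable (fun y => Real.exp (A y + l y) * D y) π := by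
  have habs : Measurable fun y => |D y| := continuous_abs.measurable.comp hDm
  have h := (hA.add hD.abs hAm).integrable_exp_add (hAm.add habs) hlm hp hl
  refine h.mono'
    ((Real.measurable_exp.comp (hAm.add hlm)).mul hDm).aestronglyMeasurable
    (Eventually.of_forall fun y => ?_)
  rw [norm_mul, Real.norm_of_nonneg (Real.exp_nonneg _), Real.norm_eq_abs, Pi.add_apply,
    add_right_comm, Real.exp_add (A y + l y)]
  gcongr
  linarith [Real.add_one_le_exp |D y|]

/-- Only the upper tail of l needs a moment. Where l ≤ 0 the product e^l |l| is at most 1; where l ≥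
0 the factor l is absorbed into e^{el}/e, with 1 + e still below p. -/
theorem AllExp.integrable_exp_add_mul_right {π : Measure Ω} {A l : Ω → ℝ} (hA : AllExp π A)
    (hAm : Measurable A) (hlm : Measurable l) {p : ℝ}
    (hp : 1 < p) (hl : Integrable (fun y => Real.exp (p * l y)) π) :
    Integrable (fun y => Real.exp (A y + l y) * l y) π := by
  set e := (p - 1) / 2 with he
  have he0 : 0 < e := by rw [he]; linarith
  have h := hA.integrable_exp_add hAm (hlm.const_mul (1 + e)) (p := p / (1 + e))
    (by rw [lt_div_iff₀ (by linarith), he]; linarith)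
    (by
      refine hl.congr (Eventually.of_forall fun y => ?_)
      simp only
      congr 1
      field_simp)
  refine ((h.const_mul (1 / e)).add (hA.integrable_exp hAm)).mono'
    ((Real.measurable_exp.comp (hAm.add hlm)).mul hlm).aestronglyMeasurable
    (Eventually.of_forall fun y => ?_)
  rw [norm_mul, Real.norm_of_nonneg (Real.exp_nonneg _), Real.norm_eq_abs]
  simp only [Pi.add_apply]
  rw [Real.exp_add, Real.exp_add, add_mul, Real.exp_add (1 * l y), one_mul]
  have hA0 := Real.exp_pos (A y)
  have hl0 := Real.exp_pos (l y)
  rcases le_total 0 (l y) with h0 | h0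
  · have h1 := abs_le_exp_mul (x := l y) he0
    rw [abs_of_nonneg h0] at h1 ⊢
    have h2 := mul_le_mul_of_nonneg_left h1 (mul_pos hA0 hl0).le
    nlinarith
  · rw [abs_of_nonpos h0]
    have h1 : Real.exp (l y) * -l y ≤ 1 := by
      have h2 := Real.add_one_le_exp (-l y)
      have h3 : Real.exp (l y) * Real.exp (-l y) = 1 := by rw [← Real.exp_add]; simp
      nlinarith
    have h2 := mul_le_mul_of_nonneg_left h1 hA0.le
    have h3 : 0 ≤ 1 / e * (Real.exp (A y) * (Real.exp (l y) * Real.exp (e * l y))) := by positivity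
    nlinarith

/-- Passes from a signed tilted expectation to a lower integral of a nonnegative majorant, the form
that the contraction estimates take as input. -/
theorem ofReal_tilt_le {π : Measure Ω} {g f F : Ω → ℝ} {a : ℝ}
    (ha : ∫ y, Real.exp (g y) ∂π = Real.exp a)
    (hi : Integrable (fun y => Real.exp (g y) * f y) π) (hF : ∀ y, f y ≤ F y)
    (hF0 : ∀ y, 0 ≤ F y) :
    ENNReal.ofReal (tilt π g f) ≤ ∫⁻ y, ENNReal.ofReal (Real.exp (g y - a) * F y) ∂π := by
  have hi' : Integrable (fun y => Real.exp (g y - a) * f y) π := by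
    refine (hi.const_mul (Real.exp (-a))).congr (Eventually.of_forall fun y => ?_)
    simp only
    rw [sub_eq_add_neg, Real.exp_add]; ring
  have e : tilt π g f = ∫ y, Real.exp (g y - a) * f y ∂π := by
    rw [tilt, ha]
    refine integral_congr_ae (Eventually.of_forall fun y => ?_)
    simp only
    rw [Real.exp_sub]
  rw [e]
  calc ENNReal.ofReal (∫ y, Real.exp (g y - a) * f y ∂π)
      ≤ ENNReal.ofReal (∫ y, max (Real.exp (g y - a) * f y) 0 ∂π) :=
        ENNReal.ofReal_le_ofReal (integral_mono hi' hi'.pos_part fun y => le_max_left _ _)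
    _ = ∫⁻ y, ENNReal.ofReal (max (Real.exp (g y - a) * f y) 0) ∂π :=
        ofReal_integral_eq_lintegral_ofReal hi'.pos_part
          (Eventually.of_forall fun y => le_max_right _ _)
    _ ≤ _ := by
        refine lintegral_mono fun y => ENNReal.ofReal_le_ofReal (max_le ?_ ?_)
        · exact mul_le_mul_of_nonneg_left (hF y) (Real.exp_nonneg _)
        · exact mul_nonneg (Real.exp_nonneg _) (hF0 y)

end Gibbs

/-! ### Second-order remainder of a tilted cumulant generating function -/

section SecondOrder

variable {Ω : Type*} [MeasurableSpace Ω]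

/-- The Taylor remainder is at most (sy)² e^{|sy|}. As s ≤ 1/2, the exponential uses only half of
e^{|y|}; the other half absorbs y² ≤ 8e^{|y|/2}. -/
theorem exp_mul_le_quadratic {s y : ℝ} (hs : 0 ≤ s) (hs' : s ≤ 1 / 2) :
    Real.exp (s * y) ≤ 1 + s * y + 8 * s ^ 2 * (Real.exp y + Real.exp (-y)) := by
  have h1 : Real.exp (s * y) ≤ 1 + s * y + (s * y) ^ 2 * Real.exp |s * y| := by
    rcases le_total 0 (s * y) with h | h
    · rw [abs_of_nonneg h]
      set x := s * y
      have h2 : Real.exp x - 1 ≤ x * Real.exp x := by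
        have := Real.add_one_le_exp (-x)
        have h3 : Real.exp x * Real.exp (-x) = 1 := by rw [← Real.exp_add]; simp
        nlinarith [Real.exp_pos x]
      nlinarith
    · rw [abs_of_nonpos h]
      set x := s * y
      have h2 : Real.exp x - 1 ≤ x * Real.exp x := by
        have := Real.add_one_le_exp (-x)
        have h3 : Real.exp x * Real.exp (-x) = 1 := by rw [← Real.exp_add]; simp
        nlinarith [Real.exp_pos x]
      have h4 : 1 ≤ Real.exp (-x) := Real.one_le_exp (by linarith)
      have h5 : x + 1 ≤ Real.exp x := Real.add_one_le_exp x
      have h6 : x ^ 2 ≤ x ^ 2 * Real.exp (-x) := le_mul_of_one_le_right (sq_nonneg x) h4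
      nlinarith
  have h2 : Real.exp |s * y| ≤ Real.exp (|y| / 2) := by
    rw [Real.exp_le_exp, abs_mul, abs_of_nonneg hs]
    nlinarith [abs_nonneg y]
  have h3 : y ^ 2 ≤ 8 * Real.exp (|y| / 2) := by
    have := Real.quadratic_le_exp_of_nonneg (x := |y| / 2) (by positivity)
    have h4 : |y| ^ 2 = y ^ 2 := sq_abs y
    nlinarith [abs_nonneg y]
  have h4 : Real.exp (|y| / 2) * Real.exp (|y| / 2) ≤ Real.exp y + Real.exp (-y) := by
    rw [← Real.exp_add, add_halves]
    rcases abs_cases y with ⟨h, -⟩ | ⟨h, -⟩ <;> rw [h] <;>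
      linarith [Real.exp_pos y, Real.exp_pos (-y)]
  have h5 : (s * y) ^ 2 * Real.exp |s * y| ≤
      8 * s ^ 2 * (Real.exp y + Real.exp (-y)) := by
    have e1 := Real.exp_pos (|y| / 2)
    calc (s * y) ^ 2 * Real.exp |s * y| ≤ s ^ 2 * (y ^ 2 * Real.exp (|y| / 2)) := by
          rw [mul_pow, mul_assoc]; gcongr
      _ ≤ s ^ 2 * (8 * Real.exp (|y| / 2) * Real.exp (|y| / 2)) := by gcongr
      _ ≤ s ^ 2 * (8 * (Real.exp y + Real.exp (-y))) := by
          rw [mul_assoc]; gcongr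
      _ = _ := by ring
  linarith

/-- Under a density `exp g`, the second-order remainder of the cumulant generating function of `f`
at `s ≤ 1/2` is at most `16 s² exp S`, where `S` is the symmetrized cumulant at `1`. -/
theorem remainder_le_quadratic {π : Measure Ω} [NeZero π] {g f : Ω → ℝ}
    (hg : Integrable (fun y => Real.exp (g y)) π) (hg1 : ∫ y, Real.exp (g y) ∂π = 1)
    (h1 : Integrable (fun y => Real.exp (g y + f y)) π)
    (h2 : Integrable (fun y => Real.exp (g y - f y)) π)
    (hf : Integrable (fun y => Real.exp (g y) * f y) π)
    {s : ℝ} (hs : 0 ≤ s) (hs' : s ≤ 1 / 2)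
    (h3 : Integrable (fun y => Real.exp (g y + s * f y)) π) :
    logInt π (fun y => g y + s * f y) - s * ∫ y, Real.exp (g y) * f y ∂π ≤
      16 * s ^ 2 * Real.exp
        (logInt π (fun y => g y + f y) + logInt π (fun y => g y - f y)) := by
  set c := ∫ y, Real.exp (g y) * f y ∂π with hc
  have hg0 : logInt π g = 0 := by rw [logInt, hg1, Real.log_one]
  have ht : tilt π g f = c := by rw [tilt_eq, hg1, div_one]
  have hlo1 : c ≤ logInt π (fun y => g y + f y) := by
    have := tilt_le_logInt_sub hg h1 (by simpa using hf)
    simp only [add_sub_cancel_left] at this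
    rwa [hg0, sub_zero, ht] at this
  have hlo2 : -c ≤ logInt π (fun y => g y - f y) := by
    have := tilt_le_logInt_sub hg h2 (by simpa using hf.neg)
    have e : tilt π g (fun y => g y - f y - g y) = -c := by
      rw [← ht, ← neg_one_mul, ← tilt_smul]; congr 1; ext y; ring
    rwa [hg0, sub_zero, e] at this
  set A := logInt π (fun y => g y + f y) with hA
  set B := logInt π (fun y => g y - f y) with hB
  have hAe : ∫ y, Real.exp (g y + f y) ∂π = Real.exp A := (exp_logInt h1).symm
  have hBe : ∫ y, Real.exp (g y - f y) ∂π = Real.exp B := (exp_logInt h2).symm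
  -- Expanding around the tilted mean c removes the first-order term; `exp_mul_le_quadratic` is
  -- applied to f - c.
  have hint : ∫ y, Real.exp (g y + s * f y) ∂π ≤
      Real.exp (s * c) *
        (1 + 8 * s ^ 2 * (Real.exp (-c) * Real.exp A + Real.exp c * Real.exp B)) := by
    have hle : ∫ y, Real.exp (g y + s * f y) ∂π ≤ ∫ y, Real.exp (s * c) *
        (((1 - s * c) * Real.exp (g y) + s * (Real.exp (g y) * f y)) +
          (8 * s ^ 2 * Real.exp (-c) * Real.exp (g y + f y) +
          8 * s ^ 2 * Real.exp c * Real.exp (g y - f y))) ∂π := by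
      refine integral_mono h3 ((((hg.const_mul _).add (hf.const_mul _)).add
        ((h1.const_mul _).add (h2.const_mul _))).const_mul _) fun y => ?_
      have hq := exp_mul_le_quadratic (y := f y - c) hs hs'
      have e0 : Real.exp (g y + s * f y) =
          Real.exp (s * c) * (Real.exp (g y) * Real.exp (s * (f y - c))) := by
        rw [← Real.exp_add, ← Real.exp_add]; ring_nf
      have e1 : Real.exp (-c) * Real.exp (g y + f y) = Real.exp (g y) * Real.exp (f y - c) := by
        rw [← Real.exp_add, ← Real.exp_add]; ring_nf
      have e2 : Real.exp c * Real.exp (g y - f y) = Real.exp (g y) * Real.exp (-(f y - c)) := by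
        rw [← Real.exp_add, ← Real.exp_add]; ring_nf
      simp only
      rw [e0, mul_assoc (8 * s ^ 2), mul_assoc (8 * s ^ 2), e1, e2]
      refine mul_le_mul_of_nonneg_left ?_ (Real.exp_nonneg _)
      have := mul_le_mul_of_nonneg_left hq (Real.exp_nonneg (g y))
      linarith
    refine hle.trans (le_of_eq ?_)
    have i1 : Integrable (fun y => (1 - s * c) * Real.exp (g y) + s * (Real.exp (g y) * f y)) π :=
      (hg.const_mul _).add (hf.const_mul _)
    have i2 : Integrable (fun y => 8 * s ^ 2 * Real.exp (-c) * Real.exp (g y + f y) +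
        8 * s ^ 2 * Real.exp c * Real.exp (g y - f y)) π :=
      (h1.const_mul _).add (h2.const_mul _)
    rw [integral_const_mul, integral_add i1 i2,
      integral_add (hg.const_mul _) (hf.const_mul _),
      integral_add (h1.const_mul _) (h2.const_mul _), integral_const_mul, integral_const_mul,
      integral_const_mul, integral_const_mul, hg1, hAe, hBe, ← hc]
    ring
  -- The Gibbs bounds -c ≤ B and c ≤ A eliminate c from the constant.
  have hb1 : Real.exp (-c) * Real.exp A ≤ Real.exp (A + B) := by
    rw [← Real.exp_add, Real.exp_le_exp]; linarith
  have hb2 : Real.exp c * Real.exp B ≤ Real.exp (A + B) := by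
    rw [← Real.exp_add, Real.exp_le_exp]; linarith
  rw [← exp_logInt h3] at hint
  have hfin : Real.exp (logInt π (fun y => g y + s * f y)) ≤
      Real.exp (s * c + 16 * s ^ 2 * Real.exp (A + B)) := by
    refine hint.trans ?_
    rw [Real.exp_add (s * c)]
    refine mul_le_mul_of_nonneg_left ?_ (Real.exp_nonneg _)
    refine le_trans ?_ (Real.add_one_le_exp _)
    nlinarith [sq_nonneg s]
  linarith [Real.exp_le_exp.1 hfin]

/-- The remainder is also at most `s S`. -/
theorem remainder_le_linear {π : Measure Ω} [NeZero π] {g f : Ω → ℝ}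
    (hg : Integrable (fun y => Real.exp (g y)) π) (hg1 : ∫ y, Real.exp (g y) ∂π = 1)
    (h1 : Integrable (fun y => Real.exp (g y + f y)) π)
    (h2 : Integrable (fun y => Real.exp (g y - f y)) π)
    (hf : Integrable (fun y => Real.exp (g y) * f y) π)
    {s : ℝ} (hs : 0 ≤ s) (hs' : s ≤ 1)
    (h3 : Integrable (fun y => Real.exp (g y + s * f y)) π) :
    logInt π (fun y => g y + s * f y) - s * ∫ y, Real.exp (g y) * f y ∂π ≤
      s * (logInt π (fun y => g y + f y) + logInt π (fun y => g y - f y)) := by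
  have hg0 : logInt π g = 0 := by rw [logInt, hg1, Real.log_one]
  have hlo2 : -(∫ y, Real.exp (g y) * f y ∂π) ≤ logInt π (fun y => g y - f y) := by
    have := tilt_le_logInt_sub hg h2 (by simpa using hf.neg)
    have ht : tilt π g f = ∫ y, Real.exp (g y) * f y ∂π := by rw [tilt_eq, hg1, div_one]
    have e : tilt π g (fun y => g y - f y - g y) = -(∫ y, Real.exp (g y) * f y ∂π) := by
      rw [← ht, ← neg_one_mul, ← tilt_smul]; congr 1; ext y; ring
    rwa [hg0, sub_zero, e] at this
  -- The cumulant is convex in s and vanishes at s = 0, hence lies below its chord on [0, 1].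
  have hy := logInt_young h3 h1 hg hs (t := 1 - s) (by linarith) (by ring)
    (fun y => by ring)
  rw [hg0, mul_zero, add_zero] at hy
  nlinarith [mul_le_mul_of_nonneg_left hlo2 hs]

theorem logInt_nonneg_symm {π : Measure Ω} [IsProbabilityMeasure π] {f : Ω → ℝ}
    (h1 : Integrable (fun y => Real.exp (f y)) π) (h2 : Integrable (fun y => Real.exp (-f y)) π)
    (hf : Integrable f π) :
    ∫ y, f y ∂π ≤ logInt π f ∧ -∫ y, f y ∂π ≤ logInt π (fun y => -f y) := by
  have hz : logInt π (fun _ => 0) = 0 := by simp [logInt]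
  constructor
  · have := tilt_le_logInt_sub (π := π) (g := fun _ => 0) (h := f) (by simp) h1
      (by simpa using hf)
    rw [hz, tilt_eq] at this
    simpa using this
  · have := tilt_le_logInt_sub (π := π) (g := fun _ => 0) (h := fun y => -f y) (by simp) h2
      (by simpa using hf.neg)
    rw [hz, tilt_eq] at this
    simpa [integral_neg] using this

/-- From (e^g - 1)² ≥ 0 and ∫ e^g = 1 one gets ∫ e^{2g} ≥ 1. -/
theorem logInt_two_mul_nonneg {π : Measure Ω} [IsProbabilityMeasure π] {g : Ω → ℝ}
    (hgm : Measurable g) (hg : AllExp π g) (hg1 : ∫ y, Real.exp (g y) ∂π = 1) :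
    0 ≤ logInt π (fun y => 2 * g y) := by
  have hgi := hg.integrable_exp hgm
  have h2g : Integrable (fun y => Real.exp (2 * g y)) π :=
    (hg.const_mul 2).integrable_exp (hgm.const_mul 2)
  apply Real.log_nonneg
  have : ∫ y, (2 * Real.exp (g y) - 1) ∂π ≤ ∫ y, Real.exp (2 * g y) ∂π := by
    refine integral_mono ((hgi.const_mul 2).sub (integrable_const 1)) h2g fun y => ?_
    have : Real.exp (2 * g y) = Real.exp (g y) * Real.exp (g y) := by
      rw [← Real.exp_add]; ring_nf
    simp only
    nlinarith [sq_nonneg (Real.exp (g y) - 1)]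
  rw [integral_sub (hgi.const_mul 2) (integrable_const 1), integral_const_mul, hg1] at this
  simp at this
  linarith

/-- The remainder of the cumulant generating function under the density `exp g`, in terms of the
symmetrized cumulant `σ` of `f` without the density. -/
theorem remainder_le {π : Measure Ω} [IsProbabilityMeasure π] {g f : Ω → ℝ}
    (hgm : Measurable g) (hfm : Measurable f) (hg : AllExp π g)
    (hg1 : ∫ y, Real.exp (g y) ∂π = 1)
    (hf : Integrable (fun y => Real.exp (2 * |f y|)) π)
    {s K : ℝ} (hs : 0 ≤ s) (hs' : s ≤ 1 / 2) :
    logInt π (fun y => g y + s * f y) - s * ∫ y, Real.exp (g y) * f y ∂π ≤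
      3 / 2 * s * (logInt π (fun y => 2 * f y) + logInt π (fun y => -(2 * f y))) +
      16 * s ^ 2 * Real.exp (3 / 2 * K) +
      3 / 2 * s * (if logInt π (fun y => 2 * g y) ≤ K then 0 else logInt π (fun y => 2 * g y)) := by
  have hgi := hg.integrable_exp hgm
  have h2f : Integrable (fun y => Real.exp (2 * f y)) π :=
    integrable_exp_of_le (hfm.const_mul 2) hf fun y => by linarith [le_abs_self (f y)]
  have h2f' : Integrable (fun y => Real.exp (-(2 * f y))) π :=
    integrable_exp_of_le (hfm.const_mul 2).neg hf fun y => by linarith [neg_abs_le (f y)]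
  have h2g : Integrable (fun y => Real.exp (2 * g y)) π :=
    (hg.const_mul 2).integrable_exp (hgm.const_mul 2)
  have h1 : Integrable (fun y => Real.exp (g y + f y)) π :=
    hg.integrable_exp_add hgm hfm one_lt_two h2f
  have h2 : Integrable (fun y => Real.exp (g y - f y)) π := by
    simpa [sub_eq_add_neg] using hg.integrable_exp_add hgm hfm.neg one_lt_two
      (by simpa using h2f')
  have hfe : Integrable (fun y => Real.exp (g y) * f y) π :=
    hg.integrable_exp_mul hgm hfm two_pos hf
  have h3 : Integrable (fun y => Real.exp (g y + s * f y)) π :=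
    integrable_exp_of_convex (hgm.add (hfm.const_mul s)) h1 hgi hs (t := 1 - s) (by linarith)
      (by ring) (fun y => by linarith)
  have hq := remainder_le_quadratic hgi hg1 h1 h2 hfe hs hs' h3
  have hl := remainder_le_linear hgi hg1 h1 h2 hfe hs (by linarith) h3
  have hy1 := logInt_young h1 h2g h2f (s := 1 / 2) (t := 1 / 2) (by norm_num) (by norm_num)
    (by norm_num) (fun y => by ring)
  have hy2 := logInt_young h2 h2g h2f' (s := 1 / 2) (t := 1 / 2) (by norm_num) (by norm_num)
    (by norm_num) (fun y => by ring)
  have hfint : Integrable (fun y => 2 * f y) π := by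
    refine hf.mono' (hfm.const_mul 2).aestronglyMeasurable (Eventually.of_forall fun y => ?_)
    rw [Real.norm_eq_abs, abs_mul, abs_two]
    linarith [Real.add_one_le_exp (2 * |f y|)]
  have hσ := logInt_nonneg_symm h2f h2f' hfint
  have hb0 := logInt_two_mul_nonneg hgm hg hg1
  set b := logInt π (fun y => 2 * g y)
  set σ := logInt π (fun y => 2 * f y) + logInt π (fun y => -(2 * f y)) with hσd
  set S := logInt π (fun y => g y + f y) + logInt π (fun y => g y - f y)
  have hσ0 : 0 ≤ σ := by linarith
  -- Cauchy-Schwarz separates the tilt from f. If b ≤ σ then S ≤ 3σ/2 and the linear bound suffices.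
  -- Otherwise S ≤ 3b/2: use the quadratic bound when b ≤ K and the linear one when b > K.
  have hS : S ≤ b + 1 / 2 * σ := by linarith
  have hsS := mul_le_mul_of_nonneg_left hS hs
  have hp1 : 0 ≤ 16 * s ^ 2 * Real.exp (3 / 2 * K) := by positivity
  have hp2 : 0 ≤ 3 / 2 * s * σ := by positivity
  split_ifs with hbK
  · rcases le_total b σ with h | h
    · have := mul_le_mul_of_nonneg_left h hs
      linarith
    · have hSK : S ≤ 3 / 2 * K := by linarith
      have : 16 * s ^ 2 * Real.exp S ≤ 16 * s ^ 2 * Real.exp (3 / 2 * K) := by gcongr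
      linarith
  · rcases le_total b σ with h | h
    · have := mul_le_mul_of_nonneg_left h hs
      have h4 : 0 ≤ 3 / 2 * s * b := by positivity
      linarith
    · have := mul_le_mul_of_nonneg_left h hs
      linarith

/-- The remainder is nonnegative by the Gibbs inequality, so the one-sided bound of `remainder_le`
already controls its absolute value. -/
theorem abs_remainder_le {π : Measure Ω} [IsProbabilityMeasure π] {g f η : Ω → ℝ}
    (hgm : Measurable g) (hfm : Measurable f) (hg : AllExp π g)
    (hg1 : ∫ y, Real.exp (g y) ∂π = 1)
    (hf : Integrable (fun y => Real.exp (2 * |f y|)) π)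
    {s : ℝ} (K : ℝ) (hs : 0 ≤ s) (hs' : s ≤ 1 / 2) (hη : ∀ y, s * f y = η y) :
    |logInt π (fun y => g y + η y) - ∫ y, Real.exp (g y) * η y ∂π| ≤
      3 / 2 * s * (logInt π (fun y => 2 * f y) + logInt π (fun y => -(2 * f y))) +
      16 * s ^ 2 * Real.exp (3 / 2 * K) +
      3 / 2 * s * (if logInt π (fun y => 2 * g y) ≤ K then 0 else logInt π (fun y => 2 * g y)) := by
  have hr := remainder_le hgm hfm hg hg1 hf hs hs' (K := K)
  obtain rfl : (fun y => s * f y) = η := funext hη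
  have hgi := hg.integrable_exp hgm
  have hge : Integrable (fun y => Real.exp (g y + s * f y)) π := by
    refine hg.integrable_exp_add hgm (hfm.const_mul s) one_lt_two ?_
    refine integrable_exp_of_le ((hfm.const_mul s).const_mul 2) hf fun y => ?_
    nlinarith [le_abs_self (f y), abs_nonneg (f y)]
  have hfe : Integrable (fun y => Real.exp (g y) * (s * f y)) π := by
    refine ((hg.integrable_exp_mul hgm hfm two_pos hf).const_mul s).congr
      (Eventually.of_forall fun y => ?_)
    simp only
    ring
  have e1 : s * ∫ y, Real.exp (g y) * f y ∂π = ∫ y, Real.exp (g y) * (s * f y) ∂π := by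
    rw [← integral_const_mul]
    refine integral_congr_ae (Eventually.of_forall fun y => ?_)
    simp only
    ring
  rw [e1] at hr
  have hlow : 0 ≤ logInt π (fun y => g y + s * f y) - ∫ y, Real.exp (g y) * (s * f y) ∂π := by
    have := tilt_le_logInt_sub hgi hge (by simpa using hfe)
    rw [tilt_eq, hg1, div_one] at this
    simp only [add_sub_cancel_left] at this
    have h0 : logInt π g = 0 := by rw [logInt, hg1, Real.log_one]
    linarith
  rwa [abs_of_nonneg hlow]

end SecondOrder

end RobustValue

namespace RobustValue

/-! ### Conditional laws of the chain, and consequences of differentiability of κ -/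

section Slices

variable {X : Type*} [MeasurableSpace X]

theorem opD_eq_tilt (β θ : ℝ) (u : X × X → ℝ) (Q : Kernel X X) (h f : X × X → ℝ) (x : X) :
    opD β θ u Q h f x =
      β * tilt (Q x) (fun y => h (x, y) + alpha β θ * u (x, y)) (fun y => f (x, y)) := rfl

theorem kappa_eq_logInt (Q : Kernel X X) (η : X × X → ℝ) (x : X) :
    kappa Q η x = logInt (Q x) (fun y => η (x, y)) := rfl

theorem measurable_condE (Q : Kernel X X) [IsSFiniteKernel Q] {f : X × X → ℝ}
    (hf : Measurable f) : Measurable (condE Q f) :=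
  (hf.stronglyMeasurable.integral_kernel_prod_right' (κ := Q)).measurable

theorem measurable_logInt (Q : Kernel X X) [IsSFiniteKernel Q] {f : X × X → ℝ}
    (hf : Measurable f) : Measurable fun x => logInt (Q x) (fun y => f (x, y)) :=
  Real.measurable_log.comp (measurable_condE Q (Real.measurable_exp.comp hf))

theorem measurable_kappa (Q : Kernel X X) [IsSFiniteKernel Q] {f : X × X → ℝ}
    (hf : Measurable f) : Measurable (kappa Q f) :=
  measurable_logInt Q hf

theorem measurable_opD (β θ : ℝ) {u : X × X → ℝ} (hu : Measurable u) (Q : Kernel X X)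
    [IsSFiniteKernel Q] {g f : X × X → ℝ} (hg : Measurable g) (hf : Measurable f) :
    Measurable (opD β θ u Q g f) := by
  have h1 : Measurable fun z => Real.exp (g z + alpha β θ * u z) :=
    Real.measurable_exp.comp (hg.add (hu.const_mul _))
  have h2 : Measurable (distortion β θ u Q g) :=
    h1.div ((measurable_condE Q h1).comp measurable_fst)
  exact (measurable_condE Q (h2.mul hf)).const_mul β

theorem ae_lintegral_slice_lt_top {μ : Measure X} [SFinite μ] {P : Kernel X X} [IsSFiniteKernel P]
    {F : X × X → ℝ≥0∞} (hF : Measurable F) (h : ∫⁻ z, F z ∂(μ ⊗ₘ P) < ∞) :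
    ∀ᵐ x ∂μ, ∫⁻ y, F (x, y) ∂(P x) < ∞ := by
  rw [Measure.lintegral_compProd hF] at h
  exact ae_lt_top hF.lintegral_kernel_prod_right' h.ne

theorem ae_integrable_exp_slice {μ : Measure X} [SFinite μ] {P : Kernel X X} [IsSFiniteKernel P]
    {h : X × X → ℝ} (hm : Measurable h)
    (hfin : ∫⁻ z, ENNReal.ofReal (Real.exp (h z)) ∂(μ ⊗ₘ P) < ∞) :
    ∀ᵐ x ∂μ, Integrable (fun y => Real.exp (h (x, y))) (P x) := by
  filter_upwards [ae_lintegral_slice_lt_top (measurable_ofReal_exp hm) hfin] with x hx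
  exact (integrable_exp_iff (hm.comp measurable_prodMk_left)).2 hx

theorem AllExp.ae_slice {μ : Measure X} [SFinite μ] {P : Kernel X X} [IsSFiniteKernel P]
    {f : X × X → ℝ} (hm : Measurable f) (hf : AllExp (μ ⊗ₘ P) f) :
    ∀ᵐ x ∂μ, AllExp (P x) (fun y => f (x, y)) := by
  have h : ∀ᵐ x ∂μ, ∀ n : ℕ,
      ∫⁻ y, ENNReal.ofReal (Real.exp ((n : ℝ) * |f (x, y)|)) ∂(P x) < ∞ :=
    ae_all_iff.2 fun n => ae_lintegral_slice_lt_top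
      (measurable_ofReal_exp ((continuous_abs.measurable.comp hm).const_mul _)) (hf n)
  filter_upwards [h] with x hx s
  obtain ⟨n, hn⟩ := exists_nat_ge s
  refine (lintegral_mono fun y => ENNReal.ofReal_le_ofReal (Real.exp_le_exp.2 ?_)).trans_lt (hx n)
  exact mul_le_mul_of_nonneg_right hn (abs_nonneg _)

theorem AllExp.nextState {μ : Measure X} [SFinite μ] {P : Kernel X X} [IsSFiniteKernel P]
    (h : Kernel.Invariant P μ) {f : X → ℝ} (hm : Measurable f) (hf : AllExp μ f) :
    AllExp (μ ⊗ₘ P) (nextState f) :=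
  AllExp.comp measurable_snd hm (by rwa [map_snd_compProd h])

theorem AllExp.currentState {μ : Measure X} [SFinite μ] {P : Kernel X X} [IsMarkovKernel P]
    {f : X → ℝ} (hm : Measurable f) (hf : AllExp μ f) :
    AllExp (μ ⊗ₘ P) (fun z => f z.1) :=
  AllExp.comp (T := Prod.fst) measurable_fst hm (by rwa [map_fst_compProd])

/-- The symmetrized cumulant `κ_f + κ_{-f}` is `o(‖f‖)` if `κ` is differentiable. -/
theorem FrechetDiffAtZero.symm_small {μ : Measure X} [IsProbabilityMeasure μ] {P : Kernel X X}
    [IsMarkovKernel P] (hκ : FrechetDiffAtZero 1 (μ ⊗ₘ P) μ (kappa P)) {ε : ℝ} (hε : 0 < ε) :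
    ∃ δ : ℝ, 0 < δ ∧ ∀ f, Measurable f → lux 2 (μ ⊗ₘ P) f ≤ ENNReal.ofReal δ →
      lux 2 μ (fun x => kappa P f x + kappa P (-f) x) ≤
        ENNReal.ofReal ε * lux 2 (μ ⊗ₘ P) f := by
  obtain ⟨A, hA, hd⟩ := hκ
  obtain ⟨δ, hδ, h⟩ := hd (ε / 2) (by positivity)
  refine ⟨δ, hδ, fun f hf hle => ?_⟩
  have hfm : MemL 1 (μ ⊗ₘ P) f := memL_one_iff.2 ⟨hf, hle.trans_lt ENNReal.ofReal_lt_top⟩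
  have hfm' : MemL 1 (μ ⊗ₘ P) (-f) := memL_one_iff.2
    ⟨hf.neg, by rw [lux_neg]; exact hle.trans_lt ENNReal.ofReal_lt_top⟩
  have h1 := h f hfm (by rwa [orliczNorm_one_eq_lux])
  have h2 := h (-f) hfm' (by rwa [orliczNorm_one_eq_lux, lux_neg])
  simp only [orliczNorm_one_eq_lux, lux_neg] at h1 h2
  have hk0 : kappa P 0 = 0 := by ext x; simp [kappa, condE]
  have hneg := hA.map_smul (-1) f hfm
  -- The derivative is odd, so its values at f and -f cancel and only the two remainders are left.
  have hsum : (fun x => kappa P f x + kappa P (-f) x) =ᵐ[μ]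
      (kappa P f - kappa P 0 - A f) + (kappa P (-f) - kappa P 0 - A (-f)) := by
    filter_upwards [hneg] with x hx
    have e : (-1 : ℝ) • f = -f := by simp
    rw [e] at hx
    simp only [Pi.add_apply, Pi.sub_apply, hk0, Pi.zero_apply, hx, Pi.smul_apply, smul_eq_mul]
    ring
  rw [lux_congr_ae hsum]
  have hmeas : Measurable (kappa P f - kappa P 0 - A f) :=
    ((measurable_kappa P hf).sub (by rw [hk0]; exact measurable_zero)).sub (hA.map_mem f hfm).1
  refine (lux_add_le hmeas).trans ((add_le_add h1 h2).trans (le_of_eq ?_))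
  rw [← add_mul, ← ENNReal.ofReal_add (by positivity) (by positivity), add_halves]

/-- Where b > K one has e^{|b|/c} ≤ e^{-K/c} e^{2|b|/c}. With K = cI, I being the moment of order
2/c, the tail contributes at most e^{-I} I ≤ 1 and the rest at most 1. -/
theorem AllExp.tail_small {μ : Measure X} [IsProbabilityMeasure μ] {b : X → ℝ}
    (hm : Measurable b) (hb : AllExp μ b) {c : ℝ} (hc : 0 < c) :
    ∃ K : ℝ, 0 ≤ K ∧ lux 2 μ (fun x => if b x ≤ K then 0 else b x) ≤ ENNReal.ofReal c := by
  have hI := hb (2 / c)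
  set I := ∫⁻ x, ENNReal.ofReal (Real.exp (2 / c * |b x|)) ∂μ with hId
  refine ⟨c * I.toReal, by positivity, lux_le hc ?_⟩
  set K := c * I.toReal with hK
  calc expI μ c (fun x => if b x ≤ K then 0 else b x)
      ≤ ∫⁻ x, (1 + ENNReal.ofReal (Real.exp (-(K / c))) *
          ENNReal.ofReal (Real.exp (2 / c * |b x|))) ∂μ := by
        refine lintegral_mono fun x => ?_
        rw [← ENNReal.ofReal_mul (Real.exp_nonneg _), ← Real.exp_add, ← ENNReal.ofReal_one,
          ← ENNReal.ofReal_add zero_le_one (Real.exp_nonneg _)]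
        refine ENNReal.ofReal_le_ofReal ?_
        have hpos := Real.exp_pos (-(K / c) + 2 / c * |b x|)
        beta_reduce
        split_ifs with h
        · simp only [abs_zero, zero_div, Real.exp_zero]; linarith
        · have h1 : |b x| / c ≤ -(K / c) + 2 / c * |b x| := by
            have : K / c ≤ |b x| / c := by
              gcongr
              exact (not_le.1 h).le.trans (le_abs_self _)
            have e : 2 / c * |b x| = |b x| / c + |b x| / c := by ring
            linarith
          linarith [Real.exp_le_exp.2 h1]
    _ = 1 + ENNReal.ofReal (Real.exp (-(K / c))) * I := by
        have hmeas : Measurable fun x => ENNReal.ofReal (Real.exp (2 / c * |b x|)) :=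
          measurable_ofReal_exp ((continuous_abs.measurable.comp hm).const_mul _)
        rw [lintegral_add_left measurable_const, lintegral_const_mul _ hmeas]
        simp [← hId]
    _ ≤ ENNReal.ofReal 1 + ENNReal.ofReal 1 := by
        rw [ENNReal.ofReal_one]
        gcongr
        rw [← ENNReal.ofReal_toReal hI.ne, ← ENNReal.ofReal_mul (Real.exp_nonneg _),
          ENNReal.ofReal_le_one, hK, mul_div_cancel_left₀ _ hc.ne', Real.exp_neg,
          inv_mul_le_one₀ (Real.exp_pos _)]
        linarith [Real.add_one_le_exp I.toReal]
    _ = ENNReal.ofReal 2 := by rw [← ENNReal.ofReal_add zero_le_one zero_le_one]; norm_num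

end Slices

/-! ### Differentiability of the tilted cumulant in Luxemburg norm -/

section Tilted

variable {X : Type*} [MeasurableSpace X] {μ : Measure X} [IsProbabilityMeasure μ]
  {P : Kernel X X} [IsMarkovKernel P]

/-- Conditional Jensen: e^{N b(x)} is at most the conditional mean of e^{2N g}. The power must be at
least 1, hence N = max s 1. -/
theorem allExp_logInt_two_mul {g : X × X → ℝ} (hgm : Measurable g) (hg : AllExp (μ ⊗ₘ P) g)
    (hb0 : ∀ᵐ x ∂μ, 0 ≤ logInt (P x) (fun y => 2 * g (x, y))) :
    AllExp μ (fun x => logInt (P x) (fun y => 2 * g (x, y))) := by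
  intro s
  set N := max s 1 with hN
  have h2g : AllExp (μ ⊗ₘ P) (fun z => 2 * g z) := hg.const_mul 2
  have h2gm : Measurable fun z => 2 * g z := hgm.const_mul 2
  have hfin : ∫⁻ z, ENNReal.ofReal (Real.exp (N * (2 * g z))) ∂(μ ⊗ₘ P) < ∞ :=
    (integrable_exp_iff (h2gm.const_mul N)).1
      ((h2g.const_mul N).integrable_exp (h2gm.const_mul N))
  rw [Measure.lintegral_compProd (measurable_ofReal_exp (h2gm.const_mul N))] at hfin
  refine lt_of_le_of_lt (lintegral_mono_ae ?_) hfin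
  filter_upwards [hb0, h2g.ae_slice h2gm] with x hx0 hx
  have hi := hx.integrable_exp (h2gm.comp measurable_prodMk_left)
  have := ofReal_exp_mul_le (π := P x) (f := fun y => 2 * g (x, y))
    (a := logInt (P x) (fun y => 2 * g (x, y))) (s := N) (h2gm.comp measurable_prodMk_left)
    (le_max_right _ _)
    (by
      rw [exp_logInt hi, ofReal_integral_eq_lintegral_ofReal hi
        (Eventually.of_forall fun y => Real.exp_nonneg _)])
  refine le_trans (ENNReal.ofReal_le_ofReal (Real.exp_le_exp.2 ?_)) this
  rw [abs_of_nonneg hx0]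
  exact mul_le_mul_of_nonneg_right (le_max_left _ _) hx0

/-- The cumulant generating function under the tilted conditional law with density `exp g` is
differentiable at `0`, uniformly in Luxemburg norm, if it is so without the tilting. -/
theorem tilted_remainder_small (hκ : FrechetDiffAtZero 1 (μ ⊗ₘ P) μ (kappa P)) {g : X × X → ℝ}
    (hgm : Measurable g) (hg : AllExp (μ ⊗ₘ P) g)
    (hg1 : ∀ᵐ x ∂μ, ∫ y, Real.exp (g (x, y)) ∂(P x) = 1) {ε : ℝ} (hε : 0 < ε) :
    ∃ δ : ℝ, 0 < δ ∧ ∀ η : X × X → ℝ, Measurable η → ∀ t : ℝ, 0 < t → t ≤ δ →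
      lux 2 (μ ⊗ₘ P) η < ENNReal.ofReal t →
      lux 2 μ (fun x => logInt (P x) (fun y => g (x, y) + η (x, y)) -
        ∫ y, Real.exp (g (x, y)) * η (x, y) ∂(P x)) ≤ ENNReal.ofReal (ε * t) := by
  have hslice := hg.ae_slice hgm
  have hb0 : ∀ᵐ x ∂μ, 0 ≤ logInt (P x) (fun y => 2 * g (x, y)) := by
    filter_upwards [hslice, hg1] with x hx hx1
    exact logInt_two_mul_nonneg (hgm.comp measurable_prodMk_left) hx hx1
  have hbm : Measurable fun x => logInt (P x) (fun y => 2 * g (x, y)) :=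
    measurable_logInt P (hgm.const_mul 2)
  have hbE := allExp_logInt_two_mul hgm hg hb0
  obtain ⟨δκ, hδκ, hsymm⟩ := hκ.symm_small (ε := ε / 9) (by positivity)
  -- The fixed size of f = η/s, with s = t/τ: it keeps 2f within reach of `hsymm`, and τ ≤ 1/2 makes
  -- e^{2|f|} integrable.
  set τ := min (δκ / 2) (1 / 2) with hτ
  have hτ0 : 0 < τ := by positivity
  have hτ1 : τ ≤ δκ / 2 := min_le_left _ _
  have hτ2 : τ ≤ 1 / 2 := min_le_right _ _
  obtain ⟨K, hK0, hK⟩ := hbE.tail_small hbm (c := τ * ε * (2 / 9)) (by positivity)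
  set E := Real.exp (3 / 2 * K) with hE
  have hE0 : 0 < E := Real.exp_pos _
  -- The first bound gives s ≤ 1/2. The second gives 32s²E ≤ εt/3, so the constant term has norm at
  -- most εt/3; ε/9 and τε(2/9) were chosen to give the same share to the other two terms.
  refine ⟨min (τ / 2) (ε * τ ^ 2 / (96 * E)), by positivity, fun η hη t ht0 htδ hlt => ?_⟩
  have ht1 : t ≤ τ / 2 := htδ.trans (min_le_left _ _)
  have ht2 : t ≤ ε * τ ^ 2 / (96 * E) := htδ.trans (min_le_right _ _)
  set s := t / τ with hs
  have hs0 : 0 < s := by positivity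
  have hs1 : s ≤ 1 / 2 := by rw [hs, div_le_iff₀ hτ0]; linarith
  have hst : s * τ = t := by rw [hs]; field_simp
  set f : X × X → ℝ := s⁻¹ • η with hf
  have hfm : Measurable f := hη.const_smul _
  have hsf : ∀ z, s * f z = η z := fun z => by
    rw [hf, Pi.smul_apply, smul_eq_mul, mul_inv_cancel_left₀ hs0.ne']
  obtain ⟨-, hexp⟩ := expI_le_of_lux_lt hlt
  have hexpf : ∫⁻ z, ENNReal.ofReal (Real.exp (2 * |f z|)) ∂(μ ⊗ₘ P) < ∞ := by
    refine lt_of_le_of_lt ?_ (hexp.trans_lt ENNReal.ofReal_lt_top)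
    refine lintegral_mono fun z => ENNReal.ofReal_le_ofReal (Real.exp_le_exp.2 ?_)
    rw [← hsf z, abs_mul, abs_of_pos hs0, ← hst, mul_div_mul_left _ _ hs0.ne',
      le_div_iff₀ hτ0]
    nlinarith [abs_nonneg (f z)]
  have hint : ∀ᵐ x ∂μ, Integrable (fun y => Real.exp (2 * |f (x, y)|)) (P x) :=
    ae_integrable_exp_slice ((continuous_abs.measurable.comp hfm).const_mul 2) hexpf
  have h2f : Measurable ((2 : ℝ) • f) := hfm.const_smul 2
  have hlux2f : lux 2 (μ ⊗ₘ P) ((2 : ℝ) • f) ≤ ENNReal.ofReal (2 * τ) := by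
    rw [hf, smul_smul]
    refine (lux_smul_le 2 _ (by positivity) η).trans ((mul_le_mul_right hlt.le _).trans ?_)
    rw [← ENNReal.ofReal_mul (by positivity)]
    refine ENNReal.ofReal_le_ofReal (le_of_eq ?_)
    rw [← hst]; field_simp
  have hσ := hsymm _ h2f (hlux2f.trans (ENNReal.ofReal_le_ofReal (by linarith)))
  have hσ' := hσ.trans (mul_le_mul_right hlux2f _)
  rw [← ENNReal.ofReal_mul (by positivity)] at hσ'
  set σ : X → ℝ := fun x => kappa P ((2 : ℝ) • f) x + kappa P (-((2 : ℝ) • f)) x with hσd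
  have hσm : Measurable σ := (measurable_kappa P h2f).add (measurable_kappa P h2f.neg)
  set T : X → ℝ := fun x => if logInt (P x) (fun y => 2 * g (x, y)) ≤ K then 0
    else logInt (P x) (fun y => 2 * g (x, y)) with hT
  have hbound : ∀ᵐ x ∂μ, |logInt (P x) (fun y => g (x, y) + η (x, y)) -
        ∫ y, Real.exp (g (x, y)) * η (x, y) ∂(P x)| ≤
      |3 / 2 * s * σ x + (16 * s ^ 2 * E + 3 / 2 * s * T x)| := by
    filter_upwards [hint, hslice, hg1] with x hx1 hx2 hx3
    have hr := abs_remainder_le (hgm.comp measurable_prodMk_left)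
      (hfm.comp measurable_prodMk_left) hx2 hx3 hx1 K hs0.le hs1
      (η := fun y => η (x, y)) (fun y => hsf (x, y))
    refine le_trans hr (le_trans (le_of_eq ?_) (le_abs_self _))
    simp only [hT, hσd, kappa_eq_logInt, Pi.neg_apply, Pi.smul_apply, smul_eq_mul, hE,
      Function.comp]
    ring
  have hsplit : (fun x => 3 / 2 * s * σ x + (16 * s ^ 2 * E + 3 / 2 * s * T x)) =
      (3 / 2 * s) • σ + ((fun _ => 16 * s ^ 2 * E) + (3 / 2 * s) • T) := rfl
  refine (lux_mono_ae hbound).trans ?_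
  rw [hsplit]
  refine (lux_add_le (hσm.const_smul _)).trans ?_
  have hp1 : lux 2 μ ((3 / 2 * s) • σ) ≤ ENNReal.ofReal (ε * t / 3) := by
    refine (lux_smul_le 2 μ (by positivity) σ).trans ((mul_le_mul_right hσ' _).trans ?_)
    rw [← ENNReal.ofReal_mul (by positivity)]
    refine ENNReal.ofReal_le_ofReal (le_of_eq ?_)
    rw [← hst]; ring
  have hp2 : lux 2 μ (fun _ : X => 16 * s ^ 2 * E) ≤ ENNReal.ofReal (ε * t / 3) := by
    refine lux_const_le μ (by positivity) (by positivity) ?_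
    rw [le_div_iff₀ (by positivity)] at ht2
    have : s ^ 2 * τ ^ 2 = t ^ 2 := by rw [← hst]; ring
    have h3 : 32 * s ^ 2 * E * τ ^ 2 ≤ ε * t / 3 * τ ^ 2 := by
      have e : 32 * s ^ 2 * E * τ ^ 2 = 32 * E * t ^ 2 := by rw [← this]; ring
      rw [e]
      nlinarith
    have := le_of_mul_le_mul_right h3 (by positivity)
    linarith
  have hp3 : lux 2 μ ((3 / 2 * s) • T) ≤ ENNReal.ofReal (ε * t / 3) := by
    refine (lux_smul_le 2 μ (by positivity) T).trans ((mul_le_mul_right hK _).trans ?_)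
    rw [← ENNReal.ofReal_mul (by positivity)]
    refine ENNReal.ofReal_le_ofReal (le_of_eq ?_)
    rw [← hst]; ring
  calc _ ≤ ENNReal.ofReal (ε * t / 3) +
        (ENNReal.ofReal (ε * t / 3) + ENNReal.ofReal (ε * t / 3)) := by
        gcongr
        exact (lux_add_le measurable_const).trans (add_le_add hp2 hp3)
    _ = ENNReal.ofReal (ε * t) := by
        rw [← ENNReal.ofReal_add (by positivity) (by positivity),
          ← ENNReal.ofReal_add (by positivity) (by positivity)]
        congr 1; ring

end Tilted

end RobustValue

namespace RobustValue

/-! ### The two fixed-point equations at a single state -/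

section Pointwise

variable {Ω : Type*} [MeasurableSpace Ω]

/-- The cumulants of a centred log likelihood ratio. -/
theorem logInt_score {π : Measure Ω} [IsProbabilityMeasure π] {l : Ω → ℝ} (hm : Measurable l)
    (hl1 : ∫ y, Real.exp (l y) ∂π = 1)
    (hl2 : Integrable (fun y => Real.exp |l y|) π) {η : Ω → ℝ}
    (hη : ∀ y, η y = l y - ∫ z, l z ∂π) :
    logInt π η = -∫ z, l z ∂π ∧ 0 ≤ logInt π η ∧ 0 ≤ logInt π (fun y => -η y) := by
  set k := ∫ z, l z ∂π with hk
  have hint : Integrable l π := by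
    refine hl2.mono' hm.aestronglyMeasurable (Eventually.of_forall fun y => ?_)
    rw [Real.norm_eq_abs]
    linarith [Real.add_one_le_exp |l y|]
  have hlp : Integrable (fun y => Real.exp (l y)) π :=
    integrable_exp_of_le hm hl2 fun y => le_abs_self _
  have hlm : Integrable (fun y => Real.exp (-l y)) π :=
    integrable_exp_of_le hm.neg hl2 fun y => neg_le_abs _
  have hηl : η = fun y => l y + -k := funext fun y => by rw [hη, sub_eq_add_neg]
  have hηp : Integrable (fun y => Real.exp (η y)) π := by
    rw [hηl]; simp_rw [Real.exp_add]; exact hlp.mul_const _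
  have hηn : Integrable (fun y => Real.exp (-η y)) π := by
    rw [hηl]; simp_rw [neg_add, Real.exp_add]; exact hlm.mul_const _
  have hηi : Integrable η π := by rw [hηl]; exact hint.add (integrable_const _)
  have hη0 : ∫ y, η y ∂π = 0 := by
    rw [hηl, integral_add hint (integrable_const _)]
    simp [hk]
  have hsymm := logInt_nonneg_symm hηp hηn hηi
  rw [hη0, neg_zero] at hsymm
  refine ⟨?_, hsymm⟩
  rw [hηl, logInt_add_const hlp]
  simp [logInt, hl1]

/-- The data of two fixed-point equations at a given state: `a = log ∫ exp V` under the reference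
law `π`, and `a' = log ∫ exp V'` under the alternative law with log likelihood ratio `l`. -/
structure FixedPair (π : Measure Ω) (V V' l : Ω → ℝ) (a a' : ℝ) : Prop where
  measurable_V : Measurable V
  measurable_V' : Measurable V'
  measurable_l : Measurable l
  allExp_V : AllExp π V
  allExp_V' : AllExp π V'
  moment : ∃ p : ℝ, 1 < p ∧ Integrable (fun y => Real.exp (p * l y)) π
  abs_moment : ∃ c : ℝ, 0 < c ∧ Integrable (fun y => Real.exp (c * |l y|)) π
  integral_V : ∫ y, Real.exp (V y) ∂π = Real.exp a
  integral_V' : ∫ y, Real.exp (V' y + l y) ∂π = Real.exp a'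

namespace FixedPair

variable {π : Measure Ω} {V V' l : Ω → ℝ} {a a' : ℝ}

theorem allExp_diff (h : FixedPair π V V' l a a') : AllExp π (fun y => V' y - V y) := by
  simpa [sub_eq_add_neg, Pi.add_def] using h.allExp_V'.add h.allExp_V.neg h.measurable_V'

theorem measurable_diff (h : FixedPair π V V' l a a') : Measurable (fun y => V' y - V y) :=
  h.measurable_V'.sub h.measurable_V

theorem logInt_V (h : FixedPair π V V' l a a') : logInt π V = a := by
  rw [logInt, h.integral_V, Real.log_exp]

theorem logInt_V' (h : FixedPair π V V' l a a') : logInt π (fun y => V' y + l y) = a' := by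
  rw [logInt, h.integral_V', Real.log_exp]

theorem integrable_V (h : FixedPair π V V' l a a') : Integrable (fun y => Real.exp (V y)) π :=
  h.allExp_V.integrable_exp h.measurable_V

theorem integrable_V_add (h : FixedPair π V V' l a a') :
    Integrable (fun y => Real.exp (V y + l y)) π :=
  let ⟨_, hp, hl⟩ := h.moment
  h.allExp_V.integrable_exp_add h.measurable_V h.measurable_l hp hl

theorem integrable_V'_add (h : FixedPair π V V' l a a') :
    Integrable (fun y => Real.exp (V' y + l y)) π :=
  let ⟨_, hp, hl⟩ := h.moment
  h.allExp_V'.integrable_exp_add h.measurable_V' h.measurable_l hp hl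

theorem integrable_V_mul_l (h : FixedPair π V V' l a a') :
    Integrable (fun y => Real.exp (V y) * l y) π :=
  let ⟨_, hc, hl⟩ := h.abs_moment
  h.allExp_V.integrable_exp_mul h.measurable_V h.measurable_l hc hl

theorem integrable_V_mul_diff (h : FixedPair π V V' l a a') :
    Integrable (fun y => Real.exp (V y) * (V' y - V y)) π :=
  h.allExp_V.integrable_exp_mul h.measurable_V h.measurable_diff one_pos
    (h.allExp_diff.integrable h.measurable_diff 1)

variable [IsProbabilityMeasure π]

/-- Gibbs inequality with the tilt taken at V' + l, the alternative model; `sub_ge` takes it at V,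
the reference model. -/
theorem sub_le (h : FixedPair π V V' l a a') {F : Ω → ℝ} (hF0 : ∀ y, 0 ≤ F y)
    (hF : ∀ y, V' y + l y - V y ≤ F y) :
    ENNReal.ofReal (a' - a) ≤ ∫⁻ y, ENNReal.ofReal (Real.exp (V' y + l y - a') * F y) ∂π := by
  obtain ⟨p, hp, hl⟩ := h.moment
  have hi : Integrable (fun y => Real.exp (V' y + l y) * (V' y + l y - V y)) π := by
    refine ((h.allExp_V'.integrable_exp_add_mul_left h.measurable_V' h.allExp_diff
      h.measurable_diff h.measurable_l hp hl).add
      (h.allExp_V'.integrable_exp_add_mul_right h.measurable_V' h.measurable_l hp hl)).congr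
      (Eventually.of_forall fun y => ?_)
    simp only [Pi.add_apply]
    ring
  have hgibbs := logInt_sub_le_tilt h.integrable_V h.integrable_V'_add hi
  rw [h.logInt_V, h.logInt_V'] at hgibbs
  exact (ENNReal.ofReal_le_ofReal hgibbs).trans (ofReal_tilt_le h.integral_V' hi hF hF0)

theorem sub_ge (h : FixedPair π V V' l a a') {F : Ω → ℝ} (hF0 : ∀ y, 0 ≤ F y)
    (hF : ∀ y, V y - (V' y + l y) ≤ F y) :
    ENNReal.ofReal (a - a') ≤ ∫⁻ y, ENNReal.ofReal (Real.exp (V y - a) * F y) ∂π := by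
  have hi : Integrable (fun y => Real.exp (V y) * (V y - (V' y + l y))) π := by
    refine (h.integrable_V_mul_diff.add h.integrable_V_mul_l).neg.congr
      (Eventually.of_forall fun y => ?_)
    simp only [Pi.add_apply, Pi.neg_apply]
    ring
  have hgibbs := logInt_sub_le_tilt h.integrable_V'_add h.integrable_V hi
  rw [h.logInt_V, h.logInt_V'] at hgibbs
  exact (ENNReal.ofReal_le_ofReal hgibbs).trans (ofReal_tilt_le h.integral_V hi hF hF0)

/-- The linearization error is controlled by the variation of the tilted expectations of `V' - V`,
the second-order remainder of the tilted cumulant of the score `η`, and its symmetrized cumulant. -/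
theorem abs_linearization_le (h : FixedPair π V V' l a a') (hl1 : ∫ y, Real.exp (l y) ∂π = 1)
    (hl2 : Integrable (fun y => Real.exp |l y|) π) {η : Ω → ℝ}
    (hη : ∀ y, η y = l y - ∫ z, l z ∂π) :
    |a' - a - tilt π V (fun y => V' y - V y) - tilt π V η| ≤
      |tilt π (fun y => η y + V y) (fun y => V' y - V y) - tilt π V (fun y => V' y - V y)| +
      |tilt π (fun y => η y + V' y) (fun y => V' y - V y) - tilt π V (fun y => V' y - V y)| +
      |logInt π (fun y => (V y - a) + η y) - ∫ y, Real.exp (V y - a) * η y ∂π| +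
      |logInt π η + logInt π (fun y => -η y)| := by
  obtain ⟨p, hp, hl⟩ := h.moment
  set k := ∫ z, l z ∂π with hk
  obtain ⟨hkη, hsymm⟩ := logInt_score h.measurable_l hl1 hl2 hη
  rw [← hk] at hkη
  -- On one slice η and l differ by the constant k, which tilts ignore and which log-integrals
  -- merely add.
  have e1 : (fun y => η y + V y) = fun y => (V y + l y) + -k := by
    ext y; rw [hη]; ring
  have e2 : (fun y => η y + V' y) = fun y => (V' y + l y) + -k := by
    ext y; rw [hη]; ring
  have e3 : (fun y => (V y - a) + η y) = fun y => (V y + l y) + (-k - a) := by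
    ext y; rw [hη]; ring
  -- Two Gibbs inequalities enclose the increment of the log-integral from V + l to V' + l between
  -- expectations of V' - V under the two tilts.
  have hdlo : tilt π (fun y => V y + l y) (fun y => V' y - V y) ≤
      a' - logInt π (fun y => V y + l y) := by
    have hi := h.allExp_V.integrable_exp_add_mul_left h.measurable_V h.allExp_diff
      h.measurable_diff h.measurable_l hp hl
    have := tilt_le_logInt_sub h.integrable_V_add h.integrable_V'_add
      (by simpa only [add_sub_add_right_eq_sub] using hi)
    rw [h.logInt_V'] at this
    simpa only [add_sub_add_right_eq_sub] using this
  have hdhi : a' - logInt π (fun y => V y + l y) ≤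
      tilt π (fun y => V' y + l y) (fun y => V' y - V y) := by
    have hi := h.allExp_V'.integrable_exp_add_mul_left h.measurable_V' h.allExp_diff
      h.measurable_diff h.measurable_l hp hl
    have := logInt_sub_le_tilt h.integrable_V_add h.integrable_V'_add
      (by simpa only [add_sub_add_right_eq_sub] using hi)
    rw [h.logInt_V'] at this
    simpa only [add_sub_add_right_eq_sub] using this
  have e4 : ∫ y, Real.exp (V y - a) * η y ∂π = tilt π V η := by
    rw [tilt, h.integral_V]
    simp_rw [Real.exp_sub]
  rw [e1, e2, e3, tilt_add_const, tilt_add_const, logInt_add_const h.integrable_V_add, e4, hkη]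
  rw [hkη] at hsymm
  set E0 := tilt π V (fun y => V' y - V y)
  set E1 := tilt π (fun y => V y + l y) (fun y => V' y - V y)
  set E2 := tilt π (fun y => V' y + l y) (fun y => V' y - V y)
  set a1 := logInt π (fun y => V y + l y)
  set T := tilt π V η
  set N := logInt π (fun y => -η y)
  have hb1 := neg_abs_le (E1 - E0)
  have hb2 := le_abs_self (E2 - E0)
  have hb3 := abs_nonneg (E1 - E0)
  have hb4 := abs_nonneg (E2 - E0)
  have hb5 := le_abs_self (a1 + (-k - a) - T)
  have hb6 := neg_abs_le (a1 + (-k - a) - T)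
  have hb7 := le_abs_self (-k + N)
  have hb8 := abs_nonneg (-k + N)
  have hb9 := hsymm.1
  have hb10 := hsymm.2
  rw [abs_le]
  constructor <;> linarith

end FixedPair

end Pointwise

/-! ### Subsolutions of the distorted equation -/

section Contraction

variable {X : Type*} [MeasurableSpace X] {μ : Measure X} [IsProbabilityMeasure μ]
  {P : Kernel X X} [IsMarkovKernel P]

/-- A nonnegative `D` with `D ≤ β E_m[D + |L|]`, where `m` is the density attached to a fixed point,
is bounded by `L` in Luxemburg norm, with a constant depending only on exponential moments of the
flow term. -/
theorem lux_le_of_subsolution (hP : Kernel.Invariant P μ) {β R : ℝ} (hβ0 : 0 < β) (hβ1 : β < 1)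
    (hR : 2 ≤ R) {v : X → ℝ} (hv : Measurable v) {w : X × X → ℝ} (hw : Measurable w)
    (hfix : ∀ᵐ x ∂μ, ENNReal.ofReal (Real.exp (v x / β)) =
      ∫⁻ y, ENNReal.ofReal (Real.exp (v y + w (x, y))) ∂(P x))
    (hfin : AllExp μ v)
    (hJ : ∫⁻ z, ENNReal.ofReal (Real.exp (3 * (2 / (1 - β)) / (1 - β) * |w z|)) ∂(μ ⊗ₘ P) ≤
      ENNReal.ofReal R)
    {D : X → ℝ} (hD : Measurable D) (hD0 : ∀ x, 0 ≤ D x) (hDfin : lux 2 μ D < ∞)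
    {L : X × X → ℝ} (hL : Measurable L)
    (hle : ∀ᵐ x ∂μ, ENNReal.ofReal (D x) ≤ ENNReal.ofReal β *
      ∫⁻ y, ENNReal.ofReal (dens β v w (x, y) * (D y + |L (x, y)|)) ∂(P x)) :
    lux 2 μ D ≤ ENNReal.ofReal (R * (contr β / (1 - contr β))) * lux 2 (μ ⊗ₘ P) L := by
  have hq : 1 ≤ 2 / (1 - β) := by rw [le_div_iff₀ (by linarith)]; linarith
  have habs : Measurable fun z => |L z| := continuous_abs.measurable.comp hL
  have hF : Measurable (nextState D + fun z => |L z|) := (measurable_nextState hD).add habs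
  have h1 := lux_contract (R := R) hβ0 hβ1 (by linarith) (measurable_dens (β := β) hv hw)
    (fun z => (dens_pos β v w z).le) (hfix.mono fun x hx => lintegral_dens_eq_one hx)
    ((lintegral_dens_rpow_le hP hβ0 hβ1 hv hw hfix hfin hq).trans hJ) hF (G := D)
    (hle.mono fun x hx => by
      rw [abs_of_nonneg (hD0 x)]
      refine hx.trans (le_of_eq ?_)
      congr 1
      refine lintegral_congr fun y => ?_
      have : 0 ≤ D y + |L (x, y)| := add_nonneg (hD0 y) (abs_nonneg _)
      simp only [Pi.add_apply, nextState, abs_of_nonneg this])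
  have h2 : lux R (μ ⊗ₘ P) (nextState D + fun z => |L z|) ≤ lux R μ D + lux R (μ ⊗ₘ P) L := by
    refine (lux_add_le (measurable_nextState hD)).trans ?_
    rw [lux_nextState hP hD]
    gcongr
    exact lux_mono_ae (Eventually.of_forall fun z => by rw [abs_abs])
  -- Finiteness is what permits absorbing the norm of D from the right side.
  have h3 : lux R μ D ≠ ∞ := ((lux_antitone_threshold hR μ D).trans_lt hDfin).ne
  have h4 := le_of_le_contract (contr_pos hβ0) (contr_lt_one hβ0 hβ1) h3
    (h1.trans (mul_le_mul_right h2 _))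
  have hc : 0 ≤ contr β / (1 - contr β) :=
    div_nonneg (contr_pos hβ0).le (by linarith [contr_lt_one hβ0 hβ1])
  refine (lux_two_le (K := R) (by linarith) le_rfl hD).trans ?_
  rw [ENNReal.ofReal_mul (by linarith), mul_assoc]
  gcongr
  exact h4.trans (mul_le_mul_right (lux_antitone_threshold hR _ L) _)

end Contraction

/-- The inverse change of measure. -/
theorem lintegral_rnDeriv_inv_rpow {X : Type*} [MeasurableSpace X] {μ ν : Measure X}
    [IsProbabilityMeasure μ] [IsProbabilityMeasure ν] (hν : ν ≪ μ) (hμ : μ ≪ ν) (p : ℝ) :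
    ∫⁻ x, μ.rnDeriv ν x ^ p ∂ν = ∫⁻ x, ν.rnDeriv μ x ^ (1 - p) ∂μ := by
  have h1 : ∫⁻ x, μ.rnDeriv ν x ^ p ∂ν = ∫⁻ x, (ν.rnDeriv μ x)⁻¹ ^ p ∂ν := by
    refine lintegral_congr_ae ?_
    filter_upwards [Measure.inv_rnDeriv hν] with x hx
    rw [← hx, Pi.inv_apply]
  -- Integrating against μ instead of ν costs one factor dν/dμ, so the exponent -p becomes 1 - p.
  rw [h1, ← lintegral_rnDeriv_mul hν (f := fun x => (ν.rnDeriv μ x)⁻¹ ^ p)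
    ((Measure.measurable_rnDeriv ν μ).inv.pow_const p).aemeasurable]
  refine lintegral_congr_ae ?_
  filter_upwards [Measure.rnDeriv_pos' hμ, Measure.rnDeriv_lt_top ν μ] with x hpos htop
  rw [ENNReal.rpow_sub _ _ hpos.ne' htop.ne, ENNReal.rpow_one, ENNReal.inv_rpow, div_eq_mul_inv]

/-! ### Change of measure through the log likelihood ratio -/

section LogLik

variable {X : Type*} [MeasurableSpace X] [MeasurableSpace.CountablyGenerated X]
  {Q Q' : Kernel X X} [IsMarkovKernel Q] [IsMarkovKernel Q']

theorem measurable_logLik (Q Q' : Kernel X X) : Measurable (logLik Q Q') :=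
  Real.measurable_log.comp (Kernel.measurable_rnDeriv Q' Q).ennreal_toReal

/-- Mutual absolute continuity excludes the values 0 and ∞ of the derivative almost everywhere, so
exp really inverts the logarithm in `logLik`. -/
theorem lintegral_eq_exp_logLik (h : MutuallyAC Q Q') (x : X) {F : X → ℝ≥0∞}
    (hF : Measurable F) :
    ∫⁻ y, F y ∂(Q' x) = ∫⁻ y, ENNReal.ofReal (Real.exp (logLik Q Q' (x, y))) * F y ∂(Q x) := by
  rw [← lintegral_rnDeriv_mul (h x).2 hF.aemeasurable]
  refine lintegral_congr_ae ?_
  filter_upwards [Kernel.rnDeriv_eq_rnDeriv_measure (κ := Q') (η := Q) (a := x),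
    Measure.rnDeriv_pos' (h x).1, Measure.rnDeriv_lt_top (Q' x) (Q x)] with y hy hpos htop
  rw [logLik, hy, Real.exp_log (ENNReal.toReal_pos hpos.ne' htop.ne),
    ENNReal.ofReal_toReal htop.ne]

theorem lintegral_exp_eq_logLik (h : MutuallyAC Q Q') (x : X) {f : X → ℝ}
    (hf : Measurable f) :
    ∫⁻ y, ENNReal.ofReal (Real.exp (f y)) ∂(Q' x) =
      ∫⁻ y, ENNReal.ofReal (Real.exp (f y + logLik Q Q' (x, y))) ∂(Q x) := by
  rw [lintegral_eq_exp_logLik h x (measurable_ofReal_exp hf)]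
  refine lintegral_congr fun y => ?_
  rw [← ENNReal.ofReal_mul (Real.exp_nonneg _), ← Real.exp_add, add_comm]

theorem integral_exp_eq_logLik (h : MutuallyAC Q Q') (x : X) {f : X → ℝ}
    (hf : Measurable f) :
    ∫ y, Real.exp (f y) ∂(Q' x) = ∫ y, Real.exp (f y + logLik Q Q' (x, y)) ∂(Q x) := by
  have hl : Measurable fun y => logLik Q Q' (x, y) :=
    (measurable_logLik Q Q').comp measurable_prodMk_left
  have hm : Measurable fun y => Real.exp (f y + logLik Q Q' (x, y)) :=
    Real.measurable_exp.comp (hf.add hl)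
  rw [integral_eq_lintegral_of_nonneg_ae (Eventually.of_forall fun y => Real.exp_nonneg _)
      (Real.measurable_exp.comp hf).aestronglyMeasurable,
    integral_eq_lintegral_of_nonneg_ae (Eventually.of_forall fun y => Real.exp_nonneg _)
      hm.aestronglyMeasurable,
    lintegral_exp_eq_logLik h x hf]

theorem integral_exp_logLik (h : MutuallyAC Q Q') (x : X) :
    ∫ y, Real.exp (logLik Q Q' (x, y)) ∂(Q x) = 1 := by
  have := integral_exp_eq_logLik h x (f := fun _ => 0) measurable_const
  simpa using this.symm

variable {μ ν : Measure X} [IsProbabilityMeasure μ] [IsProbabilityMeasure ν]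

/-- Joint laws under the alternative model have density `Δ(x₀) exp(ℓ(x₀, x₁))`. -/
theorem lintegral_compProd_eq_logLik (h : MutuallyAC Q Q') (hν : ν ≪ μ) {F : X × X → ℝ≥0∞}
    (hF : Measurable F) :
    ∫⁻ z, F z ∂(ν ⊗ₘ Q') =
      ∫⁻ z, (ν.rnDeriv μ z.1 * ENNReal.ofReal (Real.exp (logLik Q Q' z))) * F z ∂(μ ⊗ₘ Q) := by
  have hl := measurable_ofReal_exp (measurable_logLik Q Q')
  have hΔ : Measurable fun z : X × X => ν.rnDeriv μ z.1 :=
    (Measure.measurable_rnDeriv ν μ).comp measurable_fst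
  have hm : Measurable fun z : X × X =>
      (ν.rnDeriv μ z.1 * ENNReal.ofReal (Real.exp (logLik Q Q' z))) * F z := (hΔ.mul hl).mul hF
  rw [Measure.lintegral_compProd hF, Measure.lintegral_compProd hm,
    ← lintegral_rnDeriv_mul hν hF.lintegral_kernel_prod_right'.aemeasurable]
  refine lintegral_congr fun x => ?_
  have hFx : Measurable fun y => F (x, y) := hF.comp measurable_prodMk_left
  have hlx : Measurable fun y => ENNReal.ofReal (Real.exp (logLik Q Q' (x, y))) :=
    hl.comp measurable_prodMk_left
  have hlF : Measurable fun y => ENNReal.ofReal (Real.exp (logLik Q Q' (x, y))) * F (x, y) :=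
    hlx.mul hFx
  rw [lintegral_eq_exp_logLik h x hFx, ← lintegral_const_mul _ hlF]
  simp only [mul_assoc]

theorem rnDeriv_compProd_eq_logLik (h : MutuallyAC Q Q') (hν : ν ≪ μ) :
    (ν ⊗ₘ Q').rnDeriv (μ ⊗ₘ Q) =ᵐ[μ ⊗ₘ Q]
      fun z => ν.rnDeriv μ z.1 * ENNReal.ofReal (Real.exp (logLik Q Q' z)) := by
  have hm : Measurable fun z : X × X =>
      ν.rnDeriv μ z.1 * ENNReal.ofReal (Real.exp (logLik Q Q' z)) :=
    ((Measure.measurable_rnDeriv ν μ).comp measurable_fst).mul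
      (measurable_ofReal_exp (measurable_logLik Q Q'))
  have : ν ⊗ₘ Q' = (μ ⊗ₘ Q).withDensity
      fun z => ν.rnDeriv μ z.1 * ENNReal.ofReal (Real.exp (logLik Q Q' z)) := by
    refine Measure.ext_of_lintegral _ fun F hF => ?_
    rw [lintegral_compProd_eq_logLik h hν hF, lintegral_withDensity_eq_lintegral_mul _ hm hF]
    rfl
  rw [this]
  exact Measure.rnDeriv_withDensity _ hm

/-- If the joint density has a moment of order `p`, then so has the conditional one. -/
theorem ae_integrable_exp_mul_logLik (h : MutuallyAC Q Q') (hν : ν ≪ μ) (hμ : μ ≪ ν) {p : ℝ}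
    (hp : 0 < p)
    (hfin : ∫⁻ z, (ν ⊗ₘ Q').rnDeriv (μ ⊗ₘ Q) z ^ p ∂(μ ⊗ₘ Q) < ∞) :
    ∀ᵐ x ∂μ, Integrable (fun y => Real.exp (p * logLik Q Q' (x, y))) (Q x) := by
  have hΔ : Measurable fun z : X × X => ν.rnDeriv μ z.1 :=
    (Measure.measurable_rnDeriv ν μ).comp measurable_fst
  have hl := measurable_ofReal_exp (measurable_logLik Q Q')
  have heq : ∫⁻ z, (ν ⊗ₘ Q').rnDeriv (μ ⊗ₘ Q) z ^ p ∂(μ ⊗ₘ Q) =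
      ∫⁻ z, (ν.rnDeriv μ z.1 * ENNReal.ofReal (Real.exp (logLik Q Q' z))) ^ p ∂(μ ⊗ₘ Q) :=
    lintegral_congr_ae ((rnDeriv_compProd_eq_logLik h hν).mono fun z hz => by
      simp only; rw [hz])
  rw [heq] at hfin
  filter_upwards [ae_lintegral_slice_lt_top ((hΔ.mul hl).pow_const p) hfin,
    Measure.rnDeriv_pos' hμ, Measure.rnDeriv_lt_top ν μ] with x hx hpos htop
  have hlx : Measurable fun y => logLik Q Q' (x, y) :=
    (measurable_logLik Q Q').comp measurable_prodMk_left
  rw [integrable_exp_iff (hlx.const_mul p)]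
  -- The marginal density is constant on a slice and nonzero for almost every x, so it can be
  -- divided out.
  have hΔp : ν.rnDeriv μ x ^ p ≠ 0 := by
    simp [ENNReal.rpow_eq_zero_iff, hpos.ne', htop.ne]
  have e : ∀ y, (ν.rnDeriv μ x * ENNReal.ofReal (Real.exp (logLik Q Q' (x, y)))) ^ p =
      ν.rnDeriv μ x ^ p * ENNReal.ofReal (Real.exp (p * logLik Q Q' (x, y))) := by
    intro y
    rw [ENNReal.mul_rpow_of_nonneg _ _ hp.le, ENNReal.ofReal_rpow_of_pos (Real.exp_pos _),
      ← Real.exp_mul, mul_comm (logLik Q Q' (x, y))]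
  have hx' : ∫⁻ y, ν.rnDeriv μ x ^ p *
      ENNReal.ofReal (Real.exp (p * logLik Q Q' (x, y))) ∂(Q x) < ∞ := by
    simp only [← e]
    exact hx
  rw [lintegral_const_mul _ (measurable_ofReal_exp (hlx.const_mul p))] at hx'
  exact ENNReal.lt_top_of_mul_ne_top_right hx'.ne hΔp

end LogLik

end RobustValue

namespace RobustValue

/-! ### Uniform Lipschitz bound for the value function -/

section ValueBound

variable {X : Type*} [MeasurableSpace X]
  {β θ r : ℝ} {Q₀ : Measure X} [IsProbabilityMeasure Q₀] {Q Q' : Kernel X X} [IsMarkovKernel Q]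
  {u : X × X → ℝ} {v v' : X → ℝ}

theorem integral_exp_of_mul_logInt {Ω : Type*} [MeasurableSpace Ω] {π : Measure Ω} [NeZero π]
    {g : Ω → ℝ} (hg : Integrable (fun y => Real.exp (g y)) π) (hβ : β ≠ 0) {a : ℝ}
    (h : β * logInt π g = a) : ∫ y, Real.exp (g y) ∂π = Real.exp (a / β) := by
  rw [← exp_logInt hg, ← h, mul_div_cancel_left₀ _ hβ]

theorem ofReal_exp_eq_lintegral {Ω : Type*} [MeasurableSpace Ω] {π : Measure Ω}
    {g : Ω → ℝ} (hg : Integrable (fun y => Real.exp (g y)) π) {a : ℝ}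
    (h : ∫ y, Real.exp (g y) ∂π = Real.exp a) :
    ENNReal.ofReal (Real.exp a) = ∫⁻ y, ENNReal.ofReal (Real.exp (g y)) ∂π := by
  rw [← h, ofReal_integral_eq_lintegral_ofReal hg (Eventually.of_forall fun y => Real.exp_nonneg _)]

theorem allExp_alpha_mul (hr : 1 < r) (hu : MemE r (Q₀ ⊗ₘ Q) u) :
    AllExp (Q₀ ⊗ₘ Q) (fun z => alpha β θ * u z) :=
  (hu.allExp hr).const_mul _

theorem allExp_value_add (hQ : Kernel.Invariant Q Q₀) (hr : 1 < r) (hu : MemE r (Q₀ ⊗ₘ Q) u)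
    {f : X → ℝ} (hf : MemE r Q₀ f) :
    AllExp (Q₀ ⊗ₘ Q) (fun z => f z.2 + alpha β θ * u z) :=
  ((hf.allExp hr).nextState hQ hf.measurable).add (allExp_alpha_mul hr hu)
    (measurable_nextState hf.measurable)

theorem measurable_value_add (hu : Measurable u) {f : X → ℝ} (hf : Measurable f) :
    Measurable (fun z : X × X => f z.2 + alpha β θ * u z) :=
  (hf.comp measurable_snd).add (hu.const_mul _)

/-- The a priori finiteness required by `lux_le_of_subsolution`. -/
theorem lux_posPart_lt_top (hr : 1 < r) (hv : MemE r Q₀ v) (hv' : MemE r Q₀ v') :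
    lux 2 Q₀ (fun x => max (v' x - v x) 0) < ∞ := by
  have h : AllExp Q₀ (v' + -v) := (hv'.allExp hr).add (hv.allExp hr).neg hv'.measurable
  refine lt_of_le_of_lt (lux_mono_ae (Eventually.of_forall fun x => ?_))
    (h.lux_lt_top (hv'.measurable.add hv.measurable.neg))
  rw [abs_of_nonneg (le_max_right _ _), Pi.add_apply, Pi.neg_apply, ← sub_eq_add_neg]
  exact max_le (le_abs_self _) (abs_nonneg _)

theorem reference_fix (hQ : Kernel.Invariant Q Q₀) (hβ : β ≠ 0) (hr : 1 < r)
    (hu : MemE r (Q₀ ⊗ₘ Q) u) (hv : IsValueFn β θ r u Q₀ Q v) :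
    ∀ᵐ x ∂Q₀, ENNReal.ofReal (Real.exp (v x / β)) =
      ∫⁻ y, ENNReal.ofReal (Real.exp (v y + alpha β θ * u (x, y))) ∂(Q x) := by
  have hVm := measurable_value_add (β := β) (θ := θ) hu.measurable hv.mem.measurable
  filter_upwards [(allExp_value_add (β := β) (θ := θ) hQ hr hu hv.mem).ae_slice hVm,
    hv.fixed] with x h1 h2
  have hi := h1.integrable_exp (hVm.comp measurable_prodMk_left)
  exact ofReal_exp_eq_lintegral hi (integral_exp_of_mul_logInt hi hβ h2)

variable [MeasurableSpace.CountablyGenerated X]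

/-- The alternative equation is moved to the law `Q x` by adding the log likelihood ratio to the
exponent, so that both equations refer to the same measure. -/
theorem ae_fixedPair [IsMarkovKernel Q'] (hQ : Kernel.Invariant Q Q₀) (hβ : β ≠ 0) (hr : 1 < r)
    (hu : MemE r (Q₀ ⊗ₘ Q) u) (hv : IsValueFn β θ r u Q₀ Q v) (hv' : IsValueFn β θ r u Q₀ Q' v')
    (hac : MutuallyAC Q Q') (hl : lux 2 (Q₀ ⊗ₘ Q) (logLik Q Q') < ∞)
    (hp : ∀ᵐ x ∂Q₀, ∃ p : ℝ, 1 < p ∧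
      Integrable (fun y => Real.exp (p * logLik Q Q' (x, y))) (Q x)) :
    ∀ᵐ x ∂Q₀, FixedPair (Q x) (fun y => v y + alpha β θ * u (x, y))
      (fun y => v' y + alpha β θ * u (x, y)) (fun y => logLik Q Q' (x, y))
      (v x / β) (v' x / β) := by
  have hlm := measurable_logLik Q Q'
  obtain ⟨c, hc, hcl⟩ := exists_expI_le hl
  have hcl' : ∫⁻ z, ENNReal.ofReal (Real.exp (1 / c * |logLik Q Q' z|)) ∂(Q₀ ⊗ₘ Q) < ∞ := by
    refine lt_of_le_of_lt (le_of_eq ?_) (hcl.trans_lt ENNReal.ofReal_lt_top)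
    refine lintegral_congr fun z => ?_
    rw [one_div_mul_eq_div]
  have hVm := measurable_value_add (β := β) (θ := θ) hu.measurable hv.mem.measurable
  have hVm' := measurable_value_add (β := β) (θ := θ) hu.measurable hv'.mem.measurable
  filter_upwards [(allExp_value_add (β := β) (θ := θ) hQ hr hu hv.mem).ae_slice hVm,
    (allExp_value_add (β := β) (θ := θ) hQ hr hu hv'.mem).ae_slice hVm', hp,
    ae_integrable_exp_slice ((continuous_abs.measurable.comp hlm).const_mul (1 / c)) hcl',
    hv.fixed, hv'.fixed] with x h1 h2 h3 h4 h5 h6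
  have hVx : Measurable fun y => v y + alpha β θ * u (x, y) := hVm.comp measurable_prodMk_left
  have hVx' : Measurable fun y => v' y + alpha β θ * u (x, y) := hVm'.comp measurable_prodMk_left
  have hlx : Measurable fun y => logLik Q Q' (x, y) := hlm.comp measurable_prodMk_left
  obtain ⟨p, hp1, hpi⟩ := h3
  have hi' := h2.integrable_exp_add hVx' hlx hp1 hpi
  refine ⟨hVx, hVx', hlx, h1, h2, ⟨p, hp1, hpi⟩, ⟨1 / c, by positivity, h4⟩,
    integral_exp_of_mul_logInt (h1.integrable_exp hVx) hβ h5, ?_⟩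
  refine integral_exp_of_mul_logInt hi' hβ ?_
  rw [logInt, ← integral_exp_eq_logLik hac x hVx']
  exact h6

theorem AM2.lux_logLik_lt_top {M p : ℝ} (hr : 1 < r) (h : AM2 β θ r M p u Q₀ Q Q') :
    lux 2 (Q₀ ⊗ₘ Q) (logLik Q Q') < ∞ := by
  rcases h.2 with ha | ⟨Q₀', hb⟩
  · exact (ha.mem.allExp hr).lux_lt_top ha.mem.measurable
  · exact (memL_one_iff.1 hb.mem).2

theorem AM2.ae_moment [IsMarkovKernel Q'] {M p : ℝ} (hr : 1 < r) (hp : 1 < p)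
    (h : AM2 β θ r M p u Q₀ Q Q') :
    ∀ᵐ x ∂Q₀, ∃ p : ℝ, 1 < p ∧ Integrable (fun y => Real.exp (p * logLik Q Q' (x, y))) (Q x) := by
  rcases h.2 with ha | ⟨Q₀', hb⟩
  · filter_upwards [(ha.mem.allExp hr).ae_slice ha.mem.measurable] with x hx
    have hlx : Measurable fun y => logLik Q Q' (x, y) :=
      (measurable_logLik Q Q').comp measurable_prodMk_left
    exact ⟨2, one_lt_two, (hx.const_mul 2).integrable_exp (hlx.const_mul 2)⟩
  · have := hb.isProbabilityMeasure
    filter_upwards [ae_integrable_exp_mul_logLik h.1 hb.ac' hb.ac (by linarith)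
      (hb.joint_moment_le.trans_lt ENNReal.ofReal_lt_top)] with x hx
    exact ⟨p, hp, hx⟩

/-- The positive part of `v' - v` is a subsolution for the alternative distorted expectation. -/
theorem ofReal_posPart_le (hβ0 : 0 < β) {x : X}
    (h : FixedPair (Q x) (fun y => v y + alpha β θ * u (x, y))
      (fun y => v' y + alpha β θ * u (x, y)) (fun y => logLik Q Q' (x, y)) (v x / β) (v' x / β)) :
    ENNReal.ofReal (max (v' x - v x) 0) ≤ ENNReal.ofReal β *
      ∫⁻ y, ENNReal.ofReal (dens β v' (fun z => alpha β θ * u z + logLik Q Q' z) (x, y) *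
        (max (v' y - v y) 0 + |logLik Q Q' (x, y)|)) ∂(Q x) := by
  have e : ENNReal.ofReal (max (v' x - v x) 0) =
      ENNReal.ofReal β * ENNReal.ofReal (v' x / β - v x / β) := by
    rw [← ENNReal.ofReal_mul hβ0.le, ENNReal.ofReal_max, ENNReal.ofReal_zero, max_eq_left (zero_le)]
    congr 1
    field_simp
  rw [e]
  refine mul_le_mul_right ((h.sub_le (F := fun y => max (v' y - v y) 0 + |logLik Q Q' (x, y)|)
    (fun y => add_nonneg (le_max_right _ _) (abs_nonneg _)) (fun y => ?_)).trans
      (le_of_eq ?_)) _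
  · linarith [le_max_left (v' y - v y) 0, le_abs_self (logLik Q Q' (x, y))]
  · refine lintegral_congr fun y => ?_
    rw [dens, ← add_assoc]

/-- The negative part of `v' - v` is a subsolution for the reference distorted expectation. -/
theorem ofReal_negPart_le (hβ0 : 0 < β) {x : X}
    (h : FixedPair (Q x) (fun y => v y + alpha β θ * u (x, y))
      (fun y => v' y + alpha β θ * u (x, y)) (fun y => logLik Q Q' (x, y)) (v x / β) (v' x / β)) :
    ENNReal.ofReal (max (v x - v' x) 0) ≤ ENNReal.ofReal β *
      ∫⁻ y, ENNReal.ofReal (dens β v (fun z => alpha β θ * u z) (x, y) *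
        (max (v y - v' y) 0 + |logLik Q Q' (x, y)|)) ∂(Q x) := by
  have e : ENNReal.ofReal (max (v x - v' x) 0) =
      ENNReal.ofReal β * ENNReal.ofReal (v x / β - v' x / β) := by
    rw [← ENNReal.ofReal_mul hβ0.le, ENNReal.ofReal_max, ENNReal.ofReal_zero, max_eq_left (zero_le)]
    congr 1
    field_simp
  rw [e]
  refine mul_le_mul_right ((h.sub_ge (F := fun y => max (v y - v' y) 0 + |logLik Q Q' (x, y)|)
    (fun y => add_nonneg (le_max_right _ _) (abs_nonneg _)) (fun y => ?_)).trans
      (le_of_eq ?_)) _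
  · linarith [le_max_left (v y - v' y) 0, neg_abs_le (logLik Q Q' (x, y))]
  · rfl

/-- The negative part is a subsolution for the reference density, so the constant comes only from β
and exponential moments of αu under the reference law. -/
theorem exists_lux_negPart_le (hβ0 : 0 < β) (hβ1 : β < 1) (hQ : Kernel.Invariant Q Q₀)
    (hr : 1 < r) (hu : MemE r (Q₀ ⊗ₘ Q) u) (hv : IsValueFn β θ r u Q₀ Q v)
    (M : ℝ) {p : ℝ} (hp : 1 < p) :
    ∃ C : ℝ, 0 ≤ C ∧ ∀ (Q' : Kernel X X) [IsMarkovKernel Q'] (v' : X → ℝ),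
      AM2 β θ r M p u Q₀ Q Q' → IsValueFn β θ r u Q₀ Q' v' →
      lux 2 Q₀ (fun x => max (v x - v' x) 0) ≤
        ENNReal.ofReal C * lux 2 (Q₀ ⊗ₘ Q) (logLik Q Q') := by
  have hw := allExp_alpha_mul (β := β) (θ := θ) hr hu
  have hwm : Measurable fun z => alpha β θ * u z := hu.measurable.const_mul _
  set J := ∫⁻ z, ENNReal.ofReal
    (Real.exp (3 * (2 / (1 - β)) / (1 - β) * |alpha β θ * u z|)) ∂(Q₀ ⊗ₘ Q) with hJ
  have hJfin : J < ∞ := hw _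
  have hcp := contr_pos hβ0
  have hc1 := contr_lt_one hβ0 hβ1
  refine ⟨max 2 J.toReal * (contr β / (1 - contr β)),
    mul_nonneg (by positivity) (div_nonneg hcp.le (by linarith)), fun Q' _ v' hAM hv' => ?_⟩
  have hfp := ae_fixedPair hQ hβ0.ne' hr hu hv hv' hAM.1 (hAM.lux_logLik_lt_top hr)
    (hAM.ae_moment hr hp)
  refine lux_le_of_subsolution hQ hβ0 hβ1 (le_max_left _ _) hv.mem.measurable hwm
    (reference_fix hQ hβ0.ne' hr hu hv) (hv.mem.allExp hr) ?_
    ((hv.mem.measurable.sub hv'.mem.measurable).max measurable_const)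
    (fun x => le_max_right _ _) (lux_posPart_lt_top hr hv'.mem hv.mem) (measurable_logLik Q Q')
    (hfp.mono fun x hx => ofReal_negPart_le hβ0 hx)
  exact (ENNReal.ofReal_toReal hJfin.ne).symm.le.trans
    (ENNReal.ofReal_le_ofReal (le_max_right _ _))

/-- The ratio ℓ is kept inside the flow term αu + ℓ, which makes `v'` a fixed point over the
reference chain. The moment of order r in (a) bounds the exponential moment of this flow term
uniformly. -/
theorem exists_lux_posPart_le_a (hβ0 : 0 < β) (hβ1 : β < 1) (hQ : Kernel.Invariant Q Q₀)
    (hr : 1 < r) (hu : MemE r (Q₀ ⊗ₘ Q) u) (hv : IsValueFn β θ r u Q₀ Q v)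
    (M : ℝ) {p : ℝ} (hp : 1 < p) :
    ∃ C : ℝ, 0 ≤ C ∧ ∀ (Q' : Kernel X X) [IsMarkovKernel Q'] (v' : X → ℝ),
      AM2 β θ r M p u Q₀ Q Q' → AM2a β θ r M u Q₀ Q Q' → IsValueFn β θ r u Q₀ Q' v' →
      lux 2 Q₀ (fun x => max (v' x - v x) 0) ≤
        ENNReal.ofReal C * lux 2 (Q₀ ⊗ₘ Q) (logLik Q Q') := by
  have hb : 0 < 1 - β := by linarith
  set s := 3 * (2 / (1 - β)) with hs
  have hs0 : 0 < s := by positivity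
  set J := Real.exp (s * s ^ (1 / (r - 1))) * M with hJ
  have hcp := contr_pos hβ0
  have hc1 := contr_lt_one hβ0 hβ1
  refine ⟨max 2 J * (contr β / (1 - contr β)),
    mul_nonneg (by positivity) (div_nonneg hcp.le (by linarith)), fun Q' _ v' hAM ha hv' => ?_⟩
  have hfp := ae_fixedPair hQ hβ0.ne' hr hu hv hv' hAM.1 (hAM.lux_logLik_lt_top hr)
    (hAM.ae_moment hr hp)
  have hlm := measurable_logLik Q Q'
  refine lux_le_of_subsolution hQ hβ0 hβ1 (le_max_left _ _) hv'.mem.measurable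
    ((hu.measurable.const_mul (alpha β θ)).add hlm)
    (hfp.mono fun x hx => ?_) (hv'.mem.allExp hr) ?_
    ((hv'.mem.measurable.sub hv.mem.measurable).max measurable_const)
    (fun x => le_max_right _ _) (lux_posPart_lt_top hr hv.mem hv'.mem) hlm
    (hfp.mono fun x hx => ofReal_posPart_le hβ0 hx)
  · rw [ofReal_exp_eq_lintegral hx.integrable_V'_add hx.integral_V']
    simp only [Pi.add_apply, add_assoc]
  · have h1 := lintegral_exp_le_of_rpow (μ := Q₀ ⊗ₘ Q) hr hs0.le
      (fun z => 1 / (1 - β) * (logLik Q Q' z + alpha β θ * u z))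
    refine le_trans (le_of_eq ?_) ((h1.trans (mul_le_mul_right ha.moment_le _)).trans ?_)
    · refine lintegral_congr fun z => ?_
      rw [abs_mul, abs_of_pos (by positivity : 0 < 1 / (1 - β)), ← mul_assoc, mul_one_div,
        Pi.add_apply, add_comm]
    · rw [← ENNReal.ofReal_mul (Real.exp_nonneg _)]
      exact ENNReal.ofReal_le_ofReal (le_max_right _ _)

/-- Here the contraction runs along the alternative chain, stationary under `Q₀'`, with flow term αu
alone. The three moment bounds in (b) carry the norms of `D` and of ℓ between the two models, each
passage costing the factor K. -/
theorem exists_lux_posPart_le_b (hβ0 : 0 < β) (hβ1 : β < 1) (hQ : Kernel.Invariant Q Q₀)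
    (hr : 1 < r) (hu : MemE r (Q₀ ⊗ₘ Q) u) (hv : IsValueFn β θ r u Q₀ Q v)
    (M : ℝ) {p : ℝ} (hp : 1 < p) :
    ∃ C : ℝ, 0 ≤ C ∧ ∀ (Q' : Kernel X X) [IsMarkovKernel Q'] (v' : X → ℝ) (Q₀' : Measure X),
      AM2 β θ r M p u Q₀ Q Q' → AM2b p M Q₀ Q₀' Q Q' → IsValueFn β θ r u Q₀ Q' v' →
      lux 2 Q₀ (fun x => max (v' x - v x) 0) ≤
        ENNReal.ofReal C * lux 2 (Q₀ ⊗ₘ Q) (logLik Q Q') := by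
  have hpq := Real.HolderConjugate.conjExponent hp
  set q := p.conjExponent with hq
  have hp0 := hpq.pos
  have hq0 := hpq.symm.pos
  have hw := allExp_alpha_mul (β := β) (θ := θ) hr hu
  have hwm : Measurable fun z => alpha β θ * u z := hu.measurable.const_mul _
  set S := 3 * (2 / (1 - β)) / (1 - β) with hS
  set J := ∫⁻ z, ENNReal.ofReal (Real.exp (q * (S * |alpha β θ * u z|))) ∂(Q₀ ⊗ₘ Q) with hJ
  have hJfin : J < ∞ := by simpa only [mul_assoc] using hw (q * S)
  set M' := max M 0 with hM'
  have hM'0 : 0 ≤ M' := le_max_right _ _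
  have hMle : ENNReal.ofReal M ≤ ENNReal.ofReal M' := ENNReal.ofReal_le_ofReal (le_max_left _ _)
  set K := (1 + M' ^ (1 / p) * 2 ^ (1 / q)) * q with hK
  have hK0 : 0 ≤ K := by positivity
  have hcp := contr_pos hβ0
  have hc1 := contr_lt_one hβ0 hβ1
  set R := max 2 (M' ^ (1 / p) * J.toReal ^ (1 / q)) with hR
  have hRc : 0 ≤ R * (contr β / (1 - contr β)) :=
    mul_nonneg (by positivity) (div_nonneg hcp.le (by linarith))
  refine ⟨K * (R * (contr β / (1 - contr β)) * K), by positivity,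
    fun Q' _ v' Q₀' hAM hb hv' => ?_⟩
  have := hb.isProbabilityMeasure
  have hfp := ae_fixedPair hQ hβ0.ne' hr hu hv hv' hAM.1 (hAM.lux_logLik_lt_top hr)
    (hAM.ae_moment hr hp)
  have hlm := measurable_logLik Q Q'
  have hΔm := Measure.measurable_rnDeriv Q₀' Q₀
  have hΔ₂m : Measurable fun z : X × X =>
      Q₀'.rnDeriv Q₀ z.1 * ENNReal.ofReal (Real.exp (logLik Q Q' z)) :=
    (hΔm.comp measurable_fst).mul (measurable_ofReal_exp hlm)
  have hΔ₂ : ∫⁻ z, (Q₀'.rnDeriv Q₀ z.1 * ENNReal.ofReal (Real.exp (logLik Q Q' z))) ^ p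
      ∂(Q₀ ⊗ₘ Q) ≤ ENNReal.ofReal M' := by
    refine le_trans (le_of_eq (lintegral_congr_ae ?_)) (hb.joint_moment_le.trans hMle)
    filter_upwards [rnDeriv_compProd_eq_logLik hAM.1 hb.ac'] with z hz
    rw [hz]
  set D : X → ℝ := fun x => max (v' x - v x) 0 with hD
  have hDm : Measurable D := (hv'.mem.measurable.sub hv.mem.measurable).max measurable_const
  -- The moment of order p of dQ₀/dQ₀' under `Q₀'` is the moment of order 1 - p of dQ₀'/dQ₀ under
  -- `Q₀`.
  have hback : lux 2 Q₀ D ≤ ENNReal.ofReal K * lux 2 Q₀' D :=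
    lux_change_le hpq hM'0 (Measure.measurable_rnDeriv Q₀ Q₀')
      (fun F hF => (lintegral_rnDeriv_mul hb.ac hF.aemeasurable).symm)
      (by
        rw [lintegral_rnDeriv_inv_rpow hb.ac' hb.ac p]
        exact hb.inv_moment_le.trans hMle) hDm
  have hforth : lux 2 Q₀' D ≤ ENNReal.ofReal K * lux 2 Q₀ D :=
    lux_change_le hpq hM'0 hΔm
      (fun F hF => (lintegral_rnDeriv_mul hb.ac' hF.aemeasurable).symm)
      (hb.moment_le.trans hMle) hDm
  have hlforth : lux 2 (Q₀' ⊗ₘ Q') (logLik Q Q') ≤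
      ENNReal.ofReal K * lux 2 (Q₀ ⊗ₘ Q) (logLik Q Q') :=
    lux_change_le hpq hM'0 hΔ₂m (fun F hF => lintegral_compProd_eq_logLik hAM.1 hb.ac' hF) hΔ₂ hlm
  have hDfin : lux 2 Q₀' D < ∞ := hforth.trans_lt
    (ENNReal.mul_lt_top ENNReal.ofReal_lt_top (lux_posPart_lt_top hr hv.mem hv'.mem))
  -- The absorption in `moment_le` now takes place under `Q₀'`, so finiteness of the moments is
  -- needed there.
  have hv'All : AllExp Q₀' v' := by
    intro s
    have habs : Measurable fun x => s * |v' x| :=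
      (continuous_abs.measurable.comp hv'.mem.measurable).const_mul s
    rw [← lintegral_rnDeriv_mul hb.ac' (measurable_ofReal_exp habs).aemeasurable]
    refine (lintegral_exp_change_le hpq hΔm habs).trans_lt ?_
    refine ENNReal.mul_lt_top (ENNReal.rpow_lt_top_of_nonneg (by positivity)
      (hb.moment_le.trans_lt ENNReal.ofReal_lt_top).ne)
      (ENNReal.rpow_lt_top_of_nonneg (by positivity) ?_)
    simp only [← mul_assoc]
    exact (hv'.mem.allExp hr (q * s)).ne
  have hJb : ∫⁻ z, ENNReal.ofReal (Real.exp (S * |alpha β θ * u z|)) ∂(Q₀' ⊗ₘ Q') ≤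
      ENNReal.ofReal R := by
    have habs : Measurable fun z => S * |alpha β θ * u z| :=
      (continuous_abs.measurable.comp hwm).const_mul S
    rw [lintegral_compProd_eq_logLik hAM.1 hb.ac' (measurable_ofReal_exp habs)]
    refine (lintegral_exp_change_le hpq hΔ₂m habs).trans ?_
    refine le_trans ?_ (ENNReal.ofReal_le_ofReal (le_max_right _ _))
    rw [ENNReal.ofReal_mul (by positivity),
      ← ENNReal.ofReal_rpow_of_nonneg hM'0 (by positivity),
      ← ENNReal.ofReal_rpow_of_nonneg ENNReal.toReal_nonneg (by positivity),
      ENNReal.ofReal_toReal hJfin.ne]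
    gcongr
  have hmain : lux 2 Q₀' D ≤
      ENNReal.ofReal (R * (contr β / (1 - contr β))) * lux 2 (Q₀' ⊗ₘ Q') (logLik Q Q') := by
    refine lux_le_of_subsolution hb.stationary hβ0 hβ1 (le_max_left _ _) hv'.mem.measurable hwm
      (hb.ac'.ae_le (hfp.mono fun x hx => ?_)) hv'All hJb hDm (fun x => le_max_right _ _) hDfin hlm
      (hb.ac'.ae_le (hfp.mono fun x hx => ?_))
    · rw [lintegral_exp_eq_logLik hAM.1 x hx.measurable_V']
      exact ofReal_exp_eq_lintegral hx.integrable_V'_add hx.integral_V'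
    · refine (ofReal_posPart_le hβ0 hx).trans (le_of_eq ?_)
      have hFm : Measurable fun y => ENNReal.ofReal
          (dens β v' (fun z => alpha β θ * u z) (x, y) * (D y + |logLik Q Q' (x, y)|)) :=
        (((measurable_dens hv'.mem.measurable hwm).comp measurable_prodMk_left).mul
          (hDm.add (continuous_abs.measurable.comp
            (hlm.comp measurable_prodMk_left)))).ennreal_ofReal
      rw [lintegral_eq_exp_logLik hAM.1 x hFm]
      congr 1
      refine lintegral_congr fun y => ?_
      rw [← ENNReal.ofReal_mul (Real.exp_nonneg _), ← mul_assoc, dens, dens, ← Real.exp_add]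
      congr 3
      ring
  calc lux 2 Q₀ D ≤ ENNReal.ofReal K * (ENNReal.ofReal (R * (contr β / (1 - contr β))) *
        (ENNReal.ofReal K * lux 2 (Q₀ ⊗ₘ Q) (logLik Q Q'))) :=
        hback.trans (mul_le_mul_right (hmain.trans (mul_le_mul_right hlforth _)) _)
    _ = _ := by
        rw [ENNReal.ofReal_mul hK0, ENNReal.ofReal_mul hRc]
        ring

/-- Over the class of alternative models, `v' - v` is uniformly Lipschitz in the log likelihood
ratio. -/
theorem exists_lux_value_sub_le (hβ0 : 0 < β) (hβ1 : β < 1) (hQ : Kernel.Invariant Q Q₀)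
    (hr : 1 < r) (hu : MemE r (Q₀ ⊗ₘ Q) u) (hv : IsValueFn β θ r u Q₀ Q v)
    (M : ℝ) {p : ℝ} (hp : 1 < p) :
    ∃ C : ℝ, 0 ≤ C ∧ ∀ (Q' : Kernel X X) [IsMarkovKernel Q'] (v' : X → ℝ),
      AM2 β θ r M p u Q₀ Q Q' → IsValueFn β θ r u Q₀ Q' v' →
      lux 2 Q₀ (v' - v) ≤ ENNReal.ofReal C * lux 2 (Q₀ ⊗ₘ Q) (logLik Q Q') := by
  obtain ⟨C₁, hC₁, h₁⟩ := exists_lux_negPart_le hβ0 hβ1 hQ hr hu hv M hp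
  obtain ⟨C₂, hC₂, h₂⟩ := exists_lux_posPart_le_a hβ0 hβ1 hQ hr hu hv M hp
  obtain ⟨C₃, hC₃, h₃⟩ := exists_lux_posPart_le_b hβ0 hβ1 hQ hr hu hv M hp
  refine ⟨max C₂ C₃ + C₁, by positivity, fun Q' _ v' hAM hv' => ?_⟩
  have hpos : lux 2 Q₀ (fun x => max (v' x - v x) 0) ≤
      ENNReal.ofReal (max C₂ C₃) * lux 2 (Q₀ ⊗ₘ Q) (logLik Q Q') := by
    rcases hAM.2 with ha | ⟨Q₀', hb⟩
    · refine (h₂ Q' v' hAM ha hv').trans (mul_le_mul_left ?_ _)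
      exact ENNReal.ofReal_le_ofReal (le_max_left _ _)
    · refine (h₃ Q' v' Q₀' hAM hb hv').trans (mul_le_mul_left ?_ _)
      exact ENNReal.ofReal_le_ofReal (le_max_right _ _)
  have hneg := h₁ Q' v' hAM hv'
  have hsplit : v' - v = (fun x => max (v' x - v x) 0) + -(fun x => max (v x - v' x) 0) := by
    ext x
    simp only [Pi.sub_apply, Pi.add_apply, Pi.neg_apply]
    rcases le_total (v x) (v' x) with h | h
    · rw [max_eq_left (by linarith), max_eq_right (by linarith)]; ring
    · rw [max_eq_right (by linarith), max_eq_left (by linarith)]; ring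
  rw [hsplit]
  refine (lux_add_le ((hv'.mem.measurable.sub hv.mem.measurable).max measurable_const)).trans ?_
  rw [lux_neg, ENNReal.ofReal_add (by positivity) hC₁, add_mul]
  exact add_le_add hpos hneg

end ValueBound

end RobustValue

namespace RobustValue

/-! ### Convergence of geometrically decaying series -/

section Completeness

variable {Ω : Type*} [MeasurableSpace Ω]

/-- The scale ρ^N c/(1-ρ) is the full tail of the geometric series of scales, so it does not depend
on the number k of terms. -/
theorem expI_sum_geometric_le {μ : Measure Ω} [IsProbabilityMeasure μ] {R c ρ : ℝ} (hR : 1 ≤ R)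
    (hc : 0 < c) (h0 : 0 < ρ) (h1 : ρ < 1) {a : ℕ → Ω → ℝ} (ha : ∀ n, Measurable (a n))
    (h : ∀ n, expI μ (ρ ^ n * c) (a n) ≤ ENNReal.ofReal R) (k N : ℕ) :
    expI μ (ρ ^ N * c / (1 - ρ)) (fun x => ∑ i ∈ Finset.range k, a (N + i) x) ≤
      ENNReal.ofReal R := by
  have hρ : 0 < 1 - ρ := by linarith
  induction k generalizing N with
  | zero => simpa [expI] using hR
  | succ k ih =>
    have h2 := expI_add_le (by positivity) (by positivity) (ha N) (h N) (ih (N + 1))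
    have e1 : ρ ^ N * c + ρ ^ (N + 1) * c / (1 - ρ) = ρ ^ N * c / (1 - ρ) := by
      field_simp; ring
    have e2 : (a N + fun x => ∑ i ∈ Finset.range k, a (N + 1 + i) x) =
        fun x => ∑ i ∈ Finset.range (k + 1), a (N + i) x := by
      ext x
      rw [Finset.sum_range_succ', add_comm]
      simp only [Pi.add_apply, add_zero, add_assoc, add_comm 1]
    rwa [e1, e2] at h2

theorem lintegral_enorm_le_expI {μ : Measure Ω} {c : ℝ} (hc : 0 < c) {f : Ω → ℝ} :
    ∫⁻ x, ‖f x‖ₑ ∂μ ≤ ENNReal.ofReal c * expI μ c f := by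
  rw [expI, ← lintegral_const_mul' _ _ ENNReal.ofReal_ne_top]
  refine lintegral_mono fun x => ?_
  rw [← ENNReal.ofReal_mul hc.le, Real.enorm_eq_ofReal_abs]
  refine ENNReal.ofReal_le_ofReal ?_
  have := Real.add_one_le_exp (|f x| / c)
  have e : |f x| = c * (|f x| / c) := by field_simp
  nlinarith

/-- A series whose terms decay geometrically in Luxemburg norm converges. -/
theorem exists_lux_limit {μ : Measure Ω} [IsProbabilityMeasure μ] {R c ρ : ℝ} (hR : 1 ≤ R)
    (hc : 0 < c) (h0 : 0 < ρ) (h1 : ρ < 1) {a : ℕ → Ω → ℝ} (ha : ∀ n, Measurable (a n))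
    (h : ∀ n, expI μ (ρ ^ n * c) (a n) ≤ ENNReal.ofReal R) :
    ∃ w : Ω → ℝ, Measurable w ∧ ∀ N : ℕ,
      lux R μ (fun x => (∑ n ∈ Finset.range N, a n x) - w x) ≤
        ENNReal.ofReal (ρ ^ N * c / (1 - ρ)) := by
  have hρ : 0 < 1 - ρ := by linarith
  have hS : ∀ N, Measurable fun x => ∑ n ∈ Finset.range N, a n x := fun N =>
    Finset.measurable_fun_sum _ fun n _ => ha n
  have hsum : ∀ᵐ x ∂μ, Summable fun n => a n x := by
    have hfin : ∫⁻ x, ∑' n, ‖a n x‖ₑ ∂μ < ∞ := by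
      rw [lintegral_tsum fun n => (ha n).enorm.aemeasurable]
      have hle : ∀ n, ∫⁻ x, ‖a n x‖ₑ ∂μ ≤ ENNReal.ofReal (ρ ^ n * (c * R)) := by
        intro n
        refine (lintegral_enorm_le_expI (c := ρ ^ n * c) (by positivity)).trans
          ((mul_le_mul_right (h n) _).trans (le_of_eq ?_))
        rw [← ENNReal.ofReal_mul (by positivity), mul_assoc]
      refine (ENNReal.tsum_le_tsum hle).trans_lt ?_
      rw [← ENNReal.ofReal_tsum_of_nonneg (fun n => by positivity)
        ((summable_geometric_of_lt_one h0.le h1).mul_right _)]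
      exact ENNReal.ofReal_lt_top
    filter_upwards [ae_lt_top (Measurable.tsum fun n => (ha n).enorm) hfin.ne] with x hx
    refine Summable.of_norm ?_
    have := ENNReal.summable_toReal hx.ne
    simpa using this
  obtain ⟨w, hwm, hw⟩ := measurable_limit_of_tendsto_metrizable_ae (μ := μ) (L := atTop)
    (f := fun N x => ∑ n ∈ Finset.range N, a n x) (fun N => (hS N).aemeasurable)
    (hsum.mono fun x hx => ⟨_, hx.hasSum.tendsto_sum_nat⟩)
  refine ⟨w, hwm, fun N => lux_le (by positivity) ?_⟩
  set cN := ρ ^ N * c / (1 - ρ) with hcN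
  -- Up to sign, the error is the almost sure limit of finite blocks starting at N; Fatou's lemma
  -- transfers their common bound.
  have hfatou : expI μ cN (fun x => (∑ n ∈ Finset.range N, a n x) - w x) ≤
      liminf (fun k => expI μ cN (fun x => ∑ i ∈ Finset.range k, a (N + i) x)) atTop := by
    refine le_trans (lintegral_mono_ae ?_) (lintegral_liminf_le fun k =>
      measurable_ofReal_exp_abs (Finset.measurable_fun_sum _ fun n _ => ha _) cN)
    filter_upwards [hw] with x hx
    have ht : Tendsto (fun k => ∑ i ∈ Finset.range k, a (N + i) x) atTop
        (𝓝 (w x - ∑ n ∈ Finset.range N, a n x)) := by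
      have h2 : Tendsto (fun k => ∑ n ∈ Finset.range (N + k), a n x) atTop (𝓝 (w x)) := by
        have := (tendsto_add_atTop_iff_nat (f := fun k => ∑ n ∈ Finset.range k, a n x) N).2 hx
        simpa only [add_comm] using this
      refine (h2.sub_const (∑ n ∈ Finset.range N, a n x)).congr fun k => ?_
      rw [Finset.sum_range_add, add_sub_cancel_left]
    have ht2 : Tendsto
        (fun k => ENNReal.ofReal (Real.exp (|∑ i ∈ Finset.range k, a (N + i) x| / cN))) atTop
        (𝓝 (ENNReal.ofReal (Real.exp (|w x - ∑ n ∈ Finset.range N, a n x| / cN)))) :=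
      ENNReal.tendsto_ofReal ((Real.continuous_exp.tendsto _).comp ((ht.abs).div_const cN))
    rw [ht2.liminf_eq, abs_sub_comm]
  refine hfatou.trans ?_
  refine liminf_le_of_le (by isBoundedDefault) fun b hb => ?_
  obtain ⟨k, hk⟩ := hb.exists
  exact hk.trans (expI_sum_geometric_le hR hc h0 h1 ha h k N)

theorem le_of_le_mul_add {ρ : ℝ} (h0 : 0 < ρ) (h1 : ρ < 1) {x y : ℝ≥0∞} (hx : x ≠ ∞)
    (h : x ≤ ENNReal.ofReal ρ * x + y) : x ≤ ENNReal.ofReal (1 / (1 - ρ)) * y := by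
  have hρ : 0 < 1 - ρ := by linarith
  rcases eq_or_ne y ∞ with rfl | hy
  · rw [ENNReal.mul_top (by simpa using hρ)]
    exact le_top
  rw [← ENNReal.ofReal_toReal hx, ← ENNReal.ofReal_toReal hy] at h ⊢
  rw [← ENNReal.ofReal_mul h0.le, ← ENNReal.ofReal_add (by positivity) (by positivity),
    ENNReal.ofReal_le_ofReal_iff (by positivity)] at h
  rw [← ENNReal.ofReal_mul (by positivity)]
  refine ENNReal.ofReal_le_ofReal ?_
  rw [div_mul_eq_mul_div, one_mul, le_div_iff₀ hρ]
  linarith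

end Completeness

/-! ### Norm bounds for conditional expectations and for the subgradient -/

section Operator

variable {X : Type*} [MeasurableSpace X] {μ : Measure X} [IsProbabilityMeasure μ]
  {Q : Kernel X X}

theorem lux_condE_le [IsMarkovKernel Q] {R : ℝ} {f : X × X → ℝ} (hf : Measurable f) :
    lux R μ (condE Q f) ≤ lux R (μ ⊗ₘ Q) f := by
  have key := lux_le_mul_of_expI (R := R) (R' := R) (μ := μ ⊗ₘ Q) (ν := μ) (f := f)
    (g := condE Q f) one_pos fun c hc h => by
      refine le_trans ?_ h
      rw [one_mul, expI, expI, Measure.lintegral_compProd (measurable_ofReal_exp_abs hf c)]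
      refine lintegral_mono fun x => ?_
      refine ofReal_exp_le_lintegral_exp (π := Q x) (F := fun y => |f (x, y)| / c)
        (((continuous_abs.measurable.comp hf).div_const c).comp measurable_prodMk_left)
        (fun y => by positivity) ?_
      -- This holds also where the slice is not integrable, the integral then being 0 by convention.
      have h1 := enorm_integral_le_lintegral_enorm (μ := Q x) (fun y => f (x, y))
      rw [div_eq_inv_mul, ENNReal.ofReal_mul (by positivity)]
      have e : ∀ y, ENNReal.ofReal (|f (x, y)| / c) =
          ENNReal.ofReal c⁻¹ * ‖f (x, y)‖ₑ := fun y => by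
        rw [div_eq_inv_mul, ENNReal.ofReal_mul (by positivity), Real.enorm_eq_ofReal_abs]
      simp_rw [e]
      rw [lintegral_const_mul' _ _ ENNReal.ofReal_ne_top]
      refine mul_le_mul_right ?_ _
      rwa [Real.enorm_eq_ofReal_abs] at h1
  simpa using key

variable {β θ : ℝ} {u : X × X → ℝ} {v : X → ℝ}

theorem ofReal_abs_opD_le (hβ0 : 0 < β) {x : X}
    (h : ∫ y, Real.exp (v y + alpha β θ * u (x, y)) ∂(Q x) = Real.exp (v x / β))
    (F : X × X → ℝ) :
    ENNReal.ofReal |opD β θ u Q (nextState v) F x| ≤ ENNReal.ofReal β *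
      ∫⁻ y, ENNReal.ofReal (dens β v (fun z => alpha β θ * u z) (x, y) * |F (x, y)|) ∂(Q x) := by
  rw [opD_eq_tilt, abs_mul, abs_of_pos hβ0, ENNReal.ofReal_mul hβ0.le, tilt]
  refine mul_le_mul_right ?_ _
  have h1 := enorm_integral_le_lintegral_enorm (μ := Q x) (fun y =>
    Real.exp (nextState v (x, y) + alpha β θ * u (x, y)) /
      (∫ z, Real.exp (nextState v (x, z) + alpha β θ * u (x, z)) ∂(Q x)) * F (x, y))
  rw [Real.enorm_eq_ofReal_abs] at h1
  refine h1.trans (le_of_eq (lintegral_congr fun y => ?_))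
  have h' : ∫ z, Real.exp (nextState v (x, z) + alpha β θ * u (x, z)) ∂(Q x) =
    Real.exp (v x / β) := h
  rw [h', Real.enorm_eq_ofReal_abs, abs_mul, ← Real.exp_sub, Real.abs_exp]
  rfl

/-- The operators `D_g` are homogeneous. -/
theorem opD_const_mul (β θ : ℝ) (u : X × X → ℝ) (Q : Kernel X X) (g f : X × X → ℝ) (a : ℝ) (x : X) :
    opD β θ u Q g (fun z => a * f z) x = a * opD β θ u Q g f x := by
  rw [opD_eq_tilt, opD_eq_tilt, tilt_smul]
  ring

/-- Continuity of the subgradient, in a form that avoids operator norms. -/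
theorem SubgradientContinuousAt.exists_lux_le [IsMarkovKernel Q]
    (hD : SubgradientContinuousAt β θ u μ Q v)
    {ε : ℝ} (hε : 0 < ε) :
    ∃ δ : ℝ, 0 < δ ∧ ∀ h : X × X → ℝ, Measurable h → lux 2 (μ ⊗ₘ Q) h ≤ ENNReal.ofReal δ →
      ∀ (d : X → ℝ) (c : ℝ), Measurable d → lux 2 μ d < ENNReal.ofReal c →
        lux 2 μ (fun x => opD₁ β θ u Q (h + nextState v) d x - opD₁ β θ u Q (nextState v) d x) ≤
          ENNReal.ofReal (ε * c) := by
  obtain ⟨δ, hδ, hle⟩ := hD ε hε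
  refine ⟨δ, hδ, fun h hm hh d c hd hdc => ?_⟩
  have hc : 0 < c := (expI_le_of_lux_lt hdc).1
  have hop := hle h (memL_one_iff.2 ⟨hm, hh.trans_lt ENNReal.ofReal_lt_top⟩)
    (by rwa [orliczNorm_one_eq_lux])
  -- The rescaling uses a real c strictly above the norm, since the norm itself may be zero.
  have hf : lux 2 μ (c⁻¹ • d) ≤ 1 := by
    refine (lux_smul_le 2 μ (by positivity) d).trans ((mul_le_mul_right hdc.le _).trans ?_)
    rw [← ENNReal.ofReal_mul (by positivity), inv_mul_cancel₀ hc.ne', ENNReal.ofReal_one]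
  have h1 : orliczNorm 1 μ (opD₁ β θ u Q (h + nextState v) (c⁻¹ • d) -
      opD₁ β θ u Q (nextState v) (c⁻¹ • d)) ≤ ENNReal.ofReal ε := by
    refine le_trans ?_ hop
    exact le_iSup_of_le (c⁻¹ • d) (le_iSup_of_le
      (memL_one_iff.2 ⟨hd.const_smul _, hf.trans_lt ENNReal.one_lt_top⟩)
      (le_iSup_of_le (by rwa [orliczNorm_one_eq_lux]) le_rfl))
  rw [orliczNorm_one_eq_lux] at h1
  have e : (fun x => opD₁ β θ u Q (h + nextState v) d x - opD₁ β θ u Q (nextState v) d x) =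
      c • (opD₁ β θ u Q (h + nextState v) (c⁻¹ • d) -
        opD₁ β θ u Q (nextState v) (c⁻¹ • d)) := by
    ext x
    have e1 : ∀ g : X × X → ℝ, opD₁ β θ u Q g d x = c * opD₁ β θ u Q g (c⁻¹ • d) x := by
      intro g
      have := opD_const_mul β θ u Q g (nextState d) c⁻¹ x
      have e2 : nextState (c⁻¹ • d) = fun z => c⁻¹ * nextState d z := rfl
      rw [opD₁, opD₁, e2, this, mul_inv_cancel_left₀ hc.ne']
    rw [e1, e1]
    simp only [Pi.smul_apply, Pi.sub_apply, smul_eq_mul]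
    ring
  rw [e]
  refine (lux_smul_le 2 μ hc _).trans ((mul_le_mul_right h1 _).trans (le_of_eq ?_))
  rw [← ENNReal.ofReal_mul hc.le, mul_comm]

end Operator

/-! ### The Neumann series of the reference model -/

section Reference

/-- The standing facts about the reference model. -/
structure Reference {X : Type*} [MeasurableSpace X] (β θ R : ℝ) (u : X × X → ℝ) (Q₀ : Measure X)
    (Q : Kernel X X) (v : X → ℝ) : Prop where
  pos : 0 < β
  lt_one : β < 1
  invariant : Kernel.Invariant Q Q₀
  measurable_u : Measurable u
  measurable_v : Measurable v
  allExp : AllExp (Q₀ ⊗ₘ Q) (fun z => v z.2 + alpha β θ * u z)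
  fixed : ∀ᵐ x ∂Q₀, ∫ y, Real.exp (v y + alpha β θ * u (x, y)) ∂(Q x) = Real.exp (v x / β)
  two_le : 2 ≤ R
  dens_moment : ∫⁻ z, ENNReal.ofReal (dens β v (fun z => alpha β θ * u z) z) ^ (2 / (1 - β))
    ∂(Q₀ ⊗ₘ Q) ≤ ENNReal.ofReal R

namespace Reference

variable {X : Type*} [MeasurableSpace X] {β θ R : ℝ} {u : X × X → ℝ} {Q₀ : Measure X}
  {Q : Kernel X X} {v : X → ℝ}

theorem measurable_sum (h : Reference β θ R u Q₀ Q v) :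
    Measurable (fun z : X × X => v z.2 + alpha β θ * u z) :=
  measurable_value_add h.measurable_u h.measurable_v

theorem measurable_opD [IsMarkovKernel Q] (h : Reference β θ R u Q₀ Q v) {f : X × X → ℝ}
    (hf : Measurable f) : Measurable (opD β θ u Q (nextState v) f) :=
  RobustValue.measurable_opD β θ h.measurable_u Q (measurable_nextState h.measurable_v) hf

theorem lux_two_le [IsProbabilityMeasure Q₀] (h : Reference β θ R u Q₀ Q v) {f : X → ℝ}
    (hf : Measurable f) :
    lux 2 Q₀ f ≤ ENNReal.ofReal R * lux R Q₀ f :=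
  RobustValue.lux_two_le (by linarith [h.two_le]) le_rfl hf

variable [IsProbabilityMeasure Q₀]

theorem lux_lt_top_iff (h : Reference β θ R u Q₀ Q v) {f : X → ℝ} (hf : Measurable f) :
    lux 2 Q₀ f < ∞ ↔ lux R Q₀ f < ∞ :=
  ⟨fun h' => (lux_antitone_threshold h.two_le _ _).trans_lt h',
    fun h' => (h.lux_two_le hf).trans_lt (ENNReal.mul_lt_top ENNReal.ofReal_lt_top h')⟩

variable [IsMarkovKernel Q]

theorem expI_opD_le (h : Reference β θ R u Q₀ Q v) {F : X × X → ℝ} (hF : Measurable F) {c : ℝ}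
    (hc : 0 < c) (hcR : expI (Q₀ ⊗ₘ Q) c F ≤ ENNReal.ofReal R) :
    expI Q₀ (contr β * c) (opD β θ u Q (nextState v) F) ≤ ENNReal.ofReal R := by
  have hwm : Measurable fun z => alpha β θ * u z := h.measurable_u.const_mul _
  refine expI_contract h.pos h.lt_one (by linarith [h.two_le])
    (measurable_dens (β := β) h.measurable_v hwm) (fun z => (dens_pos β v _ z).le) ?_
    h.dens_moment hF (h.fixed.mono fun x hx => ofReal_abs_opD_le h.pos hx F) hc hcR
  filter_upwards [h.fixed, h.allExp.ae_slice h.measurable_sum] with x hx hx'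
  refine lintegral_dens_eq_one ?_
  exact ofReal_exp_eq_lintegral
    (hx'.integrable_exp (h.measurable_sum.comp measurable_prodMk_left)) hx

theorem lux_opD_le (h : Reference β θ R u Q₀ Q v) {F : X × X → ℝ} (hF : Measurable F) :
    lux R Q₀ (opD β θ u Q (nextState v) F) ≤ ENNReal.ofReal (contr β) * lux R (Q₀ ⊗ₘ Q) F :=
  lux_le_mul_of_expI (contr_pos h.pos) fun _ hc hcR => h.expI_opD_le hF hc hcR

/-- Linearity is asserted only almost everywhere, because the integrands are known to be integrable
only on almost every slice. -/
theorem opD_sub_ae (h : Reference β θ R u Q₀ Q v) {f g : X × X → ℝ} (hf : Measurable f)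
    (hg : Measurable g) (hf' : lux 2 (Q₀ ⊗ₘ Q) f < ∞) (hg' : lux 2 (Q₀ ⊗ₘ Q) g < ∞) :
    opD β θ u Q (nextState v) (f - g) =ᵐ[Q₀]
      opD β θ u Q (nextState v) f - opD β θ u Q (nextState v) g := by
  have hint : ∀ F : X × X → ℝ, Measurable F → lux 2 (Q₀ ⊗ₘ Q) F < ∞ → ∀ᵐ x ∂Q₀,
      Integrable (fun y => Real.exp (v y + alpha β θ * u (x, y)) * F (x, y)) (Q x) := by
    intro F hF hFl
    obtain ⟨c, hc, hcl⟩ := exists_expI_le hFl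
    have hcl' : ∫⁻ z, ENNReal.ofReal (Real.exp (1 / c * |F z|)) ∂(Q₀ ⊗ₘ Q) < ∞ := by
      refine lt_of_le_of_lt (le_of_eq ?_) (hcl.trans_lt ENNReal.ofReal_lt_top)
      exact lintegral_congr fun z => by rw [one_div_mul_eq_div]
    filter_upwards [h.allExp.ae_slice h.measurable_sum, ae_integrable_exp_slice
      ((continuous_abs.measurable.comp hF).const_mul (1 / c)) hcl'] with x h1 h2
    exact h1.integrable_exp_mul (h.measurable_sum.comp measurable_prodMk_left)
      (hF.comp measurable_prodMk_left) (by positivity : 0 < 1 / c) h2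
  filter_upwards [hint f hf hf', hint g hg hg'] with x h1 h2
  rw [Pi.sub_apply, opD_eq_tilt, opD_eq_tilt, opD_eq_tilt, ← mul_sub]
  congr 1
  exact tilt_sub h1 h2

/-- The Neumann series of the discounted distorted expectation converges, and it solves the
linearized fixed-point equation up to the residual. -/
theorem exists_series (h : Reference β θ R u Q₀ Q v) {η : X × X → ℝ} (hη : Measurable η)
    (hηl : lux 2 (Q₀ ⊗ₘ Q) η < ∞) :
    ∃ w : X → ℝ, HasOrliczSum 1 Q₀ (seriesTerm β θ u Q v η) w ∧
      ∀ d : X → ℝ, Measurable d → lux 2 Q₀ d < ∞ →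
        lux 2 Q₀ (d - w) ≤ ENNReal.ofReal (R / (1 - contr β)) *
          lux 2 Q₀ (fun x => d x - opD₁ β θ u Q (nextState v) d x -
            opD β θ u Q (nextState v) η x) := by
  have hcp := contr_pos h.pos
  have hc1 := contr_lt_one h.pos h.lt_one
  have hρ : 0 < 1 - contr β := by linarith
  have hR0 : 0 < R := by linarith [h.two_le]
  set a := seriesTerm β θ u Q v η with ha
  have ha0 : a 0 = opD β θ u Q (nextState v) η := rfl
  have hasucc : ∀ n, a (n + 1) = opD β θ u Q (nextState v) (nextState (a n)) := fun n => by
    rw [ha, seriesTerm, Function.iterate_succ_apply']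
    rfl
  have ham : ∀ n, Measurable (a n) := by
    intro n
    induction n with
    | zero => exact h.measurable_opD hη
    | succ n ih => rw [hasucc]; exact h.measurable_opD (measurable_nextState ih)
  have hηR : lux R (Q₀ ⊗ₘ Q) η < ∞ := (lux_antitone_threshold h.two_le _ _).trans_lt hηl
  obtain ⟨c, hc, hcη⟩ := exists_expI_le hηR
  -- The extra factor `contr β` is there because the term of index 0 already contains one
  -- application of the operator.
  have hexp : ∀ n, expI Q₀ (contr β ^ n * (contr β * c)) (a n) ≤ ENNReal.ofReal R := by
    intro n
    induction n with
    | zero => rw [pow_zero, one_mul, ha0]; exact h.expI_opD_le hη hc hcη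
    | succ n ih =>
      rw [hasucc, pow_succ', mul_assoc]
      refine h.expI_opD_le (measurable_nextState (ham n)) (by positivity) ?_
      refine le_trans (le_of_eq ?_) ih
      conv_rhs => rw [← map_snd_compProd h.invariant]
      rw [expI_comp measurable_snd (ham n)]
      rfl
  obtain ⟨w, hwm, hw⟩ := exists_lux_limit (by linarith [h.two_le]) (by positivity) hcp hc1 ham hexp
  set S : ℕ → X → ℝ := fun N x => ∑ n ∈ Finset.range N, a n x with hS
  have hSm : ∀ N, Measurable (S N) := fun N => Finset.measurable_fun_sum _ fun n _ => ham n
  have hSsucc : ∀ N, S (N + 1) = S N + a N := fun N => by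
    ext x; simp [hS, Finset.sum_range_succ]
  have hal : ∀ n, lux 2 Q₀ (a n) < ∞ := fun n => (h.lux_lt_top_iff (ham n)).2
    ((lux_le (by positivity) (hexp n)).trans_lt ENNReal.ofReal_lt_top)
  have hSl : ∀ N, lux 2 Q₀ (S N) < ∞ := by
    intro N
    induction N with
    | zero =>
      have : S 0 = fun _ => 0 := by ext x; simp [hS]
      rw [this]
      exact (lux_const_le Q₀ le_rfl one_pos (by norm_num)).trans_lt ENNReal.ofReal_lt_top
    | succ N ih =>
      rw [hSsucc]
      exact (lux_add_le (hSm N)).trans_lt (ENNReal.add_lt_top.2 ⟨ih, hal N⟩)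
  set t : ℕ → ℝ≥0∞ := fun N => ENNReal.ofReal (contr β ^ N * (contr β * c) / (1 - contr β)) with ht
  have htend : Tendsto t atTop (𝓝 0) := by
    have h1 : Tendsto (fun N : ℕ => contr β ^ N * (contr β * c) / (1 - contr β)) atTop (𝓝 0) := by
      have := ((tendsto_pow_atTop_nhds_zero_of_lt_one hcp.le hc1).mul_const
        (contr β * c)).div_const (1 - contr β)
      simpa using this
    simpa using ENNReal.tendsto_ofReal h1
  have hwl : lux R Q₀ w < ∞ := by
    have h1 := hw 0
    have e' : (fun x => (∑ n ∈ Finset.range 0, a n x) - w x) = -w := by ext x; simp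
    rw [e', lux_neg] at h1
    exact h1.trans_lt ENNReal.ofReal_lt_top
  refine ⟨w, ⟨memL_one_iff.2 ⟨hwm, (h.lux_lt_top_iff hwm).2 hwl⟩, ?_⟩, fun d hd hdl => ?_⟩
  · simp only [orliczNorm_one_eq_lux]
    refine tendsto_of_tendsto_of_tendsto_of_le_of_le tendsto_const_nhds
      (h := fun N => ENNReal.ofReal R * t N) ?_ (fun N => zero_le) fun N => ?_
    · simpa using ENNReal.Tendsto.const_mul htend (Or.inr ENNReal.ofReal_ne_top)
    · exact (h.lux_two_le ((hSm N).sub hwm)).trans (mul_le_mul_right (hw N) _)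
  -- The operator shifts partial sums by one index. Subtracting this from the definition of `Res`
  -- gives d - S_{N+1} = D(d - S_N) + Res, and `hlim` is the limit of the resulting norm inequality.
  have hDS : ∀ N, opD β θ u Q (nextState v) (nextState (S N)) =ᵐ[Q₀]
      S (N + 1) - opD β θ u Q (nextState v) η := by
    intro N
    induction N with
    | zero =>
      refine Eventually.of_forall fun x => ?_
      have e : nextState (S 0) = fun z : X × X => (0 : ℝ) * (0 : X × X → ℝ) z := by
        ext z; simp [hS, nextState]
      rw [e, opD_const_mul, zero_mul]
      simp [hS, ha0]
    | succ N ih =>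
      have e : nextState (S N) = nextState (S (N + 1)) - nextState (a N) := by
        ext z; simp [nextState, hSsucc]
      have h1 := h.opD_sub_ae (measurable_nextState (hSm (N + 1))) (measurable_nextState (ham N))
        (by rw [lux_nextState h.invariant (hSm _)]; exact hSl _)
        (by rw [lux_nextState h.invariant (ham _)]; exact hal _)
      rw [← e] at h1
      filter_upwards [ih, h1] with x hx1 hx2
      rw [hx1] at hx2
      simp only [Pi.sub_apply] at hx2 ⊢
      rw [hSsucc (N + 1), Pi.add_apply, hasucc N]
      linarith
  set Res : X → ℝ := fun x => d x - opD₁ β θ u Q (nextState v) d x -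
    opD β θ u Q (nextState v) η x with hRes
  have hResm : Measurable Res :=
    (hd.sub (h.measurable_opD (measurable_nextState hd))).sub (h.measurable_opD hη)
  have hstep : ∀ N, lux R Q₀ (d - S (N + 1)) ≤
      ENNReal.ofReal (contr β) * lux R Q₀ (d - S N) + lux R Q₀ Res := by
    intro N
    have h1 := h.opD_sub_ae (measurable_nextState hd) (measurable_nextState (hSm N))
        (by rw [lux_nextState h.invariant hd]; exact hdl)
        (by rw [lux_nextState h.invariant (hSm _)]; exact hSl _)
    have e : nextState d - nextState (S N) = nextState (d - S N) := rfl
    rw [e] at h1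
    have h2 : d - S (N + 1) =ᵐ[Q₀]
        opD β θ u Q (nextState v) (nextState (d - S N)) + Res := by
      filter_upwards [h1, hDS N] with x hx1 hx2
      simp only [Pi.sub_apply] at hx1 hx2 ⊢
      rw [Pi.add_apply, hx1, hx2]
      simp only [hRes, opD₁]
      ring
    have hm : Measurable (nextState (d - S N)) := measurable_nextState (hd.sub (hSm N))
    rw [lux_congr_ae h2]
    refine (lux_add_le (h.measurable_opD hm)).trans ?_
    gcongr
    refine (h.lux_opD_le hm).trans (le_of_eq ?_)
    rw [lux_nextState h.invariant (hd.sub (hSm N))]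
  have hx : lux R Q₀ (d - w) < ∞ := by
    rw [sub_eq_add_neg]
    refine (lux_add_le hd).trans_lt (ENNReal.add_lt_top.2 ⟨(h.lux_lt_top_iff hd).1 hdl, ?_⟩)
    rwa [lux_neg]
  have hlim : lux R Q₀ (d - w) ≤
      ENNReal.ofReal (contr β) * lux R Q₀ (d - w) + lux R Q₀ Res := by
    have hN : ∀ N, lux R Q₀ (d - w) ≤
        ENNReal.ofReal (contr β) * (lux R Q₀ (d - w) + t N) + lux R Q₀ Res + t (N + 1) := by
      intro N
      have e1 : d - w = (d - S (N + 1)) + fun x => S (N + 1) x - w x := by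
        ext x; simp only [Pi.sub_apply, Pi.add_apply]; ring
      have e2 : d - S N = (d - w) + -fun x => S N x - w x := by
        ext x; simp only [Pi.sub_apply, Pi.add_apply, Pi.neg_apply]; ring
      have h1 : lux R Q₀ (d - S N) ≤ lux R Q₀ (d - w) + t N := by
        conv_lhs => rw [e2]
        refine (lux_add_le (hd.sub hwm)).trans ?_
        rw [lux_neg]
        exact add_le_add le_rfl (hw N)
      conv_lhs => rw [e1]
      refine (lux_add_le (hd.sub (hSm _))).trans (add_le_add ?_ (hw (N + 1)))
      exact (hstep N).trans (add_le_add (mul_le_mul_right h1 _) le_rfl)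
    have hlimt : Tendsto (fun N => ENNReal.ofReal (contr β) * (lux R Q₀ (d - w) + t N) +
        lux R Q₀ Res + t (N + 1)) atTop
        (𝓝 (ENNReal.ofReal (contr β) * (lux R Q₀ (d - w) + 0) + lux R Q₀ Res + 0)) := by
      refine Tendsto.add (Tendsto.add ?_ tendsto_const_nhds) ((tendsto_add_atTop_iff_nat 1).2 htend)
      exact ENNReal.Tendsto.const_mul (tendsto_const_nhds.add htend)
        (Or.inr ENNReal.ofReal_ne_top)
    simpa using ge_of_tendsto' hlimt hN
  have hfin := le_of_le_mul_add hcp hc1 hx.ne hlim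
  refine (h.lux_two_le (hd.sub hwm)).trans ((mul_le_mul_right hfin _).trans ?_)
  rw [← mul_assoc, ← ENNReal.ofReal_mul hR0.le, mul_one_div]
  exact mul_le_mul_right (lux_antitone_threshold h.two_le _ _) _

end Reference

end Reference

end RobustValue

namespace RobustValue

/-! ### From the score to the log likelihood ratio, and the pointwise residual -/

section Expansion

variable {X : Type*} [MeasurableSpace X]
  {β θ r : ℝ} {Q₀ : Measure X} [IsProbabilityMeasure Q₀] {Q Q' : Kernel X X} [IsMarkovKernel Q]
  {u : X × X → ℝ} {v : X → ℝ}

/-- A fixed point in the Orlicz heart provides the standing facts about the reference model. -/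
theorem IsValueFn.exists_reference (hβ0 : 0 < β) (hβ1 : β < 1) (hQ : Kernel.Invariant Q Q₀)
    (hr : 1 < r) (hu : MemE r (Q₀ ⊗ₘ Q) u) (hv : IsValueFn β θ r u Q₀ Q v) :
    ∃ R, Reference β θ R u Q₀ Q v := by
  have hwm : Measurable fun z => alpha β θ * u z := hu.measurable.const_mul _
  have hVm := measurable_value_add (β := β) (θ := θ) hu.measurable hv.mem.measurable
  have hV := allExp_value_add (β := β) (θ := θ) hQ hr hu hv.mem
  set J := ∫⁻ z, ENNReal.ofReal
    (Real.exp (3 * (2 / (1 - β)) / (1 - β) * |alpha β θ * u z|)) ∂(Q₀ ⊗ₘ Q) with hJ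
  have hJfin : J < ∞ := allExp_alpha_mul (β := β) (θ := θ) hr hu _
  -- The threshold must be at least 2 for comparison with the φ₁-norm, and at least J to dominate
  -- the density moment.
  refine ⟨max 2 J.toReal, hβ0, hβ1, hQ, hu.measurable, hv.mem.measurable, hV, ?_,
    le_max_left _ _, ?_⟩
  · filter_upwards [hV.ae_slice hVm, hv.fixed] with x h1 h2
    exact integral_exp_of_mul_logInt (h1.integrable_exp (hVm.comp measurable_prodMk_left))
      hβ0.ne' h2
  · refine (lintegral_dens_rpow_le hQ hβ0 hβ1 hv.mem.measurable hwm
      (reference_fix hQ hβ0.ne' hr hu hv) (hv.mem.allExp hr) (q := 2 / (1 - β)) ?_).trans ?_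
    · rw [le_div_iff₀ (by linarith)]; linarith
    · exact (ENNReal.ofReal_toReal hJfin.ne).symm.le.trans
        (ENNReal.ofReal_le_ofReal (le_max_right _ _))

variable [MeasurableSpace.CountablyGenerated X]

theorem measurable_score (Q Q' : Kernel X X) [IsMarkovKernel Q] : Measurable (score Q Q') :=
  (measurable_logLik Q Q').sub
    ((measurable_condE Q (measurable_logLik Q Q')).comp measurable_fst)

theorem AM2.lux_score_lt_top {M p : ℝ} (hr : 1 < r) (h : AM2 β θ r M p u Q₀ Q Q') :
    lux 2 (Q₀ ⊗ₘ Q) (score Q Q') < ∞ := by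
  have hl := h.lux_logLik_lt_top hr
  have hlm := measurable_logLik Q Q'
  have e : score Q Q' = logLik Q Q' + -fun z : X × X => condE Q (logLik Q Q') z.1 := by
    ext z; simp [score, sub_eq_add_neg]
  rw [e]
  refine (lux_add_le hlm).trans_lt (ENNReal.add_lt_top.2 ⟨hl, ?_⟩)
  rw [lux_neg, lux_currentState (measurable_condE Q hlm)]
  exact (lux_condE_le hlm).trans_lt hl

/-- A score of norm below t ≤ 1 has e^{|η|} integrable, and on each slice ℓ differs from η by a
constant. -/
theorem ae_integrable_exp_abs_logLik {t : ℝ} (ht1 : t ≤ 1)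
    (h : lux 2 (Q₀ ⊗ₘ Q) (score Q Q') < ENNReal.ofReal t) :
    ∀ᵐ x ∂Q₀, Integrable (fun y => Real.exp |logLik Q Q' (x, y)|) (Q x) := by
  obtain ⟨ht, hexp⟩ := expI_le_of_lux_lt h
  have habs : Measurable fun z : X × X => |score Q Q' z| :=
    continuous_abs.measurable.comp (measurable_score Q Q')
  have hfin : ∫⁻ z, ENNReal.ofReal (Real.exp (|score Q Q' z|)) ∂(Q₀ ⊗ₘ Q) < ∞ := by
    refine lt_of_le_of_lt (lintegral_mono fun z => ENNReal.ofReal_le_ofReal ?_)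
      (hexp.trans_lt ENNReal.ofReal_lt_top)
    rw [Real.exp_le_exp, le_div_iff₀ ht]
    exact mul_le_of_le_one_right (abs_nonneg _) ht1
  filter_upwards [ae_integrable_exp_slice habs hfin] with x hx
  have hx' : Integrable (fun y => Real.exp (|score Q Q' (x, y)| + |condE Q (logLik Q Q') x|))
      (Q x) := by
    simp_rw [Real.exp_add]
    exact hx.mul_const _
  refine integrable_exp_of_le
    (continuous_abs.measurable.comp ((measurable_logLik Q Q').comp measurable_prodMk_left)) hx'
    fun y => ?_
  have : logLik Q Q' (x, y) = score Q Q' (x, y) + condE Q (logLik Q Q') x := by simp [score]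
  rw [this]
  exact abs_add_le _ _

/-- The conditional mean of the log likelihood ratio is dominated by the symmetrized cumulant of
the score. -/
theorem ae_abs_condE_logLik_le {t : ℝ} (ht1 : t ≤ 1) (hac : MutuallyAC Q Q') [IsMarkovKernel Q']
    (h : lux 2 (Q₀ ⊗ₘ Q) (score Q Q') < ENNReal.ofReal t) :
    ∀ᵐ x ∂Q₀, |condE Q (logLik Q Q') x| ≤
      |kappa Q (score Q Q') x + kappa Q (-score Q Q') x| := by
  filter_upwards [ae_integrable_exp_abs_logLik ht1 h] with x hx
  obtain ⟨h1, h2, h3⟩ := logInt_score ((measurable_logLik Q Q').comp measurable_prodMk_left)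
    (integral_exp_logLik hac x) hx (η := fun y => score Q Q' (x, y)) fun y => rfl
  have e1 : kappa Q (score Q Q') x = logInt (Q x) (fun y => score Q Q' (x, y)) := rfl
  have e2 : kappa Q (-score Q Q') x = logInt (Q x) (fun y => -score Q Q' (x, y)) := rfl
  have e3 : condE Q (logLik Q Q') x = -logInt (Q x) (fun y => score Q Q' (x, y)) := by
    rw [h1, neg_neg]; rfl
  rw [e1, e2, e3, abs_neg, abs_of_nonneg h2, abs_of_nonneg (add_nonneg h2 h3)]
  linarith

/-- The log likelihood ratio is controlled by the score. -/
theorem exists_lux_logLik_le (hκ : FrechetDiffAtZero 1 (Q₀ ⊗ₘ Q) Q₀ (kappa Q)) :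
    ∃ δ : ℝ, 0 < δ ∧ ∀ (Q' : Kernel X X) [IsMarkovKernel Q'], MutuallyAC Q Q' →
      ∀ t : ℝ, t ≤ δ → lux 2 (Q₀ ⊗ₘ Q) (score Q Q') < ENNReal.ofReal t →
        lux 2 (Q₀ ⊗ₘ Q) (logLik Q Q') ≤ ENNReal.ofReal (2 * t) := by
  obtain ⟨δ, hδ, hκδ⟩ := hκ.symm_small one_pos
  refine ⟨min δ 1, by positivity, fun Q' _ hac t ht h => ?_⟩
  have ht0 := (expI_le_of_lux_lt h).1
  have hlm := measurable_logLik Q Q'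
  have hk : lux 2 Q₀ (condE Q (logLik Q Q')) ≤ ENNReal.ofReal t := by
    refine (lux_mono_ae (ae_abs_condE_logLik_le (ht.trans (min_le_right _ _)) hac h)).trans ?_
    refine (hκδ _ (measurable_score Q Q') (h.le.trans (ENNReal.ofReal_le_ofReal
      (ht.trans (min_le_left _ _))))).trans ?_
    simpa using h.le
  have e : logLik Q Q' = score Q Q' + fun z : X × X => condE Q (logLik Q Q') z.1 := by
    ext z; simp [score]
  rw [e, two_mul, ENNReal.ofReal_add ht0.le ht0.le]
  refine (lux_add_le (measurable_score Q Q')).trans (add_le_add h.le ?_)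
  rwa [lux_currentState (measurable_condE Q hlm)]

/-- This is β times `FixedPair.abs_linearization_le`: β completes the first two terms to
subgradients, and is dropped from the last two since β < 1. -/
theorem abs_residual_le {v' : X → ℝ} [IsMarkovKernel Q'] (hβ0 : 0 < β) (hβ1 : β < 1)
    (hac : MutuallyAC Q Q') {x : X}
    (hl : Integrable (fun y => Real.exp |logLik Q Q' (x, y)|) (Q x))
    (h : FixedPair (Q x) (fun y => v y + alpha β θ * u (x, y))
      (fun y => v' y + alpha β θ * u (x, y)) (fun y => logLik Q Q' (x, y)) (v x / β) (v' x / β)) :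
    |(v' - v) x - opD₁ β θ u Q (nextState v) (v' - v) x -
        opD β θ u Q (nextState v) (score Q Q') x| ≤
      |opD₁ β θ u Q (score Q Q' + nextState v) (v' - v) x -
        opD₁ β θ u Q (nextState v) (v' - v) x| +
      |opD₁ β θ u Q (score Q Q' + nextState (v' - v) + nextState v) (v' - v) x -
        opD₁ β θ u Q (nextState v) (v' - v) x| +
      |logInt (Q x) (fun y => (v y + alpha β θ * u (x, y) - v x / β) + score Q Q' (x, y)) -
        ∫ y, Real.exp (v y + alpha β θ * u (x, y) - v x / β) * score Q Q' (x, y) ∂(Q x)| +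
      |kappa Q (score Q Q') x + kappa Q (-score Q Q') x| := by
  have key := h.abs_linearization_le (integral_exp_logLik hac x) hl
    (η := fun y => score Q Q' (x, y)) fun y => rfl
  have hd : (fun y => v' y + alpha β θ * u (x, y) - (v y + alpha β θ * u (x, y))) =
      fun y => (v' - v) y := by
    ext y; simp
  rw [hd] at key
  have e0 : opD₁ β θ u Q (nextState v) (v' - v) x =
      β * tilt (Q x) (fun y => v y + alpha β θ * u (x, y)) (fun y => (v' - v) y) := rfl
  have e1 : opD β θ u Q (nextState v) (score Q Q') x =
      β * tilt (Q x) (fun y => v y + alpha β θ * u (x, y)) (fun y => score Q Q' (x, y)) := rfl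
  have e2 : opD₁ β θ u Q (score Q Q' + nextState v) (v' - v) x =
      β * tilt (Q x) (fun y => score Q Q' (x, y) + (v y + alpha β θ * u (x, y)))
        (fun y => (v' - v) y) := by
    rw [opD₁, opD_eq_tilt]
    simp only [Pi.add_apply, nextState, add_assoc]
  have e3 : opD₁ β θ u Q (score Q Q' + nextState (v' - v) + nextState v) (v' - v) x =
      β * tilt (Q x) (fun y => score Q Q' (x, y) + (v' y + alpha β θ * u (x, y)))
        (fun y => (v' - v) y) := by
    rw [opD₁, opD_eq_tilt]
    simp only [Pi.add_apply, Pi.sub_apply, nextState, add_assoc, sub_add_cancel]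
  rw [e0, e1, e2, e3, ← mul_sub, ← mul_sub, abs_mul, abs_mul, abs_of_pos hβ0]
  have e4 : (v' - v) x = β * (v' x / β - v x / β) := by
    rw [Pi.sub_apply]; field_simp
  rw [e4, ← mul_sub, ← mul_sub, abs_mul, abs_of_pos hβ0]
  refine (mul_le_mul_of_nonneg_left key hβ0.le).trans ?_
  rw [mul_add, mul_add, mul_add]
  gcongr ?_ + ?_ + ?_ + ?_
  · exact le_rfl
  · exact le_rfl
  · exact mul_le_of_le_one_left (abs_nonneg _) hβ1.le
  · exact mul_le_of_le_one_left (abs_nonneg _) hβ1.le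

end Expansion

end RobustValue

namespace RobustValue

theorem lux_le_of_abs_le_sum {Ω : Type*} [MeasurableSpace Ω] {R : ℝ} {μ : Measure Ω}
    {f f₁ f₂ f₃ f₄ : Ω → ℝ} (h₁ : Measurable f₁) (h₂ : Measurable f₂) (h₃ : Measurable f₃)
    (h : ∀ᵐ x ∂μ, |f x| ≤ |f₁ x| + |f₂ x| + |f₃ x| + |f₄ x|) :
    lux R μ f ≤ lux R μ f₁ + lux R μ f₂ + lux R μ f₃ + lux R μ f₄ := by
  have habs : ∀ g : Ω → ℝ, lux R μ (fun x => |g x|) = lux R μ g := fun g =>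
    le_antisymm (lux_mono_ae (Eventually.of_forall fun x => (abs_abs _).le))
      (lux_mono_ae (Eventually.of_forall fun x => (abs_abs _).ge))
  have hm : ∀ g : Ω → ℝ, Measurable g → Measurable (fun x => |g x|) := fun g hg =>
    continuous_abs.measurable.comp hg
  calc lux R μ f ≤ lux R μ ((((fun x => |f₁ x|) + fun x => |f₂ x|) + fun x => |f₃ x|) +
        fun x => |f₄ x|) := lux_mono_ae (h.mono fun x hx => hx.trans (le_abs_self _))
    _ ≤ _ := (lux_add_le (((hm _ h₁).add (hm _ h₂)).add (hm _ h₃))).trans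
        (add_le_add ((lux_add_le ((hm _ h₁).add (hm _ h₂))).trans
          (add_le_add (lux_add_le (hm _ h₁)) le_rfl)) le_rfl)
    _ = _ := by rw [habs, habs, habs, habs]

/-! ### The residual is of smaller order than the score -/

section Expansion

variable {X : Type*} [MeasurableSpace X] [MeasurableSpace.CountablyGenerated X]
  {β θ r : ℝ} {Q₀ : Measure X} [IsProbabilityMeasure Q₀] {Q : Kernel X X} [IsMarkovKernel Q]
  {u : X × X → ℝ} {v : X → ℝ}

/-- The residual of the linearized fixed-point equation at `v' - v` is of smaller order than the
score, uniformly over the alternative models. -/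
theorem exists_lux_residual_le (hβ0 : 0 < β) (hβ1 : β < 1) (hQ : Kernel.Invariant Q Q₀)
    (hr : 1 < r) (hu : MemE r (Q₀ ⊗ₘ Q) u) (hv : IsValueFn β θ r u Q₀ Q v)
    (hκ : FrechetDiffAtZero 1 (Q₀ ⊗ₘ Q) Q₀ (kappa Q))
    (hD : SubgradientContinuousAt β θ u Q₀ Q v) (M : ℝ) {p : ℝ} (hp : 1 < p)
    {ε : ℝ} (hε : 0 < ε) :
    ∃ δ : ℝ, 0 < δ ∧ ∀ (Q' : Kernel X X) [IsMarkovKernel Q'] (v' : X → ℝ),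
      AM2 β θ r M p u Q₀ Q Q' → IsValueFn β θ r u Q₀ Q' v' → ∀ t : ℝ, t ≤ δ →
        lux 2 (Q₀ ⊗ₘ Q) (score Q Q') < ENNReal.ofReal t →
        lux 2 Q₀ (fun x => (v' - v) x - opD₁ β θ u Q (nextState v) (v' - v) x -
          opD β θ u Q (nextState v) (score Q Q') x) ≤ ENNReal.ofReal (ε * t) := by
  obtain ⟨C, hC, hLip⟩ := exists_lux_value_sub_le hβ0 hβ1 hQ hr hu hv M hp
  obtain ⟨R, hRef⟩ := hv.exists_reference hβ0 hβ1 hQ hr hu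
  obtain ⟨δ₁, hδ₁, hcont⟩ := hD.exists_lux_le (ε := ε / (4 * (2 * C + 1))) (by positivity)
  have hgm : Measurable fun z : X × X => v z.2 + alpha β θ * u z - v z.1 / β :=
    hRef.measurable_sum.sub ((hv.mem.measurable.comp measurable_fst).div_const β)
  have hg : AllExp (Q₀ ⊗ₘ Q) fun z : X × X => v z.2 + alpha β θ * u z - v z.1 / β := by
    have h1 := ((hv.mem.allExp hr).currentState (P := Q) hv.mem.measurable).const_mul (-(1 / β))
    have h2 := hRef.allExp.add h1 hRef.measurable_sum
    convert h2 using 1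
    ext z
    simp only [Pi.add_apply]
    ring
  have hg1 : ∀ᵐ x ∂Q₀, ∫ y, Real.exp (v y + alpha β θ * u (x, y) - v x / β) ∂(Q x) = 1 := by
    filter_upwards [hRef.fixed] with x hx
    simp_rw [sub_eq_add_neg _ (v x / β)]
    rw [integral_exp_add_const, hx, ← Real.exp_add]
    simp
  obtain ⟨δ₂, hδ₂, htilt⟩ := tilted_remainder_small hκ hgm hg hg1 (ε := ε / 4) (by positivity)
  obtain ⟨δ₃, hδ₃, hsymm⟩ := hκ.symm_small (ε := ε / 4) (by positivity)
  obtain ⟨δ₄, hδ₄, hlog⟩ := exists_lux_logLik_le hκ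
  -- The denominator 2C + 2 accounts for the perturbation η + (v' - v), whose norm is at most t +
  -- (2C + 1)t.
  refine ⟨min (min (δ₁ / (2 * C + 2)) δ₂) (min (min δ₃ δ₄) 1), by positivity,
    fun Q' _ v' hAM hv' t ht h => ?_⟩
  simp only [le_min_iff] at ht
  obtain ⟨⟨ht₁, ht₂⟩, ⟨ht₃, ht₄⟩, ht1⟩ := ht
  have ht0 := (expI_le_of_lux_lt h).1
  have hηm := measurable_score Q Q'
  have hdm : Measurable (v' - v) := hv'.mem.measurable.sub hv.mem.measurable
  rw [le_div_iff₀ (by positivity)] at ht₁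
  -- The Lipschitz bound gives 2Ct; the additional t makes the inequality strict, as `hcont`
  -- requires.
  have hd : lux 2 Q₀ (v' - v) < ENNReal.ofReal ((2 * C + 1) * t) := by
    refine ((hLip Q' v' hAM hv').trans (mul_le_mul_right (hlog Q' hAM.1 t ht₄ h) _)).trans_lt ?_
    rw [← ENNReal.ofReal_mul hC]
    exact (ENNReal.ofReal_lt_ofReal_iff (by positivity)).2 (by linarith)
  have hεt : ε / (4 * (2 * C + 1)) * ((2 * C + 1) * t) = ε / 4 * t := by field_simp
  have h₁ := hcont (score Q Q') hηm (h.le.trans (ENNReal.ofReal_le_ofReal (by nlinarith)))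
    (v' - v) _ hdm hd
  have h₂ := hcont (score Q Q' + nextState (v' - v)) (hηm.add (measurable_nextState hdm)) (by
      refine (lux_add_le hηm).trans ?_
      rw [lux_nextState hQ hdm]
      refine (add_le_add h.le hd.le).trans ?_
      rw [← ENNReal.ofReal_add ht0.le (by positivity)]
      exact ENNReal.ofReal_le_ofReal (by linarith)) (v' - v) _ hdm hd
  rw [hεt] at h₁ h₂
  have h₃ := htilt (score Q Q') hηm t ht0 ht₂ h
  have h₄ : lux 2 Q₀ (fun x => kappa Q (score Q Q') x + kappa Q (-score Q Q') x) ≤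
      ENNReal.ofReal (ε / 4 * t) := by
    refine (hsymm _ hηm (h.le.trans (ENNReal.ofReal_le_ofReal ht₃))).trans ?_
    rw [ENNReal.ofReal_mul (by positivity)]
    exact mul_le_mul_right h.le _
  have hpt := ae_fixedPair hQ hβ0.ne' hr hu hv hv' hAM.1 (hAM.lux_logLik_lt_top hr)
    (hAM.ae_moment hr hp)
  have hopm : ∀ g : X × X → ℝ, Measurable g → Measurable (opD₁ β θ u Q g (v' - v)) :=
    fun g hg => measurable_opD β θ hu.measurable Q hg (measurable_nextState hdm)
  have hnv := measurable_nextState hv.mem.measurable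
  refine (lux_le_of_abs_le_sum ((hopm _ (hηm.add hnv)).sub (hopm _ hnv))
    ((hopm _ ((hηm.add (measurable_nextState hdm)).add hnv)).sub (hopm _ hnv))
    ((measurable_logInt Q (hgm.add hηm)).sub
      (measurable_condE Q ((Real.measurable_exp.comp hgm).mul hηm)))
    (f₄ := fun x => kappa Q (score Q Q') x + kappa Q (-score Q Q') x) ?_).trans
      ((add_le_add (add_le_add (add_le_add h₁ h₂) h₃) h₄).trans (le_of_eq ?_))
  · filter_upwards [hpt, ae_integrable_exp_abs_logLik ht1 h] with x hx hx'
    exact abs_residual_le hβ0 hβ1 hAM.1 hx' hx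
  · rw [← ENNReal.ofReal_add (by positivity) (by positivity),
      ← ENNReal.ofReal_add (by positivity) (by positivity),
      ← ENNReal.ofReal_add (by positivity) (by positivity)]
    congr 1
    ring

end Expansion

end RobustValue

/-! ### Conclusion: residual bound combined with the Neumann series -/

theorem lemma5p3 {X : Type*} [MeasurableSpace X] [MeasurableSpace.CountablyGenerated X]
    (β θ : ℝ) (hβ₀ : 0 < β) (hβ₁ : β < 1) (hθ : 0 < θ)
    (Q₀ : Measure X) [IsProbabilityMeasure Q₀] (Q : Kernel X X) [IsMarkovKernel Q]
    (hQ : Kernel.Invariant Q Q₀)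
    (u : X × X → ℝ) (r : ℝ) (hr : 1 < r) (hu : MemE r (Q₀ ⊗ₘ Q) u)
    (v : X → ℝ) (hv : IsValueFn β θ r u Q₀ Q v)
    (hκ : FrechetDiffAtZero 1 (Q₀ ⊗ₘ Q) Q₀ (kappa Q))
    (hD : SubgradientContinuousAt β θ u Q₀ Q v)
    (M : ℝ)
    (hM : ∫⁻ z, ENNReal.ofReal (Real.exp (|alpha β θ / (1 - β) * u z| ^ r)) ∂(Q₀ ⊗ₘ Q)
      ≤ ENNReal.ofReal M)
    (p : ℝ) (hp : 1 < p) :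
    ∀ ε : ℝ, 0 < ε → ∃ δ : ℝ, 0 < δ ∧
      ∀ (Q' : Kernel X X) [IsMarkovKernel Q'] (v' : X → ℝ),
        AM2 β θ r M p u Q₀ Q Q' → IsValueFn β θ r u Q₀ Q' v' →
        ∃ w : X → ℝ, HasOrliczSum 1 Q₀ (seriesTerm β θ u Q v (score Q Q')) w ∧
          (orliczNorm 1 (Q₀ ⊗ₘ Q) (score Q Q') ≤ ENNReal.ofReal δ →
            orliczNorm 1 Q₀ (v' - v - w)
              ≤ ENNReal.ofReal ε * orliczNorm 1 (Q₀ ⊗ₘ Q) (score Q Q')) := by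
  intro ε hε
  obtain ⟨R, hRef⟩ := hv.exists_reference hβ₀ hβ₁ hQ hr hu
  have hρ : 0 < 1 - contr β := by linarith [contr_lt_one hβ₀ hβ₁]
  have hR : 0 < R := by linarith [hRef.two_le]
  -- This tolerance compensates the factor R/(1 - contr β) lost in `Reference.exists_series`.
  obtain ⟨δ, hδ, hres⟩ := exists_lux_residual_le hβ₀ hβ₁ hQ hr hu hv hκ hD M hp
    (ε := ε * (1 - contr β) / R) (by positivity)
  refine ⟨δ / 2, by positivity, fun Q' _ v' hAM hv' => ?_⟩
  obtain ⟨w, hw, hdw⟩ := hRef.exists_series (measurable_score Q Q') (hAM.lux_score_lt_top hr)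
  refine ⟨w, hw, fun hle => ?_⟩
  rw [orliczNorm_one_eq_lux] at hle ⊢
  rw [orliczNorm_one_eq_lux]
  have hdm : Measurable (v' - v) := hv'.mem.measurable.sub hv.mem.measurable
  have hdl : lux 2 Q₀ (v' - v) < ∞ := by
    obtain ⟨C, -, hC⟩ := exists_lux_value_sub_le hβ₀ hβ₁ hQ hr hu hv M hp
    exact (hC Q' v' hAM hv').trans_lt
      (ENNReal.mul_lt_top ENNReal.ofReal_lt_top (hAM.lux_logLik_lt_top hr))
  have hε' : ENNReal.ofReal ε ≠ 0 := by simpa using hε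
  rw [mul_comm, ← ENNReal.div_le_iff_le_mul (Or.inl hε') (Or.inl ENNReal.ofReal_ne_top)]
  -- The norm of the score is approached from above by reals c, which also covers a score of norm
  -- zero. Halving δ keeps the norm strictly below min c δ.
  refine le_of_forall_ofReal_lt fun c hc => ?_
  rw [ENNReal.div_le_iff_le_mul (Or.inl hε') (Or.inl ENNReal.ofReal_ne_top)]
  have hlt : lux 2 (Q₀ ⊗ₘ Q) (score Q Q') < ENNReal.ofReal (min c δ) := by
    rw [ENNReal.ofReal_min]
    exact lt_min hc (hle.trans_lt ((ENNReal.ofReal_lt_ofReal_iff hδ).2 (by linarith)))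
  refine (hdw _ hdm hdl).trans ((mul_le_mul_right
    (hres Q' v' hAM hv' (min c δ) (min_le_right _ _) hlt) _).trans ?_)
  have ht0 := (expI_le_of_lux_lt hlt).1
  have e : R / (1 - contr β) * (ε * (1 - contr β) / R * min c δ) = min c δ * ε := by
    field_simp
  rw [← ENNReal.ofReal_mul (by positivity), e, ENNReal.ofReal_mul ht0.le]
  exact mul_le_mul_left (ENNReal.ofReal_le_ofReal (min_le_left _ _)) _
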